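/- **Theorem.** Write $V=\{x_{ij}: 1\le i\ne j\le 4\}$. Two icosahedra (boundary complexes) $I_1,I_2$ with a common vertex set are *antimorphic* if, in their edge graphs, any two vertices are at distance one (respectively two) in $I_1$ if and only if they are at distance two (respectively one) in $I_2$. For an antimorphic pair and each triangle $\Delta=abc$ of $I_1$ there is a unique triangle $\varphi(\Delta)=ijk$ of $I_2$ such that, for a suitable naming of its vertices, $aij$, $bjk$, $cik$ are triangles of $I_2$; let $K(I_1,I_2)$ be the simplicial complex whose facets are the sets of neighbours in $I_1$ of the vertices, and the sets $(\Delta\cup\varphi(\Delta))\setminus\{y\}$ with $\Delta$ a triangle of $I_1$ and $y\in\varphi(\Delta)$. Let $$g=(x_{12}x_{21}x_{24}x_{42}x_{14}x_{41}x_{43}x_{34}x_{13}x_{31}x_{32}x_{23}),\qquad h=(x_{12}x_{14}x_{21}x_{24}x_{31})(x_{13}x_{42}x_{43}x_{32}x_{34}).$$ Let $I_1$ be the icosahedron on $V$ in which $x_{23}$ and $x_{41}$ are antipodal, $x_{23}$ has the link $x_{12}x_{14}x_{21}x_{24}x_{31}$ and $x_{41}$ has the link $x_{13}x_{42}x_{43}x_{32}x_{34}$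 (5-cycles in this cyclic order), and $x_{13}$ is adjacent to $x_{12}$ and $x_{14}$, with the remaining adjacencies obtained by applying $h$; let $I_2=g(I_1)$. (a) $I_1,I_2$ is an antimorphic pair. The complex $(S^2\times S^2)_{12}:=K(I_1,I_2)$ has 12 vertices, and its facets are the images of $x_{12}x_{14}x_{21}x_{24}x_{31}$ and $x_{12}x_{13}x_{14}x_{21}x_{31}$ under the group $\langle g,h\rangle$. For every antimorphic pair of icosahedra $J_1,J_2$, the complex $K(J_1,J_2)$ is isomorphic to $(S^2\times S^2)_{12}$. (b) The geometric carrier of $(S^2\times S^2)_{12}$ is homeomorphic to $S^2\times S^2$. (c) Let $(S^2\times S^2)'_{16}$ be the complex with vertices $x_{ij}$ $(1\le i,j\le 4)$ whose facets are the images, under $A_4$ acting on the indices, of $x_{11}x_{12}x_{13}x_{21}x_{31}$, $x_{11}x_{12}x_{14}x_{21}x_{31}$, $x_{11}x_{13}x_{14}x_{21}x_{31}$, $x_{12}x_{13}x_{23}x_{31}x_{32}$, $x_{12}x_{14}x_{21}x_{24}x_{31}$, $x_{12}x_{14}x_{24}x_{31}x_{34}$, $x_{12}x_{21}x_{24}x_{31}x_{32}$,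 $x_{12}x_{24}x_{31}x_{32}x_{34}$. It has 16 vertices and, with $x_{ij}=(x_i,x_j)$, it is a simplicial subdivision of the product cell complex $\partial T\times\partial T$, where $T$ is the tetrahedron $x_1x_2x_3x_4$. The complex $(S^2\times S^2)_{12}$ is obtained from it by a finite sequence of generalized bistellar moves. (Such a move replaces a pure $d$-dimensional complex $X$ by the complex $(X\setminus D)\cup\widehat D$, where $D\subseteq X$ and $\widehat D$ are triangulated $d$-balls with $\partial D=\partial\widehat D=\widehat D\cap X$; here $d=4$.) (d) The full automorphism group $G$ of $(S^2\times S^2)_{12}$ equals $\langle g,h\rangle$ and has order 240. It is a non-split central extension of $S_5$ by $\mathbb Z_2$, namely the one in which the preimage of $A_5$ is isomorphic to $A_5\times\mathbb Z_2$. -/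

import Mathlib

/-! ## Finite simplicial complexes -/

namespace SimplicialSurgery

/-- The simplicial complex generated by a family of finite sets: all nonempty subsets of its
members. -/
def generatedBy {V : Type*} (F : Set (Finset V)) : PreAbstractSimplicialComplex V where
  faces := {t | t.Nonempty ∧ ∃ s ∈ F, t ⊆ s}
  isRelLowerSet_faces := by
    rintro t ⟨ht, s, hs, hts⟩
    exact ⟨ht, fun u hut hu => ⟨hu, s, hs, hut.trans hts⟩⟩

/-- The vertices of a simplicial complex. -/
def vertexSet {V : Type*} (K : PreAbstractSimplicialComplex V) : Set V :=
  {v | {v} ∈ K.faces}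

/-- The geometric carrier `|K|`: the functions `V → [0, 1]` with sum `1` whose support is a simplex
of `K`, topologized as a subspace of `V → ℝ`. -/
def carrier {V : Type*} [Fintype V] (K : PreAbstractSimplicialComplex V) : Set (V → ℝ) :=
  {f | (∀ v, 0 ≤ f v) ∧ ∑ v, f v = 1 ∧ ∃ s ∈ K.faces, ∀ v, f v ≠ 0 ↔ v ∈ s}

/-- `K` triangulates the topological space `Y`. -/
def Triangulates {V : Type*} [Fintype V] (K : PreAbstractSimplicialComplex V)
    (Y : Type*) [TopologicalSpace Y] : Prop :=
  Nonempty (carrier K ≃ₜ Y)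

/-- `e` is an isomorphism between `K` and `L`; `V` and `W` are meant to be their vertex sets. -/
def IsIso {V W : Type*} (K : PreAbstractSimplicialComplex V) (L : PreAbstractSimplicialComplex W)
    (e : V ≃ W) : Prop :=
  ∀ s : Finset V, s.map e.toEmbedding ∈ L.faces ↔ s ∈ K.faces

/-- The full automorphism group of a simplicial complex with vertex set `V`. -/
def Aut {V : Type*} (K : PreAbstractSimplicialComplex V) : Subgroup (Equiv.Perm V) where
  carrier := {e | IsIso K K e}
  one_mem' := fun s => by
    have h : s.map (Equiv.toEmbedding (1 : Equiv.Perm V)) = s := by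
      exact Finset.map_refl
    rw [h]
  mul_mem' := by
    intro a b ha hb s
    have h : s.map (Equiv.toEmbedding (a * b)) = (s.map b.toEmbedding).map a.toEmbedding := by
      rw [Finset.map_map]; rfl
    rw [h]
    exact (ha _).trans (hb s)
  inv_mem' := by
    intro a ha s
    have h : (s.map (Equiv.toEmbedding a⁻¹)).map a.toEmbedding = s := by
      rw [Finset.map_map]
      ext v; simp
    have := ha (s.map (Equiv.toEmbedding a⁻¹))
    rw [h] at this
    exact this.symm

/-- The edge graph of a simplicial complex. -/
def edgeGraph {V : Type*} [DecidableEq V] (K : PreAbstractSimplicialComplex V) :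
    SimpleGraph V where
  Adj x y := x ≠ y ∧ {x, y} ∈ K.faces
  symm := ⟨fun x y h => ⟨h.1.symm, by rw [Finset.pair_comm]; exact h.2⟩⟩
  loopless := ⟨fun _ h => h.1 rfl⟩

/-- The triangles (two-dimensional simplices) of a simplicial complex. -/
def triangles {V : Type*} (K : PreAbstractSimplicialComplex V) : Set (Finset V) :=
  {s | s ∈ K.faces ∧ s.card = 3}

/-! ## Generalized bistellar moves -/

/-- `K` is pure of dimension `d`: all its maximal simplices are `d`-dimensional. -/
def IsPure {V : Type*} (d : ℕ) (K : PreAbstractSimplicialComplex V) : Prop :=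
  ∀ s, Maximal (· ∈ K.faces) s → s.card = d + 1

/-- The boundary complex of a triangulated `d`-ball (`1 ≤ d`): it is generated by the
`(d - 1)`-simplices lying in exactly one `d`-simplex. -/
def boundary {V : Type*} (d : ℕ) (D : PreAbstractSimplicialComplex V) :
    PreAbstractSimplicialComplex V :=
  generatedBy {r | r ∈ D.faces ∧ r.card = d ∧ ∃! s, s ∈ D.faces ∧ s.card = d + 1 ∧ r ⊆ s}

/-- `D` is a triangulation of the `d`-ball. -/
def IsTriangulatedBall {V : Type*} [Fintype V] (d : ℕ) (D : PreAbstractSimplicialComplex V) :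
    Prop :=
  Triangulates D (Metric.closedBall (0 : EuclideanSpace ℝ (Fin d)) 1)

/-- `X'` is obtained from the pure `d`-dimensional complex `X` by a generalized bistellar move: a
triangulated `d`-ball `D ⊆ X` is replaced by a triangulated `d`-ball `D'` such that
`∂D = ∂D' = D' ∩ X`. -/
def IsGBM {V : Type*} [Fintype V] (d : ℕ) (X X' : PreAbstractSimplicialComplex V) : Prop :=
  IsPure d X ∧ ∃ D D' : PreAbstractSimplicialComplex V,
    IsTriangulatedBall d D ∧ IsTriangulatedBall d D' ∧
    boundary d D = boundary d D' ∧ boundary d D' = D' ⊓ X ∧ D ≤ X ∧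
    X'.faces = (X.faces \ D.faces) ∪ D'.faces

/-! ## Antimorphic pairs of icosahedra -/

/-- The boundary complex of the icosahedron. The vertices are two poles `(true, none)` and
`(false, none)` and the two rings `(true, some i)` and `(false, some i)` of their neighbours. -/
def icosahedron : PreAbstractSimplicialComplex (Bool × Option (Fin 5)) :=
  generatedBy
    ({s | ∃ (b : Bool) (i : Fin 5), s = {(b, none), (b, some i), (b, some (i + 1))}} ∪
     {s | ∃ i : Fin 5, s = {(true, some i), (true, some (i + 1)), (false, some i)}} ∪
     {s | ∃ i : Fin 5, s = {(false, some i), (false, some (i + 1)), (true, some (i + 1))}})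

/-- `I` is a copy of the icosahedron with vertex set `V`. -/
def IsIcosahedron {V : Type*} (I : PreAbstractSimplicialComplex V) : Prop :=
  ∃ e : Bool × Option (Fin 5) ≃ V, IsIso icosahedron I e

/-- `f` is an antimorphism: it interchanges the distances one and two. -/
def IsAntimorphism {V W : Type*} [DecidableEq V] [DecidableEq W]
    (I₁ : PreAbstractSimplicialComplex V) (I₂ : PreAbstractSimplicialComplex W) (f : V ≃ W) :
    Prop :=
  ∀ x y : V,
    ((edgeGraph I₁).dist x y = 1 ↔ (edgeGraph I₂).dist (f x) (f y) = 2) ∧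
    ((edgeGraph I₁).dist x y = 2 ↔ (edgeGraph I₂).dist (f x) (f y) = 1)

/-- `I₁` and `I₂` are an antimorphic pair of icosahedra with common vertex set `V`. -/
def IsAntimorphicPair {V : Type*} [DecidableEq V] (I₁ I₂ : PreAbstractSimplicialComplex V) :
    Prop :=
  IsIcosahedron I₁ ∧ IsIcosahedron I₂ ∧ IsAntimorphism I₁ I₂ (Equiv.refl V)

/-- The condition `φ(abc) = ijk` relating a triangle `abc` of `I₁` to a triangle `ijk` of `I₂`:
`aij`, `bjk` and `cik` are triangles of `I₂`. -/
def Corresponds {V : Type*} [DecidableEq V] (I₁ I₂ : PreAbstractSimplicialComplex V)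
    (s t : Finset V) : Prop :=
  s ∈ triangles I₁ ∧ t ∈ triangles I₂ ∧ ∃ a b c i j k : V, s = {a, b, c} ∧ t = {i, j, k} ∧
    {a, i, j} ∈ triangles I₂ ∧ {b, j, k} ∈ triangles I₂ ∧ {c, i, k} ∈ triangles I₂

/-- The complex built from an antimorphic pair of icosahedra. Its facets are the sets of
neighbours in `I₁` of the vertices, and the sets `(Δ ∪ φ(Δ)) \ {y}` with `Δ` a triangle of `I₁` and
`y ∈ φ(Δ)`. -/
def pairComplex {V : Type*} [DecidableEq V] (I₁ I₂ : PreAbstractSimplicialComplex V) :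
    PreAbstractSimplicialComplex V :=
  generatedBy
    ({s | ∃ x, ∀ y, y ∈ s ↔ (edgeGraph I₁).Adj x y} ∪
     {s | ∃ t t' : Finset V, Corresponds I₁ I₂ t t' ∧ ∃ y ∈ t', s = (t ∪ t').erase y})

/-! ## The complex with twelve vertices -/

/-- The symbols `x i j` with `i ≠ j`. The labels `1, 2, 3, 4` of the vertices of the tetrahedron
are taken modulo `4`, i.e. `4` is the element `0` of `Fin 4`. -/
abbrev OffDiag : Type := {p : Fin 4 × Fin 4 // p.1 ≠ p.2}

/-- The vertex `x i j`. -/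
abbrev x (i j : Fin 4) (h : i ≠ j := by decide) : OffDiag := ⟨(i, j), h⟩

/-- The vertex labels of the first icosahedron. -/
def label₁ : Bool × Option (Fin 5) → OffDiag
  | (true, none) => x 2 3
  | (true, some i) => ![x 1 2, x 1 4, x 2 1, x 2 4, x 3 1] i
  | (false, some i) => ![x 1 3, x 4 2, x 4 3, x 3 2, x 3 4] i
  | (false, none) => x 4 1

/-- The vertex labels of the second icosahedron. -/
def label₂ : Bool × Option (Fin 5) → OffDiag
  | (true, none) => x 1 2
  | (true, some i) => ![x 2 1, x 4 1, x 2 4, x 4 2, x 3 2] i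
  | (false, some i) => ![x 3 1, x 1 4, x 3 4, x 2 3, x 1 3] i
  | (false, none) => x 4 3

/-- The first of two explicit antimorphic icosahedra. -/
def ico₁ : PreAbstractSimplicialComplex OffDiag := icosahedron.map label₁

/-- The second of two explicit antimorphic icosahedra. -/
def ico₂ : PreAbstractSimplicialComplex OffDiag := icosahedron.map label₂

/-- The complex `(S² × S²)₁₂`. -/
def S12 : PreAbstractSimplicialComplex OffDiag := pairComplex ico₁ ico₂

/-- The permutation `g` of order twelve. -/
def g : Equiv.Perm OffDiag :=
  [x 1 2, x 2 1, x 2 4, x 4 2, x 1 4, x 4 1, x 4 3, x 3 4, x 1 3, x 3 1, x 3 2, x 2 3].formPerm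

/-- The permutation `h` of order five. -/
def h : Equiv.Perm OffDiag :=
  [x 1 2, x 1 4, x 2 1, x 2 4, x 3 1].formPerm * [x 1 3, x 4 2, x 4 3, x 3 2, x 3 4].formPerm

/-- The group generated by `g` and `h`. -/
def groupGH : Subgroup (Equiv.Perm OffDiag) := Subgroup.closure {g, h}

/-- The two basic facets of `(S² × S²)₁₂` modulo the group generated by `g` and `h`. -/
def basicFacets12 : Set (Finset OffDiag) :=
  {{x 1 2, x 1 4, x 2 1, x 2 4, x 3 1}, {x 1 2, x 1 3, x 1 4, x 2 1, x 3 1}}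

/-! ## The subdivision with sixteen vertices -/

/-- The eight basic facets of `(S² × S²)'₁₆` modulo `A₄`; the pair `(i, j)` is the vertex
`x i j`. -/
def basicFacets16 : Set (Finset (Fin 4 × Fin 4)) :=
  {{(1, 1), (1, 2), (1, 3), (2, 1), (3, 1)},
   {(1, 1), (1, 2), (1, 4), (2, 1), (3, 1)},
   {(1, 1), (1, 3), (1, 4), (2, 1), (3, 1)},
   {(1, 2), (1, 3), (2, 3), (3, 1), (3, 2)},
   {(1, 2), (1, 4), (2, 1), (2, 4), (3, 1)},
   {(1, 2), (1, 4), (2, 4), (3, 1), (3, 4)},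
   {(1, 2), (2, 1), (2, 4), (3, 1), (3, 2)},
   {(1, 2), (2, 4), (3, 1), (3, 2), (3, 4)}}

/-- The complex `(S² × S²)'₁₆`, whose facets form the orbits of the basic facets under the action
of `A₄` on the indices. -/
def S16second : PreAbstractSimplicialComplex (Fin 4 × Fin 4) :=
  generatedBy {s | ∃ a ∈ alternatingGroup (Fin 4), ∃ b ∈ basicFacets16,
    s = b.image (Prod.map a a)}

/-- The geometric face of the standard tetrahedron in `ℝ⁴` spanned by the vertices in `A`. -/
def tetraFace (A : Finset (Fin 4)) : Set (Fin 4 → ℝ) :=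
  convexHull ℝ ((fun i => Pi.single i 1) '' (A : Set (Fin 4)))

/-- The point `(xᵢ, xⱼ)` of the product of two tetrahedra. -/
def vertexPoint (p : Fin 4 × Fin 4) : (Fin 4 → ℝ) × (Fin 4 → ℝ) :=
  (Pi.single p.1 1, Pi.single p.2 1)

/-- `K`, with its vertex `(i, j)` placed at the point `(xᵢ, xⱼ)`, is a simplicial subdivision of the
product cell complex `S²₄ × S²₄ = ∂T × ∂T`, whose cells are the products of two proper faces of the
tetrahedron `T`: the simplices form a geometric simplicial complex, each of them lies in a cell, and
together they fill `|∂T| × |∂T|`. -/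
def IsSubdivisionOfProduct (K : PreAbstractSimplicialComplex (Fin 4 × Fin 4)) : Prop :=
  ∃ G : Geometry.SimplicialComplex ℝ ((Fin 4 → ℝ) × (Fin 4 → ℝ)),
    G.faces = {s : Finset ((Fin 4 → ℝ) × (Fin 4 → ℝ)) | ∃ t ∈ K.faces,
      (s : Set ((Fin 4 → ℝ) × (Fin 4 → ℝ))) = vertexPoint '' (t : Set (Fin 4 × Fin 4))} ∧
    (∀ s ∈ G.faces, ∃ A B : Finset (Fin 4), A ≠ Finset.univ ∧ B ≠ Finset.univ ∧
      convexHull ℝ (s : Set ((Fin 4 → ℝ) × (Fin 4 → ℝ))) ⊆ tetraFace A ×ˢ tetraFace B) ∧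
    G.space = (⋃ A ∈ {A : Finset (Fin 4) | A ≠ Finset.univ}, tetraFace A) ×ˢ
      (⋃ B ∈ {B : Finset (Fin 4) | B ≠ Finset.univ}, tetraFace B)

/-! ## The 2-sphere -/

/-- The standard 2-sphere. -/
abbrev Sphere2 : Type := Metric.sphere (0 : EuclideanSpace ℝ (Fin 3)) 1

end SimplicialSurgery

open SimplicialSurgery

/-!
Let `U` be the disjoint union of blocks of vertices. The join of one block, as a simplex, with the
boundaries of the other blocks is a ball whose boundary, the join of all the boundaries, does not
depend on the chosen block. Exchanging the balls of two blocks `A` and `B` is therefore a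
generalized bistellar move, and if `B` is a nonface it does not change the carrier: the
homeomorphism transports the minimum of the barycentric coordinates on `A` to `B`. Eight such flips
lead from sixteen to twelve vertices. The sixteen-vertex complex is realized affinely on
`∂T × ∂T`; injectivity holds because an affine dependency between points `(xᵢ, xⱼ)` is a matrix
with vanishing row and column sums, whose sign pattern contains an alternating circuit, and no two
faces contain the positive and the negative positions of such a circuit.

In an antimorphic pair the first icosahedron determines the edge graph of the second, hence the
second as a flag complex, so that all antimorphic pairs are isomorphic.

An automorphism preserves the number of facets containing three given vertices, and it is trivial
if it fixes three suitable vertices. There are `240` triples with the count of such a triple, and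
the known elements of `⟨g, h⟩` act transitively on them. The group acts on five colours of pairs of
axes, which gives a surjection `π` onto `S₅` with kernel of order two, and on four classes of
oriented triangles, which gives a homomorphism `ρ` onto `ℤ/4`. The parity of `ρ` is the sign of
`π`, so the group is the fibre product of `S₅` and `ℤ/4` over `ℤ/2`: the preimage of `A₅` is
`A₅ × ℤ/2`, and no involution lies above a transposition.
-/

namespace SimplicialSurgery

/-! ## Geometric carriers -/

section Carrier

variable {V : Type*} [Fintype V] {K : PreAbstractSimplicialComplex V} {f : V → ℝ}

theorem mem_carrier_of_forall {t : Finset V} (h0 : ∀ v, 0 ≤ f v) (h1 : ∑ v, f v = 1)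
    (ht : t ∈ K.faces) (hft : ∀ v, f v ≠ 0 → v ∈ t) : f ∈ carrier K := by
  classical
  refine ⟨h0, h1, Finset.univ.filter (f · ≠ 0), (K.isRelLowerSet_faces ht).2 ?_ ?_, by simp⟩
  · intro v hv
    exact hft v (by simpa using hv)
  · obtain ⟨v, -, hv⟩ := Finset.exists_ne_zero_of_sum_ne_zero (h1.trans_ne one_ne_zero)
    exact ⟨v, by simpa using hv⟩

theorem carrier_subset_Icc (K : PreAbstractSimplicialComplex V) :
    carrier K ⊆ Set.Icc (0 : V → ℝ) 1 := by
  rintro f ⟨h0, h1, -⟩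
  refine ⟨h0, fun v => ?_⟩
  exact (Finset.single_le_sum (fun v _ => h0 v) (Finset.mem_univ v)).trans_eq h1

theorem isClosed_carrier (K : PreAbstractSimplicialComplex V) : IsClosed (carrier K) := by
  have h : carrier K = ⋃ s ∈ K.faces, (stdSimplex ℝ V ∩ ⋂ v ∈ {v | v ∉ s}, {f | f v = 0}) := by
    ext f
    simp only [Set.mem_iUnion, Set.mem_inter_iff, Set.mem_iInter]
    constructor
    · rintro ⟨h0, h1, s, hs, hfs⟩
      exact ⟨s, hs, ⟨h0, h1⟩, fun v hv => not_not.1 fun hne => hv ((hfs v).1 hne)⟩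
    · rintro ⟨s, hs, ⟨h0, h1⟩, hfs⟩
      exact mem_carrier_of_forall h0 h1 hs fun v hv => not_not.1 fun hvs => hv (hfs v hvs)
  rw [h]
  exact (Set.toFinite _).isClosed_biUnion fun s _ => (isClosed_stdSimplex ℝ V).inter
    (isClosed_biInter fun v _ => isClosed_eq (continuous_apply v) continuous_const)

instance (K : PreAbstractSimplicialComplex V) : CompactSpace (carrier K) :=
  isCompact_iff_compactSpace.1
    (isCompact_Icc.of_isClosed_subset (isClosed_carrier K) (carrier_subset_Icc K))

theorem nonempty_homeomorph_of_bijOn {X Y : Type*} [TopologicalSpace X] [TopologicalSpace Y]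
    [T2Space Y] {s : Set X} {t : Set Y} [CompactSpace s] {φ : X → Y} (hφ : ContinuousOn φ s)
    (h : Set.BijOn φ s t) : Nonempty (s ≃ₜ t) :=
  ⟨(hφ.mapsToRestrict h.mapsTo).homeoOfEquivCompactToT2 (f := h.equiv φ)⟩

theorem nonempty_carrier_map_homeomorph {W : Type*} [Fintype W] [DecidableEq W]
    (K : PreAbstractSimplicialComplex V) {φ : V → W} (hφ : Function.Injective φ) :
    Nonempty (carrier (K.map φ) ≃ₜ carrier K) := by
  have sum_comp {g : W → ℝ} (hg : ∀ w ∉ Set.range φ, g w = 0) : ∑ v, g (φ v) = ∑ w, g w :=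
    Finset.sum_of_injOn φ hφ.injOn (fun _ _ => Finset.mem_coe.2 (Finset.mem_univ _))
      (fun w _ hw => hg w (by simpa using hw)) fun _ _ => rfl
  have eq_zero : ∀ g ∈ carrier (K.map φ), ∀ w ∉ Set.range φ, g w = 0 := by
    rintro g ⟨-, -, -, ⟨t, -, rfl⟩, hs⟩ w hw
    by_contra hne
    obtain ⟨v, -, rfl⟩ := Finset.mem_image.1 ((hs w).1 hne)
    exact hw ⟨v, rfl⟩
  refine nonempty_homeomorph_of_bijOn (φ := fun g v => g (φ v)) (by fun_prop) ⟨?_, ?_, ?_⟩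
  · intro g hg
    have hzero := eq_zero g hg
    obtain ⟨h0, h1, -, ⟨t, ht, rfl⟩, hgs⟩ := hg
    refine mem_carrier_of_forall (fun v => h0 _) ((sum_comp hzero).trans h1) ht fun v hv => ?_
    exact (Finset.mem_image.1 ((hgs _).1 hv)).elim fun v' h => hφ h.2 ▸ h.1
  · intro g hg g' hg' h
    ext w
    by_cases hw : w ∈ Set.range φ
    · obtain ⟨v, rfl⟩ := hw
      exact congrFun h v
    · rw [eq_zero g hg w hw, eq_zero g' hg' w hw]
  · rintro f ⟨h0, h1, s, hs, hfs⟩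
    have hext : ∀ v, Function.extend φ f (0 : W → ℝ) (φ v) = f v := hφ.extend_apply f (0 : W → ℝ)
    have hext0 : ∀ w ∉ Set.range φ, Function.extend φ f (0 : W → ℝ) w = 0 :=
      fun w hw => Function.extend_apply' f (0 : W → ℝ) w hw
    refine ⟨Function.extend φ f (0 : W → ℝ), mem_carrier_of_forall (t := s.image φ) (fun w => ?_) ?_
      ⟨s, hs, rfl⟩ fun w hw => ?_, funext hext⟩
    · by_cases hw : w ∈ Set.range φ
      · obtain ⟨v, rfl⟩ := hw
        exact (h0 v).trans_eq (hext v).symm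
      · exact (hext0 w hw).ge
    · rw [← sum_comp hext0, ← h1]
      exact Finset.sum_congr rfl fun v _ => hext v
    · obtain ⟨v, rfl⟩ : w ∈ Set.range φ := not_not.1 fun h => hw (hext0 w h)
      exact Finset.mem_image_of_mem φ ((hfs v).1 (hext v ▸ hw))

end Carrier

section Oscillation

variable {V : Type*} {A : Finset V} {f : V → ℝ} {v : V}

/-- The minimum of `f` on the finite set `A` (and `0` if `A` is empty). -/
noncomputable def blockMin (A : Finset V) (f : V → ℝ) : ℝ := ⨅ v : A, f v

theorem blockMin_le (f : V → ℝ) (hv : v ∈ A) : blockMin A f ≤ f v :=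
  ciInf_le (Set.finite_range fun v : A => f v).bddBelow ⟨v, hv⟩

theorem exists_eq_blockMin (hA : A.Nonempty) (f : V → ℝ) : ∃ v ∈ A, f v = blockMin A f := by
  have := hA.to_subtype
  obtain ⟨v, hv⟩ := exists_eq_ciInf_of_finite (f := fun v : A => f v)
  exact ⟨v, v.2, hv⟩

theorem blockMin_nonneg (h : ∀ v, 0 ≤ f v) : 0 ≤ blockMin A f :=
  Real.iInf_nonneg fun v => h v

theorem blockMin_eq_zero_iff (hA : A.Nonempty) (h : ∀ v, 0 ≤ f v) :
    blockMin A f = 0 ↔ ∃ v ∈ A, f v = 0 := by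
  refine ⟨fun h0 => h0 ▸ exists_eq_blockMin hA f, ?_⟩
  rintro ⟨v, hv, hv0⟩
  exact le_antisymm (hv0 ▸ blockMin_le f hv) (blockMin_nonneg h)

theorem blockMin_of_eq_add {g : V → ℝ} (hA : A.Nonempty) {c : ℝ} (h : ∀ v ∈ A, g v = f v + c) :
    blockMin A g = blockMin A f + c := by
  have := hA.to_subtype
  calc blockMin A g = ⨅ v : A, (f v + c) := iInf_congr fun v => h v v.2
    _ = blockMin A f + c := (ciInf_add (Set.finite_range fun v : A => f v).bddBelow c).symm

theorem continuous_blockMin (A : Finset V) : Continuous (blockMin A) := by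
  rcases isEmpty_or_nonempty A with _ | _
  · exact continuous_const.congr fun f => (Real.iInf_of_isEmpty fun v : A => f v).symm
  · exact (Continuous.finset_inf'_apply Finset.univ_nonempty fun v _ =>
      continuous_apply v.1).congr fun f => Finset.inf'_univ_eq_ciInf fun v : A => f v

variable [DecidableEq V] {U : Finset V} (P : Finpartition U)

/-- The total height of `f` above its minima on the blocks of a partition. It is a gauge on the
space of functions modulo those that are constant on the blocks. -/
noncomputable def oscillation (f : V → ℝ) : ℝ := ∑ v ∈ U, (f v - blockMin (P.part v) f)

variable {P}

theorem sub_le_oscillation (f : V → ℝ) {w : V} (hv : v ∈ U) (hw : w ∈ P.part v) :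
    f v - f w ≤ oscillation P f :=
  calc f v - f w ≤ f v - blockMin (P.part v) f := sub_le_sub_left (blockMin_le f hw) _
    _ ≤ oscillation P f :=
      Finset.single_le_sum (f := fun v => f v - blockMin (P.part v) f)
        (fun _ hu => sub_nonneg.2 (blockMin_le f (P.mem_part_self.2 hu))) hv

theorem oscillation_of_eq_add {g : V → ℝ} {c : Finset V → ℝ}
    (h : ∀ v ∈ U, g v = f v + c (P.part v)) : oscillation P g = oscillation P f := by
  refine Finset.sum_congr rfl fun v hv => ?_
  have hblock : ∀ w ∈ P.part v, g w = f w + c (P.part v) := fun w hw => by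
    rw [h w (P.part_subset v hw), P.part_eq_of_mem (P.part_mem.2 hv) hw]
  rw [blockMin_of_eq_add (P.part_nonempty.2 hv) hblock, h v hv, add_sub_add_right_eq_sub]

theorem convexOn_oscillation (P : Finpartition U) : ConvexOn ℝ Set.univ (oscillation P) := by
  refine ⟨convex_univ, fun f _ g _ a b ha hb _ => ?_⟩
  simp only [oscillation, smul_eq_mul, Finset.mul_sum, ← Finset.sum_add_distrib]
  refine Finset.sum_le_sum fun v hv => ?_
  obtain ⟨w, hw, hmin⟩ := exists_eq_blockMin (P.part_nonempty.2 hv) (a • f + b • g)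
  simp only [← hmin, Pi.add_apply, Pi.smul_apply, smul_eq_mul]
  nlinarith [mul_le_mul_of_nonneg_left (blockMin_le f hw) ha,
    mul_le_mul_of_nonneg_left (blockMin_le g hw) hb]

theorem oscillation_add_card_mul_blockMin (hA : A ∈ P.parts)
    (h : ∀ B ∈ P.parts, B ≠ A → blockMin B f = 0) :
    oscillation P f + A.card * blockMin A f = ∑ v ∈ U, f v := by
  have hmin : ∀ v ∈ U, blockMin (P.part v) f = if v ∈ A then blockMin A f else 0 := by
    intro v hv
    split_ifs with hvA
    · rw [P.part_eq_of_mem hA hvA]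
    · exact h _ (P.part_mem.2 hv) fun hvA' => hvA (hvA' ▸ P.mem_part_self.2 hv)
  rw [oscillation, Finset.sum_sub_distrib, Finset.sum_congr rfl hmin, ← Finset.sum_filter,
    Finset.filter_mem_eq_inter, Finset.inter_eq_right.2 (P.subset hA), Finset.sum_const,
    nsmul_eq_mul, sub_add_cancel]

end Oscillation

/-! ## Joins of simplices and boundaries of simplices -/

section JoinBall

variable {V : Type*} [DecidableEq V] {U : Finset V}

/-- The join of the simplex `A` with the boundaries of the other blocks of the partition `P`. For a
block `A` it is a triangulated ball, whose boundary is the join of the boundaries of all blocks. -/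
def joinBall (P : Finpartition U) (A : Finset V) : PreAbstractSimplicialComplex V where
  faces := {t | t.Nonempty ∧ t ⊆ U ∧ ∀ B ∈ P.parts, B ≠ A → ¬B ⊆ t}
  isRelLowerSet_faces := by
    rintro t ⟨hne, htU, ht⟩
    exact ⟨hne, fun u hut hu => ⟨hu, hut.trans htU, fun B hB hBA h => ht B hB hBA (h.trans hut)⟩⟩

variable {P : Finpartition U} {A : Finset V} {d : ℕ}

theorem insert_mem_joinBall {r : Finset V} {v w : V} (hr : r ⊆ U)
    (hrP : ∀ B ∈ P.parts, B ≠ A → ¬B ⊆ r) (hv : v ∈ U) (hw : w ∈ P.part v) (hwr : w ∉ r)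
    (hvw : v ≠ w) : insert v r ∈ (joinBall P A).faces := by
  refine ⟨Finset.insert_nonempty v r, Finset.insert_subset hv hr, fun B hB hBA hBr => ?_⟩
  by_cases hvB : v ∈ B
  · have hwB : w ∈ B := P.part_eq_of_mem hB hvB ▸ hw
    exact hwr (Finset.mem_of_mem_insert_of_ne (hBr hwB) hvw.symm)
  · exact hrP B hB hBA ((Finset.subset_insert_iff_of_notMem hvB).1 hBr)

theorem not_subset_of_mem_boundary_joinBall (hA : A ∈ P.parts) (hd : U.card = d + P.parts.card)
    {r : Finset V} (hr : r ∈ (joinBall P A).faces) (hcard : r.card = d)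
    (huniq : ∃! s, s ∈ (joinBall P A).faces ∧ s.card = d + 1 ∧ r ⊆ s) : ¬A ⊆ r := by
  intro hAr
  have hmissing : (P.parts.erase A).card < (U \ r).card := by
    rw [Finset.card_erase_of_mem hA, Finset.card_sdiff_of_subset hr.2.1]
    have := Finset.card_pos.2 ⟨A, hA⟩
    omega
  have hmaps : ∀ v ∈ U \ r, P.part v ∈ P.parts.erase A := by
    intro v hv
    rw [Finset.mem_sdiff] at hv
    exact Finset.mem_erase.2 ⟨fun h => hv.2 (hAr (h ▸ P.mem_part_self.2 hv.1)), P.part_mem.2 hv.1⟩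
  obtain ⟨v, hv, w, hw, hvw, hpart⟩ := Finset.exists_ne_map_eq_of_card_lt_of_maps_to hmissing hmaps
  rw [Finset.mem_sdiff] at hv hw
  have hfacet {v w : V} (hv : v ∈ U ∧ v ∉ r) (hw : w ∈ U ∧ w ∉ r) (hvw : v ≠ w)
      (hpart : P.part v = P.part w) : insert v r ∈ (joinBall P A).faces ∧
        (insert v r).card = d + 1 ∧ r ⊆ insert v r :=
    ⟨insert_mem_joinBall hr.2.1 hr.2.2 hv.1 (hpart ▸ P.mem_part_self.2 hw.1) hw.2 hvw,
      by rw [Finset.card_insert_of_notMem hv.2, hcard], Finset.subset_insert v r⟩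
  have heq := huniq.unique (hfacet hv hw hvw hpart) (hfacet hw hv hvw.symm hpart.symm)
  exact hvw ((Finset.mem_insert.1 (heq ▸ Finset.mem_insert_self v r)).resolve_right hv.2)

theorem existsUnique_facet_of_transversal (hA : A ∈ P.parts) {m : Finset V → V}
    (hm : ∀ B ∈ P.parts, m B ∈ B) (hd : (U \ P.parts.image m).card = d) :
    ∃! s, s ∈ (joinBall P A).faces ∧ s.card = d + 1 ∧ U \ P.parts.image m ⊆ s := by
  set r := U \ P.parts.image m
  have hmU {B : Finset V} (hB : B ∈ P.parts) : m B ∈ U := P.subset hB (hm B hB)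
  have hmr {B : Finset V} (hB : B ∈ P.parts) : m B ∉ r := fun h =>
    (Finset.mem_sdiff.1 h).2 (Finset.mem_image_of_mem m hB)
  have hcard : (insert (m A) r).card = d + 1 := by
    rw [Finset.card_insert_of_notMem (hmr hA), hd]
  refine ⟨insert (m A) r, ⟨⟨Finset.insert_nonempty _ r,
    Finset.insert_subset (hmU hA) Finset.sdiff_subset, fun B hB hBA h => ?_⟩, hcard,
    Finset.subset_insert _ r⟩, ?_⟩
  · refine hBA (P.eq_of_mem_parts hB hA (hm B hB) ?_)
    rw [(Finset.mem_insert.1 (h (hm B hB))).resolve_right (hmr hB)]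
    exact hm A hA
  · rintro s ⟨hs, hscard, hrs⟩
    refine Finset.eq_of_subset_of_card_le (fun v hv => ?_) (hcard.trans hscard.symm).le
    by_contra hvr
    rw [Finset.mem_insert, not_or] at hvr
    have hvm : v ∈ P.parts.image m := by_contra fun h =>
      hvr.2 (Finset.mem_sdiff.2 ⟨hs.2.1 hv, h⟩)
    obtain ⟨B, hB, rfl⟩ := Finset.mem_image.1 hvm
    refine hs.2.2 B hB (fun h => hvr.1 (h ▸ rfl)) fun w hw => ?_
    by_cases hwm : w ∈ P.parts.image m
    · obtain ⟨C, hC, rfl⟩ := Finset.mem_image.1 hwm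
      rwa [P.eq_of_mem_parts hC hB (hm C hC) hw]
    · exact hrs (Finset.mem_sdiff.2 ⟨P.subset hB hw, hwm⟩)

theorem card_sdiff_transversal {m : Finset V → V} (hm : ∀ B ∈ P.parts, m B ∈ B) :
    (U \ P.parts.image m).card = U.card - P.parts.card := by
  have hinj : Set.InjOn m P.parts := fun B hB C hC h =>
    P.eq_of_mem_parts hB hC (hm B hB) (h ▸ hm C hC)
  rw [Finset.card_sdiff_of_subset
    (Finset.image_subset_iff.2 fun B hB => P.subset hB (hm B hB)),
    Finset.card_image_of_injOn hinj]

theorem mem_boundary_joinBall (hA : A ∈ P.parts) (hd : U.card = d + P.parts.card) {t : Finset V} :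
    t ∈ (boundary d (joinBall P A)).faces ↔ t.Nonempty ∧ t ⊆ U ∧ ∀ B ∈ P.parts, ¬B ⊆ t := by
  constructor
  · rintro ⟨hne, r, ⟨hr, hcard, huniq⟩, htr⟩
    refine ⟨hne, htr.trans hr.2.1, fun B hB hBt => ?_⟩
    by_cases hBA : B = A
    · exact not_subset_of_mem_boundary_joinBall hA hd hr hcard huniq (hBA ▸ hBt.trans htr)
    · exact hr.2.2 B hB hBA (hBt.trans htr)
  · rintro ⟨hne, htU, ht⟩
    have : Nonempty V := hne.to_type
    choose! m hm hmt using fun B hB => Finset.not_subset.1 (ht B hB)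
    have hcard : (U \ P.parts.image m).card = d := by
      rw [card_sdiff_transversal hm, hd, Nat.add_sub_cancel_right]
    have htr : t ⊆ U \ P.parts.image m := fun v hv => by
      refine Finset.mem_sdiff.2 ⟨htU hv, fun hvm => ?_⟩
      obtain ⟨B, hB, rfl⟩ := Finset.mem_image.1 hvm
      exact hmt B hB hv
    refine ⟨hne, _, ⟨⟨hne.mono htr, Finset.sdiff_subset, fun B hB _ h => ?_⟩, hcard,
      existsUnique_facet_of_transversal hA hm hcard⟩, htr⟩
    exact (Finset.mem_sdiff.1 (h (hm B hB))).2 (Finset.mem_image_of_mem m hB)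

theorem exists_facet_of_mem_joinBall (hA : A ∈ P.parts) (hd : U.card = d + P.parts.card)
    {t : Finset V} (ht : t ∈ (joinBall P A).faces) :
    ∃ s ∈ (joinBall P A).faces, s.card = d + 1 ∧ t ⊆ s := by
  obtain ⟨hne, htU, hmissing⟩ := ht
  have : Nonempty V := hne.to_type
  choose! m hm hmt using fun B hB => Finset.not_subset.1 (hmissing B (Finset.mem_of_mem_erase hB)
    (Finset.ne_of_mem_erase hB))
  have hinj : Set.InjOn m (P.parts.erase A) := fun B hB C hC h =>
    P.eq_of_mem_parts (Finset.mem_of_mem_erase hB) (Finset.mem_of_mem_erase hC) (hm B hB)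
      (h ▸ hm C hC)
  have hts : t ⊆ U \ (P.parts.erase A).image m := fun v hv => by
    refine Finset.mem_sdiff.2 ⟨htU hv, fun hvm => ?_⟩
    obtain ⟨B, hB, rfl⟩ := Finset.mem_image.1 hvm
    exact hmt B hB hv
  refine ⟨_, ⟨hne.mono hts, Finset.sdiff_subset, fun B hB hBA h => ?_⟩, ?_, hts⟩
  · have hB' := Finset.mem_erase.2 ⟨hBA, hB⟩
    exact (Finset.mem_sdiff.1 (h (hm B hB'))).2 (Finset.mem_image_of_mem m hB')
  · have := Finset.card_pos.2 ⟨A, hA⟩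
    rw [Finset.card_sdiff_of_subset (Finset.image_subset_iff.2 fun B hB =>
      P.subset (Finset.mem_of_mem_erase hB) (hm B hB)), Finset.card_image_of_injOn hinj,
      Finset.card_erase_of_mem hA]
    omega

variable [Fintype V] {f : V → ℝ}

theorem mem_carrier_joinBall : f ∈ carrier (joinBall P A) ↔
    (∀ v, 0 ≤ f v) ∧ ∑ v, f v = 1 ∧ (∀ v ∉ U, f v = 0) ∧
      ∀ B ∈ P.parts, B ≠ A → blockMin B f = 0 := by
  constructor
  · rintro ⟨h0, h1, s, ⟨-, hsU, hs⟩, hfs⟩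
    refine ⟨h0, h1, fun v hv => not_not.1 fun h => hv (hsU ((hfs v).1 h)), fun B hB hBA => ?_⟩
    obtain ⟨v, hv, hvs⟩ := Finset.not_subset.1 (hs B hB hBA)
    exact (blockMin_eq_zero_iff (P.nonempty_of_mem_parts hB) h0).2
      ⟨v, hv, not_not.1 fun h => hvs ((hfs v).1 h)⟩
  · rintro ⟨h0, h1, hU, hmin⟩
    obtain ⟨v, -, hv⟩ := Finset.exists_ne_zero_of_sum_ne_zero (h1.trans_ne one_ne_zero)
    refine ⟨h0, h1, Finset.univ.filter (f · ≠ 0), ⟨⟨v, by simpa using hv⟩, fun w hw => ?_,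
      fun B hB hBA hBf => ?_⟩, by simp⟩
    · by_contra hwU
      exact (Finset.mem_filter.1 hw).2 (hU w hwU)
    · obtain ⟨w, hw, hw0⟩ :=
        (blockMin_eq_zero_iff (P.nonempty_of_mem_parts hB) h0).1 (hmin B hB hBA)
      exact (Finset.mem_filter.1 (hBf hw)).2 hw0

end JoinBall

section Ball

theorem nonempty_homeomorph_closedBall {E : Type*} [NormedAddCommGroup E] [NormedSpace ℝ E]
    {s : Set E} (hs : Convex ℝ s) (hclosed : IsClosed s) (hb : Bornology.IsBounded s)
    (hne : (interior s).Nonempty) : Nonempty (s ≃ₜ Metric.closedBall (0 : E) 1) := by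
  obtain ⟨φ, -, hφ, -⟩ := exists_homeomorph_image_interior_closure_frontier_eq_unitBall hs hne hb
  rw [hclosed.closure_eq] at hφ
  exact ⟨(φ.image s).trans (Homeomorph.setCongr hφ)⟩

variable {V : Type*} [DecidableEq V] {U A : Finset V} {P : Finpartition U} {m : Finset V → V}

/-- Extension by zero of a function defined on `U \ R`. When `R` is a set of representatives of the
blocks of a partition of `U`, this is a section of the quotient of the functions on `U` by those
that are constant on the blocks. -/
noncomputable def extendZero (U R : Finset V) : EuclideanSpace ℝ ↥(U \ R) →ₗ[ℝ] V → ℝ :=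
  (Function.ExtendByZero.linearMap ℝ (Subtype.val : ↥(U \ R) → V)).comp
    (WithLp.linearEquiv 2 ℝ (↥(U \ R) → ℝ)).toLinearMap

theorem extendZero_apply {R : Finset V} (y : EuclideanSpace ℝ ↥(U \ R)) (v : ↥(U \ R)) :
    extendZero U R y v = y v :=
  Subtype.val_injective.extend_apply (y : ↥(U \ R) → ℝ) (0 : V → ℝ) v

theorem extendZero_of_mem {R : Finset V} (y : EuclideanSpace ℝ ↥(U \ R)) {v : V} (hv : v ∈ R) :
    extendZero U R y v = 0 := by
  refine Function.extend_apply' (y : ↥(U \ R) → ℝ) (0 : V → ℝ) v ?_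
  rintro ⟨w, rfl⟩
  exact (Finset.mem_sdiff.1 w.2).2 hv

/-- The functions on `U` without representatives of the blocks of `P` whose extensions by zero
oscillate by at most `1`. -/
def oscillationBody (P : Finpartition U) (m : Finset V → V) :
    Set (EuclideanSpace ℝ ↥(U \ P.parts.image m)) :=
  {y | oscillation P (extendZero U _ y) ≤ 1}

theorem convexOn_oscillation_extendZero (P : Finpartition U) (R : Finset V) :
    ConvexOn ℝ Set.univ fun y => oscillation P (extendZero U R y) :=
  (convexOn_oscillation P).comp_linearMap (extendZero U R)

theorem abs_le_one_of_mem_oscillationBody (hm : ∀ B ∈ P.parts, m B ∈ B)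
    {y : EuclideanSpace ℝ ↥(U \ P.parts.image m)} (hy : y ∈ oscillationBody P m)
    (v : ↥(U \ P.parts.image m)) : |y v| ≤ 1 := by
  have hv : v.1 ∈ U := (Finset.mem_sdiff.1 v.2).1
  have hB := P.part_mem.2 hv
  have hw := hm _ hB
  have hvw : v.1 ∈ P.part (m (P.part v)) := by
    rw [P.part_eq_of_mem hB hw]
    exact P.mem_part_self.2 hv
  have hup := (sub_le_oscillation (extendZero U _ y) hv hw).trans hy
  have hdown := (sub_le_oscillation (extendZero U _ y) (P.subset hB hw) hvw).trans hy
  rw [extendZero_apply, extendZero_of_mem y (Finset.mem_image_of_mem m hB)] at hup hdown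
  exact abs_le.2 ⟨by linarith, by linarith⟩

theorem nonempty_oscillationBody_homeomorph (hm : ∀ B ∈ P.parts, m B ∈ B) :
    Nonempty (oscillationBody P m ≃ₜ
      Metric.closedBall (0 : EuclideanSpace ℝ ↥(U \ P.parts.image m)) 1) := by
  have hconvex := convexOn_oscillation_extendZero P (P.parts.image m)
  have hcont := hconvex.locallyLipschitz.continuous
  have hbounded : Bornology.IsBounded (oscillationBody P m) := by
    refine ((PiLp.antilipschitzWith_ofLp 2 fun _ : ↥(U \ P.parts.image m) => ℝ).isBounded_preimage
      (Metric.isBounded_Icc (-1) 1)).subset ?_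
    intro y hy
    have habs v := abs_le.1 (abs_le_one_of_mem_oscillationBody hm hy v)
    exact ⟨fun v => (habs v).1, fun v => (habs v).2⟩
  refine nonempty_homeomorph_closedBall ?_ (isClosed_le hcont continuous_const) hbounded ⟨0, ?_⟩
  · rw [show oscillationBody P m = _ from (Set.sep_univ).symm]
    exact hconvex.convex_le 1
  · have hopen := isOpen_lt hcont (continuous_const (y := (1 : ℝ)))
    refine interior_mono (Set.ofPred_subset_ofPred.2 fun y hy => hy.le) (hopen.interior_eq.ge ?_)
    simp [oscillation, blockMin]

/-- The differences of the values of `f` to its values at the representatives of the blocks. -/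
noncomputable def blockDifference (P : Finpartition U) (m : Finset V → V) (f : V → ℝ) :
    EuclideanSpace ℝ ↥(U \ P.parts.image m) :=
  WithLp.toLp 2 fun v => f v - f (m (P.part v))

theorem extendZero_blockDifference (hm : ∀ B ∈ P.parts, m B ∈ B) (f : V → ℝ) {v : V} (hv : v ∈ U) :
    extendZero U _ (blockDifference P m f) v = f v - f (m (P.part v)) := by
  by_cases hvm : v ∈ P.parts.image m
  · obtain ⟨B, hB, rfl⟩ := Finset.mem_image.1 hvm
    rw [extendZero_of_mem _ hvm, P.part_eq_of_mem hB (hm B hB), sub_self]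
  · exact extendZero_apply (blockDifference P m f) ⟨v, Finset.mem_sdiff.2 ⟨hv, hvm⟩⟩

theorem oscillation_extendZero_blockDifference (hm : ∀ B ∈ P.parts, m B ∈ B) (f : V → ℝ) :
    oscillation P (extendZero U _ (blockDifference P m f)) = oscillation P f :=
  oscillation_of_eq_add (c := fun B => -f (m B)) fun _ hv =>
    (extendZero_blockDifference hm f hv).trans (sub_eq_add_neg _ _)

variable [Fintype V]

theorem oscillation_add_of_mem_carrier (hA : A ∈ P.parts) {f : V → ℝ}
    (hf : f ∈ carrier (joinBall P A)) : oscillation P f + A.card * blockMin A f = 1 := by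
  obtain ⟨-, h1, hU, hmin⟩ := mem_carrier_joinBall.1 hf
  rw [oscillation_add_card_mul_blockMin hA hmin, ← h1]
  exact Finset.sum_subset (Finset.subset_univ U) fun v _ => hU v

theorem injOn_blockDifference (hm : ∀ B ∈ P.parts, m B ∈ B) (hA : A ∈ P.parts) :
    Set.InjOn (blockDifference P m) (carrier (joinBall P A)) := by
  intro f hf g hg hfg
  have hdiff : ∀ v ∈ U, f v = g v + (f (m (P.part v)) - g (m (P.part v))) := by
    intro v hv
    have := extendZero_blockDifference hm f hv
    rw [hfg, extendZero_blockDifference hm g hv] at this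
    linarith
  have hosc : oscillation P f = oscillation P g := by
    rw [← oscillation_extendZero_blockDifference hm, hfg, oscillation_extendZero_blockDifference hm]
  have hblock : ∀ B ∈ P.parts, blockMin B f = blockMin B g := by
    intro B hB
    by_cases hBA : B = A
    · have hcard : (A.card : ℝ) ≠ 0 := by
        exact_mod_cast (Finset.card_pos.2 (P.nonempty_of_mem_parts hA)).ne'
      have hf1 := oscillation_add_of_mem_carrier hA hf
      rw [hosc, ← oscillation_add_of_mem_carrier hA hg, add_right_inj] at hf1
      exact hBA ▸ mul_left_cancel₀ hcard hf1
    · rw [(mem_carrier_joinBall.1 hf).2.2.2 B hB hBA, (mem_carrier_joinBall.1 hg).2.2.2 B hB hBA]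
  ext v
  by_cases hv : v ∈ U
  · have hB := P.part_mem.2 hv
    have hshift := blockMin_of_eq_add (P.nonempty_of_mem_parts hB) (f := g) (g := f)
      (c := f (m (P.part v)) - g (m (P.part v))) fun w hw => by
        rw [hdiff w (P.part_subset v hw), P.part_eq_of_mem hB hw]
    rw [hblock _ hB, left_eq_add] at hshift
    rw [hdiff v hv, hshift, add_zero]
  · rw [(mem_carrier_joinBall.1 hf).2.2.1 v hv, (mem_carrier_joinBall.1 hg).2.2.1 v hv]

end Ball

section BallTriangulation

variable {V : Type*} [DecidableEq V] [Fintype V] {U A : Finset V} {P : Finpartition U}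
  {m : Finset V → V}

theorem mapsTo_blockDifference (hm : ∀ B ∈ P.parts, m B ∈ B) (hA : A ∈ P.parts) :
    Set.MapsTo (blockDifference P m) (carrier (joinBall P A)) (oscillationBody P m) := by
  intro f hf
  change oscillation P _ ≤ 1
  rw [oscillation_extendZero_blockDifference hm, ← oscillation_add_of_mem_carrier hA hf]
  exact le_add_of_nonneg_right (mul_nonneg A.card.cast_nonneg (blockMin_nonneg hf.1))

theorem mem_carrier_joinBall_of_blockMin (hA : A ∈ P.parts) {f : V → ℝ} (hU : ∀ v ∉ U, f v = 0)
    (hosc : oscillation P f ≤ 1)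
    (hmin : ∀ B ∈ P.parts, blockMin B f = if B = A then (1 - oscillation P f) / A.card else 0) :
    f ∈ carrier (joinBall P A) := by
  have hmin0 : ∀ B ∈ P.parts, B ≠ A → blockMin B f = 0 := fun B hB hBA => by
    rw [hmin B hB, if_neg hBA]
  have hcard : (A.card : ℝ) ≠ 0 := by
    exact_mod_cast (Finset.card_pos.2 (P.nonempty_of_mem_parts hA)).ne'
  refine mem_carrier_joinBall.2 ⟨fun v => ?_, ?_, hU, hmin0⟩
  · by_cases hv : v ∈ U
    · have hle := blockMin_le f (P.mem_part_self.2 hv)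
      rw [hmin _ (P.part_mem.2 hv)] at hle
      refine le_trans ?_ hle
      split_ifs
      · exact div_nonneg (sub_nonneg.2 hosc) A.card.cast_nonneg
      · exact le_rfl
    · exact (hU v hv).ge
  · rw [← Finset.sum_subset (Finset.subset_univ U) fun v _ => hU v,
      ← oscillation_add_card_mul_blockMin hA hmin0, hmin A hA, if_pos rfl, mul_div_cancel₀ _ hcard,
      add_sub_cancel]

theorem surjOn_blockDifference (hm : ∀ B ∈ P.parts, m B ∈ B) (hA : A ∈ P.parts) :
    Set.SurjOn (blockDifference P m) (carrier (joinBall P A)) (oscillationBody P m) := by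
  intro y hy
  set x := extendZero U (P.parts.image m) y with hx
  set c : Finset V → ℝ := fun B =>
    (if B = A then (1 - oscillation P x) / A.card else 0) - blockMin B x
  set f : V → ℝ := fun v => if v ∈ U then x v + c (P.part v) else 0
  have hfU : ∀ v ∈ U, f v = x v + c (P.part v) := fun v hv => if_pos hv
  have hosc : oscillation P f = oscillation P x := oscillation_of_eq_add hfU
  refine ⟨f, mem_carrier_joinBall_of_blockMin hA (fun v hv => if_neg hv) (hosc.trans_le hy)
    fun B hB => ?_, ?_⟩
  · rw [blockMin_of_eq_add (P.nonempty_of_mem_parts hB) (c := c B) fun v hv => ?_, hosc,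
      add_sub_cancel]
    rw [hfU v (P.subset hB hv), P.part_eq_of_mem hB hv]
  · ext v
    have hv : v.1 ∈ U := (Finset.mem_sdiff.1 v.2).1
    have hB := P.part_mem.2 hv
    change f v - f (m (P.part v)) = y v
    rw [hfU v hv, hfU _ (P.subset hB (hm _ hB)), P.part_eq_of_mem hB (hm _ hB),
      add_sub_add_right_eq_sub, hx, extendZero_apply,
      extendZero_of_mem y (Finset.mem_image_of_mem m hB), sub_zero]

theorem isTriangulatedBall_joinBall {d : ℕ} (hA : A ∈ P.parts) (hd : U.card = d + P.parts.card) :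
    IsTriangulatedBall d (joinBall P A) := by
  have : Nonempty V := (P.nonempty_of_mem_parts hA).to_type
  choose! m hm using fun B (hB : B ∈ P.parts) => P.nonempty_of_mem_parts hB
  obtain ⟨φ⟩ := nonempty_homeomorph_of_bijOn (φ := blockDifference P m)
    (Continuous.continuousOn (by unfold blockDifference; fun_prop))
    ⟨mapsTo_blockDifference hm hA, injOn_blockDifference hm hA, surjOn_blockDifference hm hA⟩
  obtain ⟨ψ⟩ := nonempty_oscillationBody_homeomorph hm
  have hcard : Fintype.card ↥(U \ P.parts.image m) = Fintype.card (Fin d) := by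
    rw [Fintype.card_coe, card_sdiff_transversal hm, hd, Fintype.card_fin, Nat.add_sub_cancel_right]
  let e := LinearIsometryEquiv.piLpCongrLeft 2 ℝ ℝ (Fintype.equivOfCardEq hcard)
  refine ⟨(φ.trans ψ).trans ((e.toHomeomorph.image _).trans (Homeomorph.setCongr ?_))⟩
  exact (e.image_closedBall 0 1).trans (by rw [map_zero])

end BallTriangulation

/-! ## Flips between joins -/

theorem isPure_generatedBy {V : Type*} {F : Set (Finset V)} {d : ℕ} (hF : ∀ s ∈ F, s.card = d + 1) :
    IsPure d (generatedBy F) := by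
  intro s hs
  obtain ⟨hne, t, ht, hst⟩ := hs.prop
  rw [← hF t ht, hs.eq_of_le ⟨hne.mono hst, t, ht, Finset.Subset.refl t⟩ hst]

section Flip

variable {V : Type*} [DecidableEq V] {U A B : Finset V} {P : Finpartition U}
  {X X' : PreAbstractSimplicialComplex V}

/-- `X'` arises from `X` by a generalized bistellar flip: for two blocks `A` and `B` of the
partition `P`, the ball `joinBall P A`, which contains the star of `A` in `X`, is replaced by
`joinBall P B`, while `B` is not contained in a face of `X`. -/
structure IsFlip (P : Finpartition U) (A B : Finset V) (X X' : PreAbstractSimplicialComplex V) :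
    Prop where
  left_mem : A ∈ P.parts
  right_mem : B ∈ P.parts
  ne : A ≠ B
  joinBall_le : joinBall P A ≤ X
  star_le : ∀ t ∈ X.faces, A ⊆ t → t ∈ (joinBall P A).faces
  not_subset : ∀ t ∈ X.faces, ¬B ⊆ t
  faces_eq : X'.faces = (X.faces \ (joinBall P A).faces) ∪ (joinBall P B).faces

/-- The map moving the common part of the values of `f` on `A` to `B`. -/
noncomputable def shift (A B : Finset V) (f : V → ℝ) (v : V) : ℝ :=
  f v + (if v ∈ A then -blockMin A f else 0) + (if v ∈ B then A.card * blockMin A f / B.card else 0)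

theorem continuous_shift (A B : Finset V) : Continuous (shift A B) := by
  have := continuous_blockMin A
  refine continuous_pi fun v => ?_
  unfold shift
  split_ifs <;> fun_prop

theorem shift_apply_of_mem_left (hAB : Disjoint A B) {v : V} (hv : v ∈ A) (f : V → ℝ) :
    shift A B f v = f v + -blockMin A f := by
  simp [shift, hv, Finset.disjoint_left.1 hAB hv]

theorem shift_apply_of_mem_right (hAB : Disjoint A B) {v : V} (hv : v ∈ B) (f : V → ℝ) :
    shift A B f v = f v + A.card * blockMin A f / B.card := by
  simp [shift, hv, Finset.disjoint_right.1 hAB hv]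

theorem shift_apply_of_notMem {v : V} (hA : v ∉ A) (hB : v ∉ B) (f : V → ℝ) :
    shift A B f v = f v := by
  simp [shift, hA, hB]

theorem shift_eq_self {f : V → ℝ} (hf : blockMin A f = 0) : shift A B f = f := by
  ext v
  simp [shift, hf]

theorem shift_shift (hA : A.Nonempty) (hB : B.Nonempty) (hAB : Disjoint A B) {f : V → ℝ}
    (hf : blockMin B f = 0) : shift B A (shift A B f) = f := by
  have hA0 : (A.card : ℝ) ≠ 0 := by exact_mod_cast hA.card_pos.ne'
  have hB0 : (B.card : ℝ) ≠ 0 := by exact_mod_cast hB.card_pos.ne'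
  have hmin := blockMin_of_eq_add hB fun v hv => shift_apply_of_mem_right hAB hv f
  rw [hf, zero_add] at hmin
  ext v
  by_cases hvA : v ∈ A
  · rw [shift_apply_of_mem_right hAB.symm hvA, shift_apply_of_mem_left hAB hvA, hmin,
      mul_div_cancel₀ _ hB0, mul_div_cancel_left₀ _ hA0, neg_add_cancel_right]
  · by_cases hvB : v ∈ B
    · rw [shift_apply_of_mem_left hAB.symm hvB, shift_apply_of_mem_right hAB hvB, hmin,
        add_neg_cancel_right]
    · rw [shift_apply_of_notMem hvB hvA, shift_apply_of_notMem hvA hvB]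

theorem sum_shift [Fintype V] (hB : B.Nonempty) (f : V → ℝ) : ∑ v, shift A B f v = ∑ v, f v := by
  have hB0 : (B.card : ℝ) ≠ 0 := by exact_mod_cast hB.card_pos.ne'
  simp only [shift, Finset.sum_add_distrib, Finset.sum_ite_mem, Finset.univ_inter,
    Finset.sum_const, nsmul_eq_mul, mul_div_cancel₀ _ hB0]
  ring

theorem shift_mem_carrier_joinBall [Fintype V] (hA : A ∈ P.parts) (hB : B ∈ P.parts) (hAB : A ≠ B)
    {f : V → ℝ} (hf : f ∈ carrier (joinBall P A)) : shift A B f ∈ carrier (joinBall P B) := by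
  have hdisj : Disjoint A B := P.disjoint hA hB hAB
  obtain ⟨h0, h1, hU, hmin⟩ := mem_carrier_joinBall.1 hf
  have hmin0 := blockMin_nonneg h0 (A := A)
  refine mem_carrier_joinBall.2 ⟨fun v => ?_, (sum_shift (P.nonempty_of_mem_parts hB) f).trans h1,
    fun v hv => ?_, fun C hC hCB => ?_⟩
  · by_cases hvA : v ∈ A
    · rw [shift_apply_of_mem_left hdisj hvA]
      linarith [blockMin_le f hvA]
    · by_cases hvB : v ∈ B
      · rw [shift_apply_of_mem_right hdisj hvB]
        have := h0 v
        positivity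
      · exact (h0 v).trans_eq (shift_apply_of_notMem hvA hvB f).symm
  · rw [shift_apply_of_notMem (fun h => hv (P.subset hA h)) (fun h => hv (P.subset hB h)), hU v hv]
  · by_cases hCA : C = A
    · rw [hCA, blockMin_of_eq_add (P.nonempty_of_mem_parts hA) fun v hv =>
        shift_apply_of_mem_left hdisj hv f, add_neg_cancel]
    · rw [← hmin C hC hCA, blockMin_of_eq_add (P.nonempty_of_mem_parts hC) (c := 0), add_zero]
      intro v hv
      have hvA : v ∉ A := Finset.disjoint_left.1 (P.disjoint hC hA hCA) hv
      have hvB : v ∉ B := Finset.disjoint_left.1 (P.disjoint hC hB hCB) hv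
      rw [shift_apply_of_notMem hvA hvB, add_zero]

namespace IsFlip

theorem mem_of_not_subset (h : IsFlip P A B X X') {t : Finset V} (ht : t ∈ X.faces)
    (hAt : ¬A ⊆ t) : t ∈ X'.faces := by
  rw [h.faces_eq]
  by_cases htD : t ∈ (joinBall P A).faces
  · refine Or.inr ⟨htD.1, htD.2.1, fun C hC _ => ?_⟩
    by_cases hCA : C = A
    · rwa [hCA]
    · exact htD.2.2 C hC hCA
  · exact Or.inl ⟨ht, htD⟩

theorem symm (h : IsFlip P A B X X') : IsFlip P B A X' X where
  left_mem := h.right_mem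
  right_mem := h.left_mem
  ne := h.ne.symm
  joinBall_le := fun t ht => by
    rw [h.faces_eq]
    exact Or.inr ht
  star_le t ht hB := by
    rw [h.faces_eq] at ht
    exact ht.resolve_left fun ht' => h.not_subset t ht'.1 hB
  not_subset t ht hA := by
    rw [h.faces_eq] at ht
    rcases ht with ht | ht
    · exact ht.2 (h.star_le t ht.1 hA)
    · exact ht.2.2 A h.left_mem h.ne hA
  faces_eq := by
    ext t
    constructor
    · intro ht
      by_cases hA : A ⊆ t
      · exact Or.inr (h.star_le t ht hA)
      · by_cases htB : t ∈ (joinBall P B).faces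
        · refine Or.inr ⟨htB.1, htB.2.1, fun C hC _ => ?_⟩
          by_cases hCB : C = B
          · exact hCB ▸ h.not_subset t ht
          · exact htB.2.2 C hC hCB
        · exact Or.inl ⟨h.mem_of_not_subset ht hA, htB⟩
    · rintro (⟨ht, ht'⟩ | ht)
      · rw [h.faces_eq] at ht
        exact (ht.resolve_right ht').1
      · exact h.joinBall_le ht

theorem isGBM [Fintype V] (h : IsFlip P A B X X') {d : ℕ} (hX : IsPure d X)
    (hd : U.card = d + P.parts.card) : IsGBM d X X' := by
  refine ⟨hX, joinBall P A, joinBall P B, isTriangulatedBall_joinBall h.left_mem hd,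
    isTriangulatedBall_joinBall h.right_mem hd, ?_, ?_, h.joinBall_le, h.faces_eq⟩
  · ext t
    rw [mem_boundary_joinBall h.left_mem hd, mem_boundary_joinBall h.right_mem hd]
  · ext t
    rw [mem_boundary_joinBall h.right_mem hd]
    constructor
    · rintro ⟨hne, hU, ht⟩
      exact ⟨⟨hne, hU, fun C hC _ => ht C hC⟩, h.joinBall_le ⟨hne, hU, fun C hC _ => ht C hC⟩⟩
    · rintro ⟨⟨hne, hU, ht⟩, htX⟩
      refine ⟨hne, hU, fun C hC => ?_⟩
      by_cases hCB : C = B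
      · exact hCB ▸ h.not_subset t htX
      · exact ht C hC hCB

theorem blockMin_eq_zero [Fintype V] (h : IsFlip P A B X X') {f : V → ℝ} (hf : f ∈ carrier X) :
    blockMin B f = 0 := by
  obtain ⟨h0, -, s, hs, hfs⟩ := hf
  obtain ⟨v, hv, hvs⟩ := Finset.not_subset.1 (h.not_subset s hs)
  exact (blockMin_eq_zero_iff (P.nonempty_of_mem_parts h.right_mem) h0).2
    ⟨v, hv, not_not.1 fun hv0 => hvs ((hfs v).1 hv0)⟩

theorem shift_mem_carrier [Fintype V] (h : IsFlip P A B X X') {f : V → ℝ} (hf : f ∈ carrier X) :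
    shift A B f ∈ carrier X' := by
  obtain ⟨h0, h1, s, hs, hfs⟩ := hf
  by_cases hAs : A ⊆ s
  · obtain ⟨h0', h1', t, ht, hft⟩ := shift_mem_carrier_joinBall h.left_mem h.right_mem h.ne
      ⟨h0, h1, s, h.star_le s hs hAs, hfs⟩
    exact ⟨h0', h1', t, h.symm.joinBall_le ht, hft⟩
  · obtain ⟨v, hv, hvs⟩ := Finset.not_subset.1 hAs
    have hmin : blockMin A f = 0 := (blockMin_eq_zero_iff
      (P.nonempty_of_mem_parts h.left_mem) h0).2 ⟨v, hv, not_not.1 fun hv0 => hvs ((hfs v).1 hv0)⟩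
    rw [shift_eq_self hmin]
    exact ⟨h0, h1, s, h.mem_of_not_subset hs hAs, hfs⟩

theorem shift_shift [Fintype V] (h : IsFlip P A B X X') {f : V → ℝ} (hf : f ∈ carrier X) :
    shift B A (shift A B f) = f :=
  SimplicialSurgery.shift_shift (P.nonempty_of_mem_parts h.left_mem)
    (P.nonempty_of_mem_parts h.right_mem) (P.disjoint h.left_mem h.right_mem h.ne)
    (h.blockMin_eq_zero hf)

theorem nonempty_carrier_homeomorph [Fintype V] (h : IsFlip P A B X X') :
    Nonempty (carrier X ≃ₜ carrier X') :=
  nonempty_homeomorph_of_bijOn (continuous_shift A B).continuousOn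
    (Set.InvOn.bijOn ⟨fun _ => h.shift_shift, fun _ => h.symm.shift_shift⟩
      (fun _ => h.shift_mem_carrier) fun _ => h.symm.shift_mem_carrier)

theorem generatedBy {F F' : Set (Finset V)} {d : ℕ} (hA : A ∈ P.parts) (hB : B ∈ P.parts)
    (hAB : A ≠ B) (hd : U.card = d + P.parts.card)
    (hstar : ∀ s ∈ F, A ⊆ s → s ∈ (joinBall P A).faces)
    (hfacet : ∀ s ∈ (joinBall P A).faces, s.card = d + 1 → s ∈ F) (hBF : ∀ s ∈ F, ¬B ⊆ s)
    (hF' : ∀ s, s ∈ F' ↔ (s ∈ F ∧ ¬A ⊆ s) ∨ s ∈ (joinBall P B).faces ∧ s.card = d + 1) :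
    IsFlip P A B (generatedBy F) (generatedBy F') where
  left_mem := hA
  right_mem := hB
  ne := hAB
  joinBall_le t ht := by
    obtain ⟨s, hs, hcard, hts⟩ := exists_facet_of_mem_joinBall hA hd ht
    exact ⟨ht.1, s, hfacet s hs hcard, hts⟩
  star_le := by
    rintro t ⟨hne, s, hs, hts⟩ hAt
    exact (joinBall P A).isRelLowerSet_faces.mem_of_le (hstar s hs (hAt.trans hts)) hts hne
  not_subset := by
    rintro t ⟨-, s, hs, hts⟩ hBt
    exact hBF s hs (hBt.trans hts)
  faces_eq := by
    ext t
    constructor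
    · rintro ⟨hne, s, hs, hts⟩
      by_cases htB : t ∈ (joinBall P B).faces
      · exact Or.inr htB
      rcases (hF' s).1 hs with ⟨hsF, hAs⟩ | ⟨hsB, -⟩
      · refine Or.inl ⟨⟨hne, s, hsF, hts⟩, fun htA => htB ⟨hne, htA.2.1, fun C hC _ => ?_⟩⟩
        by_cases hCA : C = A
        · exact hCA ▸ fun h => hAs (h.trans hts)
        · exact htA.2.2 C hC hCA
      · exact absurd ((joinBall P B).isRelLowerSet_faces.mem_of_le hsB hts hne) htB
    · rintro (⟨⟨hne, s, hs, hts⟩, htA⟩ | htB)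
      · refine ⟨hne, s, (hF' s).2 (Or.inl ⟨hs, fun hAs => htA ?_⟩), hts⟩
        exact (joinBall P A).isRelLowerSet_faces.mem_of_le (hstar s hs hAs) hts hne
      · obtain ⟨s, hs, hcard, hts⟩ := exists_facet_of_mem_joinBall hB hd htB
        exact ⟨htB.1, s, (hF' s).2 (Or.inr ⟨hs, hcard⟩), hts⟩

end IsFlip

end Flip

section Mask

variable {V : Type*} {c : V → ℕ} {a b : ℕ} {l : List V}

/-- The bit mask of a list of vertices, where the vertex `v` is represented by the bit `c v`. The
kernel computes much faster with bit masks than with finite sets. -/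
def mask (c : V → ℕ) (l : List V) : ℕ := l.foldr (fun v m => 2 ^ c v ||| m) 0

theorem testBit_mask (hc : Function.Injective c) {v : V} : (mask c l).testBit (c v) ↔ v ∈ l := by
  induction l with
  | nil => simp [mask]
  | cons w l ih =>
    change (2 ^ c w ||| mask c l).testBit (c v) ↔ _
    rw [Nat.testBit_or, Nat.testBit_two_pow, Bool.or_eq_true, ih, decide_eq_true_iff, hc.eq_iff,
      List.mem_cons, eq_comm]

theorem exists_of_testBit_mask {i : ℕ} (h : (mask c l).testBit i) : ∃ v, c v = i := by
  induction l with
  | nil => simp [mask] at h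
  | cons w l ih =>
    change (2 ^ c w ||| mask c l).testBit i at h
    rw [Nat.testBit_or, Nat.testBit_two_pow, Bool.or_eq_true, decide_eq_true_iff] at h
    exact h.elim (fun h => ⟨w, h⟩) ih

variable [Fintype V]

/-- The set of vertices represented by a bit mask. -/
def ofMask (c : V → ℕ) (m : ℕ) : Finset V := Finset.univ.filter fun v => m.testBit (c v)

theorem mem_ofMask {v : V} : v ∈ ofMask c a ↔ a.testBit (c v) := by
  simp [ofMask]

theorem ofMask_mask [DecidableEq V] (hc : Function.Injective c) (l : List V) :
    ofMask c (mask c l) = l.toFinset := by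
  ext v
  rw [mem_ofMask, testBit_mask hc, List.mem_toFinset]

theorem ofMask_mask_map {W : Type*} [DecidableEq V] [DecidableEq W] (hc : Function.Injective c)
    (f : W → V) (l : List W) : ofMask c (mask c (l.map f)) = l.toFinset.image f := by
  rw [ofMask_mask hc]
  ext
  simp

theorem ofMask_subset_of_land_eq (h : a &&& b = a) : ofMask c a ⊆ ofMask c b := by
  intro v hv
  rw [mem_ofMask, ← h, Nat.testBit_and, Bool.and_eq_true] at hv
  exact mem_ofMask.2 hv.2

theorem mask_land_eq_iff [DecidableEq V] (hc : Function.Injective c) :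
    mask c l &&& b = mask c l ↔ l.toFinset ⊆ ofMask c b := by
  rw [← ofMask_mask hc]
  refine ⟨ofMask_subset_of_land_eq, fun h => Nat.eq_of_testBit_eq fun i => ?_⟩
  rw [Nat.testBit_and]
  by_cases hi : (mask c l).testBit i
  · obtain ⟨v, rfl⟩ := exists_of_testBit_mask hi
    rw [hi, mem_ofMask.1 (h (mem_ofMask.2 hi)), Bool.and_self]
  · rw [Bool.not_eq_true] at hi
    rw [hi, Bool.false_and]

/-- The complex generated by the sets represented by a list of bit masks. -/
def maskComplex (c : V → ℕ) (L : List ℕ) : PreAbstractSimplicialComplex V :=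
  generatedBy {s | ∃ m ∈ L, s = ofMask c m}

theorem mem_maskComplex {L : List ℕ} {t : Finset V} :
    t ∈ (maskComplex c L).faces ↔ t.Nonempty ∧ ∃ m ∈ L, t ⊆ ofMask c m :=
  and_congr_right fun _ => ⟨fun ⟨_, ⟨m, hm, h⟩, ht⟩ => ⟨m, hm, h ▸ ht⟩,
    fun ⟨m, hm, ht⟩ => ⟨_, ⟨m, hm, rfl⟩, ht⟩⟩

theorem vertexSet_maskComplex {L : List ℕ} (h : ∀ v, ∃ m ∈ L, m.testBit (c v) = true) :
    vertexSet (maskComplex c L) = Set.univ := by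
  refine Set.eq_univ_of_forall fun v => ?_
  obtain ⟨m, hm, hv⟩ := h v
  exact mem_maskComplex.2
    ⟨Finset.singleton_nonempty v, m, hm, Finset.singleton_subset_iff.2 (mem_ofMask.2 hv)⟩

theorem maskComplex_congr {L L' : List ℕ} (h : L ⊆ L') (h' : L' ⊆ L) :
    maskComplex c L = maskComplex c L' := by
  ext t
  rw [mem_maskComplex, mem_maskComplex]
  exact and_congr_right fun _ =>
    ⟨fun ⟨m, hm, ht⟩ => ⟨m, h hm, ht⟩, fun ⟨m, hm, ht⟩ => ⟨m, h' hm, ht⟩⟩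

end Mask

section MaskFlip

variable {V : Type*} [DecidableEq V]

/-- The partition whose blocks are given by a list of lists. -/
def partitionOfLists (Bs : List (List V)) (hne : [] ∉ Bs) (hnodup : Bs.flatten.Nodup) :
    Finpartition Bs.flatten.toFinset where
  parts := (Bs.map List.toFinset).toFinset
  supIndep := by
    refine Finset.supIndep_iff_pairwiseDisjoint.2 fun s hs t ht hst => ?_
    simp only [List.coe_toFinset, List.mem_map, Set.mem_ofPred_eq] at hs ht
    obtain ⟨⟨l, hl, rfl⟩, m, hm, rfl⟩ := hs, ht
    have : Std.Symm (List.Disjoint (α := V)) := ⟨fun _ _ => List.Disjoint.symm⟩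
    exact List.disjoint_toFinset_iff_disjoint.2
      ((List.nodup_flatten.1 hnodup).2.forall hl hm fun hlm => hst (hlm ▸ rfl))
  sup_parts := by
    ext v
    simp
  bot_notMem := by
    simpa using hne

variable {Bs : List (List V)} {hne : [] ∉ Bs} {hnodup : Bs.flatten.Nodup}

theorem forall_mem_parts_partitionOfLists {p : Finset V → Prop} :
    (∀ B ∈ (partitionOfLists Bs hne hnodup).parts, p B) ↔ ∀ l ∈ Bs, p l.toFinset := by
  simp [partitionOfLists]

theorem nodup_map_toFinset (hne : [] ∉ Bs) (hnodup : Bs.flatten.Nodup) :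
    (Bs.map List.toFinset).Nodup := by
  refine List.pairwise_map.2 ((List.nodup_flatten.1 hnodup).2.imp_of_mem ?_)
  intro l m hl _ hdisj hlm
  rw [← List.disjoint_toFinset_iff_disjoint, ← hlm, disjoint_self, Finset.bot_eq_empty,
    List.toFinset_eq_empty_iff] at hdisj
  exact hne (hdisj ▸ hl)

theorem card_parts_partitionOfLists :
    (partitionOfLists Bs hne hnodup).parts.card = Bs.length :=
  (List.toFinset_card_of_nodup (nodup_map_toFinset hne hnodup)).trans (List.length_map _)

theorem mem_joinBall_partitionOfLists {A : List V} {Cs : List (List V)} (hBs : Bs.Perm (A :: Cs))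
    {s : Finset V} :
    s ∈ (joinBall (partitionOfLists Bs hne hnodup) A.toFinset).faces ↔
      s.Nonempty ∧ s ⊆ Bs.flatten.toFinset ∧ ∀ C ∈ Cs, ¬C.toFinset ⊆ s := by
  have hA : A.toFinset ∉ Cs.map List.toFinset :=
    (List.nodup_cons.1 ((hBs.map _).nodup (nodup_map_toFinset hne hnodup))).1
  refine and_congr_right fun _ => and_congr_right fun _ => ?_
  rw [forall_mem_parts_partitionOfLists]
  constructor
  · intro h C hC
    refine h C (hBs.mem_iff.2 (List.mem_cons_of_mem A hC)) fun hCA => hA ?_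
    exact hCA ▸ List.mem_map_of_mem hC
  · intro h B hB hBA
    exact h B ((List.mem_cons.1 (hBs.mem_iff.1 hB)).resolve_left fun hBA' => hBA (hBA' ▸ rfl))

/-- The bit masks of the sets of `d + 1` vertices in `U` that contain no member of `Cs`. If `Cs`
consists of the blocks of a partition of `U` other than `A`, these are the facets of `joinBall`. -/
def ballFacets (c : V → ℕ) (d : ℕ) (U : List V) (Cs : List (List V)) : List ℕ :=
  ((U.sublistsLen (d + 1)).map (mask c)).filter fun s => ∀ C ∈ Cs, ¬mask c C &&& s = mask c C

variable [Fintype V] {c : V → ℕ} {d : ℕ}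

theorem exists_mem_ballFacets_iff (hc : Function.Injective c) {A : List V} {Cs : List (List V)}
    (hBs : Bs.Perm (A :: Cs)) {s : Finset V} :
    (∃ m ∈ ballFacets c d Bs.flatten Cs, s = ofMask c m) ↔
      s ∈ (joinBall (partitionOfLists Bs hne hnodup) A.toFinset).faces ∧ s.card = d + 1 := by
  simp only [mem_joinBall_partitionOfLists hBs, ballFacets, List.mem_filter, List.mem_map,
    List.mem_sublistsLen, decide_eq_true_iff, mask_land_eq_iff hc]
  constructor
  · rintro ⟨-, ⟨⟨l, ⟨hl, hlength⟩, rfl⟩, hCs⟩, rfl⟩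
    rw [ofMask_mask hc] at hCs ⊢
    have hcard : l.toFinset.card = d + 1 :=
      (List.toFinset_card_of_nodup (hl.nodup hnodup)).trans hlength
    exact ⟨⟨Finset.card_pos.1 (by omega),
      fun v hv => List.mem_toFinset.2 (hl.subset (List.mem_toFinset.1 hv)), hCs⟩, hcard⟩
  · rintro ⟨⟨-, hsU, hCs⟩, hcard⟩
    have hs : (Bs.flatten.filter (· ∈ s)).toFinset = s := by
      ext v
      simpa only [List.mem_toFinset, List.mem_filter, decide_eq_true_iff, and_iff_right_iff_imp]
        using fun hv => List.mem_toFinset.1 (hsU hv)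
    refine ⟨mask c (Bs.flatten.filter (· ∈ s)), ⟨⟨_, ⟨List.filter_sublist, ?_⟩, rfl⟩, ?_⟩, ?_⟩
    · rw [← List.toFinset_card_of_nodup (hnodup.filter _), hs, hcard]
    · rwa [ofMask_mask hc, hs]
    · rw [ofMask_mask hc, hs]

/-- The blocks of a flip, which replaces `source` by `target`. -/
structure FlipData (V : Type*) where
  source : List V
  target : List V
  others : List (List V)

namespace FlipData

/-- The list of all blocks of a flip. -/
def blocks {V : Type*} (e : FlipData V) : List (List V) := e.source :: e.target :: e.others

/-- The facets after the flip `e` of the `d`-dimensional complex with facets `L`. -/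
def flip (c : V → ℕ) (d : ℕ) (e : FlipData V) (L : List ℕ) : List ℕ :=
  L.filter (fun s => ¬mask c e.source &&& s = mask c e.source) ++
    ballFacets c d e.blocks.flatten (e.source :: e.others)

/-- The conditions under which `e` is a flip of the `d`-dimensional complex with facets `L`. -/
def IsValid (c : V → ℕ) (d : ℕ) (e : FlipData V) (L : List ℕ) : Prop :=
  [] ∉ e.blocks ∧ e.blocks.flatten.Nodup ∧ e.blocks.flatten.length = d + e.blocks.length ∧
  (∀ s ∈ L, (ofMask c s).card = d + 1 ∧ ¬mask c e.target &&& s = mask c e.target ∧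
    (mask c e.source &&& s = mask c e.source →
      s &&& mask c e.blocks.flatten = s ∧ ∀ C ∈ e.others, ¬mask c C &&& s = mask c C)) ∧
  ballFacets c d e.blocks.flatten (e.target :: e.others) ⊆ L

instance (e : FlipData V) (L : List ℕ) : Decidable (e.IsValid c d L) := by
  unfold IsValid
  infer_instance

variable {e : FlipData V} {L : List ℕ}

theorem exists_mem_flip_iff (hc : Function.Injective c) {s : Finset V} :
    (∃ m ∈ e.flip c d L, s = ofMask c m) ↔
      ((∃ m ∈ L, s = ofMask c m) ∧ ¬e.source.toFinset ⊆ s) ∨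
        ∃ m ∈ ballFacets c d e.blocks.flatten (e.source :: e.others), s = ofMask c m := by
  simp only [flip, List.mem_append, List.mem_filter, decide_eq_true_iff, or_and_right, exists_or]
  refine or_congr_left ⟨?_, ?_⟩
  · rintro ⟨m, ⟨hm, hAm⟩, rfl⟩
    exact ⟨⟨m, hm, rfl⟩, mt (mask_land_eq_iff hc).2 hAm⟩
  · rintro ⟨⟨m, hm, rfl⟩, hAm⟩
    exact ⟨m, ⟨hm, mt (mask_land_eq_iff hc).1 hAm⟩, rfl⟩

theorem IsValid.exists_isFlip (hc : Function.Injective c) (h : e.IsValid c d L) :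
    ∃ (U : Finset V) (P : Finpartition U), U.card = d + P.parts.card ∧
      IsFlip P e.source.toFinset e.target.toFinset (maskComplex c L)
        (maskComplex c (e.flip c d L)) := by
  obtain ⟨hne, hnodup, hlength, hL, hfacets⟩ := h
  set P := partitionOfLists e.blocks hne hnodup
  have hparts := forall_mem_parts_partitionOfLists.1 fun B (hB : B ∈ P.parts) => hB
  have hd : e.blocks.flatten.toFinset.card = d + P.parts.card := by
    rw [List.toFinset_card_of_nodup hnodup, hlength, card_parts_partitionOfLists]
  refine ⟨_, P, hd, IsFlip.generatedBy (hparts _ (by simp [blocks])) (hparts _ (by simp [blocks]))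
    ?_ hd ?_ ?_ ?_ fun s => ?_⟩
  · have := nodup_map_toFinset hne hnodup
    simp only [blocks, List.map_cons, List.nodup_cons, List.mem_cons, not_or] at this
    exact this.1.1
  · rintro _ ⟨m, hm, rfl⟩ hAm
    obtain ⟨hcard, hB, hA⟩ := hL m hm
    obtain ⟨hU, hothers⟩ := hA ((mask_land_eq_iff hc).2 hAm)
    have hCm {C : List V} (hC : ¬mask c C &&& m = mask c C) : ¬C.toFinset ⊆ ofMask c m :=
      mt (mask_land_eq_iff hc).2 hC
    refine (mem_joinBall_partitionOfLists (List.Perm.refl e.blocks)).2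
      ⟨Finset.card_pos.1 (by omega), ?_, ?_⟩
    · exact ofMask_mask hc e.blocks.flatten ▸ ofMask_subset_of_land_eq hU
    · exact List.forall_mem_cons.2 ⟨hCm hB, fun C hC => hCm (hothers C hC)⟩
  · intro s hs hcard
    obtain ⟨m, hm, rfl⟩ :=
      (exists_mem_ballFacets_iff hc (List.Perm.refl e.blocks)).2 ⟨hs, hcard⟩
    exact ⟨m, hfacets hm, rfl⟩
  · rintro _ ⟨m, hm, rfl⟩
    exact mt (mask_land_eq_iff hc).2 (hL m hm).2.1
  · have hball := exists_mem_ballFacets_iff (hne := hne) (hnodup := hnodup) (d := d) (s := s) hc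
      (List.Perm.swap e.target e.source e.others : e.blocks.Perm _)
    exact (exists_mem_flip_iff hc).trans (or_congr_right hball)

end FlipData
end MaskFlip

section FlipSequence

variable {V : Type*} [Fintype V] {c : V → ℕ} {d : ℕ} {L : List ℕ}

namespace FlipData

theorem IsValid.isGBM {e : FlipData V} (hc : Function.Injective c) (h : e.IsValid c d L) :
    IsGBM d (maskComplex c L) (maskComplex c (e.flip c d L)) := by
  classical
  obtain ⟨U, P, hd, hflip⟩ := h.exists_isFlip hc
  refine hflip.isGBM (isPure_generatedBy ?_) hd
  rintro _ ⟨m, hm, rfl⟩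
  exact (h.2.2.2.1 m hm).1

/-- The facets after a sequence of flips. -/
def flipAll (c : V → ℕ) (d : ℕ) : List (FlipData V) → List ℕ → List ℕ
  | [], L => L
  | e :: es, L => flipAll c d es (e.flip c d L)

/-- Every member of a sequence is a flip of the result of the preceding flips. -/
def AllValid (c : V → ℕ) (d : ℕ) : List (FlipData V) → List ℕ → Prop
  | [], _ => True
  | e :: es, L => e.IsValid c d L ∧ AllValid c d es (e.flip c d L)

instance decidableAllValid [DecidableEq V] :
    ∀ (es : List (FlipData V)) (L : List ℕ), Decidable (AllValid c d es L)
  | [], _ => instDecidableTrue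
  | _ :: es, _ => @instDecidableAnd _ _ _ (decidableAllValid es _)

theorem AllValid.reflTransGen (hc : Function.Injective c) {es : List (FlipData V)}
    (h : AllValid c d es L) :
    Relation.ReflTransGen (IsGBM d) (maskComplex c L) (maskComplex c (flipAll c d es L)) := by
  induction es generalizing L with
  | nil => exact Relation.ReflTransGen.refl
  | cons e es ih => exact Relation.ReflTransGen.head (h.1.isGBM hc) (ih h.2)

theorem AllValid.nonempty_carrier_homeomorph (hc : Function.Injective c) {es : List (FlipData V)}
    (h : AllValid c d es L) :
    Nonempty (carrier (maskComplex c L) ≃ₜ carrier (maskComplex c (flipAll c d es L))) := by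
  classical
  induction es generalizing L with
  | nil => exact ⟨Homeomorph.refl _⟩
  | cons e es ih =>
    obtain ⟨U, P, -, hflip⟩ := h.1.exists_isFlip hc
    obtain ⟨φ⟩ := hflip.nonempty_carrier_homeomorph
    exact (ih h.2).map φ.trans

end FlipData
end FlipSequence

/-! ## The sixteen-vertex subdivision -/

section Sixteen

/-- The position of the bit representing the vertex `(i, j)`. -/
def code (p : Fin 4 × Fin 4) : ℕ := 4 * p.1 + p.2

theorem code_injective : Function.Injective code := by
  rintro ⟨i, j⟩ ⟨k, l⟩ h
  simp only [code] at h
  ext <;> simp only <;> omega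

/-- The even permutations of the indices, the products of a member of the Klein four-group and a
permutation that fixes the index `3`. -/
def evenPerms : List (Equiv.Perm (Fin 4)) :=
  [1, c[0, 1] * c[2, 3], c[0, 2] * c[1, 3], c[0, 3] * c[1, 2]].flatMap fun a =>
    [1, c[0, 1, 2], c[0, 2, 1]].map (a * ·)

theorem mem_evenPerms : ∀ a : Equiv.Perm (Fin 4), a ∈ evenPerms ↔ a ∈ alternatingGroup (Fin 4) := by
  simp only [Equiv.Perm.mem_alternatingGroup]
  decide +kernel

/-- The basic facets of the complex with sixteen vertices. -/
def basicList16 : List (List (Fin 4 × Fin 4)) :=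
  [[(1, 1), (1, 2), (1, 3), (2, 1), (3, 1)],
   [(1, 1), (1, 2), (1, 4), (2, 1), (3, 1)],
   [(1, 1), (1, 3), (1, 4), (2, 1), (3, 1)],
   [(1, 2), (1, 3), (2, 3), (3, 1), (3, 2)],
   [(1, 2), (1, 4), (2, 1), (2, 4), (3, 1)],
   [(1, 2), (1, 4), (2, 4), (3, 1), (3, 4)],
   [(1, 2), (2, 1), (2, 4), (3, 1), (3, 2)],
   [(1, 2), (2, 4), (3, 1), (3, 2), (3, 4)]]

theorem mem_basicFacets16 {s : Finset (Fin 4 × Fin 4)} :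
    s ∈ basicFacets16 ↔ ∃ l ∈ basicList16, s = l.toFinset := by
  simp [basicFacets16, basicList16]

/-- The facets of the complex with sixteen vertices. -/
def facets16 : List ℕ :=
  evenPerms.flatMap fun a => basicList16.map fun l => mask code (l.map (Prod.map a a))

theorem S16second_eq : S16second = maskComplex code facets16 := by
  ext t
  rw [mem_maskComplex]
  refine and_congr_right fun _ => ?_
  simp only [Set.mem_ofPred_eq, facets16, List.mem_flatMap, List.mem_map, mem_evenPerms,
    mem_basicFacets16]
  constructor
  · rintro ⟨-, ⟨a, ha, -, ⟨l, hl, rfl⟩, rfl⟩, ht⟩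
    exact ⟨_, ⟨a, ha, l, hl, rfl⟩, by rwa [ofMask_mask_map code_injective]⟩
  · rintro ⟨-, ⟨a, ha, l, hl, rfl⟩, ht⟩
    rw [ofMask_mask_map code_injective] at ht
    exact ⟨_, ⟨a, ha, _, ⟨l, hl, rfl⟩, rfl⟩, ht⟩

/-- The flips that lead from sixteen to twelve vertices. The first four replace the three vertices
of a row off the diagonal by three vertices that form a directed cycle; the last four remove the
vertices on the diagonal. -/
def flips : List (FlipData (Fin 4 × Fin 4)) :=
  [⟨row 1, cycle 1, []⟩, ⟨row 2, cycle 2, []⟩, ⟨row 3, cycle 3, []⟩, ⟨row 0, cycle 0, []⟩] ++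
    [1, 2, 3, 0].map fun i => ⟨[(i, i)], row i, [column i]⟩
where
  row (i : Fin 4) : List (Fin 4 × Fin 4) := [(i, i + 1), (i, i + 2), (i, i + 3)]
  column (i : Fin 4) : List (Fin 4 × Fin 4) := [(i + 1, i), (i + 2, i), (i + 3, i)]
  cycle : Fin 4 → List (Fin 4 × Fin 4) :=
    ![[(1, 3), (3, 2), (2, 1)], [(0, 2), (2, 3), (3, 0)], [(1, 0), (0, 3), (3, 1)],
      [(0, 1), (1, 2), (2, 0)]]

theorem allValid_flips : FlipData.AllValid code 4 flips facets16 := by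
  decide +kernel

theorem vertexSet_S16second : vertexSet S16second = Set.univ := by
  rw [S16second_eq]
  exact vertexSet_maskComplex (by decide +kernel)

end Sixteen

section Realization

variable {V E : Type*} [Fintype V] [AddCommGroup E] [Module ℝ E]

theorem convexHull_image_single [DecidableEq V] (s : Set V) :
    convexHull ℝ ((fun v => (Pi.single v 1 : V → ℝ)) '' s) =
      {f ∈ stdSimplex ℝ V | ∀ v, f v ≠ 0 → v ∈ s} := by
  refine (convexHull_min ?_ ?_).antisymm ?_
  · rintro _ ⟨v, hv, rfl⟩
    refine ⟨single_mem_stdSimplex ℝ v, fun w hw => ?_⟩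
    obtain rfl : w = v := not_not.1 fun hwv => hw (Pi.single_eq_of_ne hwv 1)
    exact hv
  · refine fun f hf g hg a b ha hb hab =>
      ⟨convex_stdSimplex ℝ V hf.1 hg.1 ha hb hab, fun v hv => ?_⟩
    by_contra hvs
    have hfv : f v = 0 := not_not.1 (mt (hf.2 v) hvs)
    have hgv : g v = 0 := not_not.1 (mt (hg.2 v) hvs)
    simp [hfv, hgv] at hv
  · rintro f ⟨⟨h0, h1⟩, hs⟩
    classical
    refine (mem_convexHull_iff).2 fun C hC hconv => ?_
    have hsum : f = ∑ v with f v ≠ 0, f v • (Pi.single v 1 : V → ℝ) := by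
      ext w
      simp +contextual [Pi.single_apply]
    rw [hsum]
    exact hconv.sum_mem (fun v _ => h0 v) ((Finset.sum_filter_ne_zero _).trans h1)
      fun v hv => hC ⟨v, hs v (Finset.mem_filter.1 hv).2, rfl⟩

theorem mem_convexHull_image_iff {φ : V → E} {s : Set V} {y : E} :
    y ∈ convexHull ℝ (φ '' s) ↔ ∃ f ∈ stdSimplex ℝ V, (∀ v, f v ≠ 0 → v ∈ s) ∧
      Fintype.linearCombination ℝ φ f = y := by
  classical
  have himage : φ '' s = Fintype.linearCombination ℝ φ '' ((fun v => Pi.single v 1) '' s) := by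
    rw [Set.image_image]
    simp
  rw [himage, ← LinearMap.image_convexHull, convexHull_image_single]
  simp only [Set.mem_image, Set.mem_ofPred_eq, and_assoc]

variable {K : PreAbstractSimplicialComplex V} {φ : V → E}

theorem image_carrier_eq_iUnion (K : PreAbstractSimplicialComplex V) (φ : V → E) :
    Fintype.linearCombination ℝ φ '' carrier K =
      ⋃ t ∈ K.faces, convexHull ℝ (φ '' (t : Set V)) := by
  ext y
  simp only [Set.mem_image, Set.mem_iUnion, mem_convexHull_image_iff, exists_prop]
  constructor
  · rintro ⟨f, ⟨h0, h1, t, ht, hft⟩, hy⟩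
    exact ⟨t, ht, f, ⟨h0, h1⟩, fun v hv => (hft v).1 hv, hy⟩
  · rintro ⟨t, ht, f, ⟨h0, h1⟩, hft, hy⟩
    exact ⟨f, mem_carrier_of_forall h0 h1 ht hft, hy⟩

theorem convexHull_image_inter_subset (h : Set.InjOn (Fintype.linearCombination ℝ φ) (carrier K))
    {t t' : Finset V} (ht : t ∈ K.faces) (ht' : t' ∈ K.faces) {A B : Set V} (hA : A ⊆ t)
    (hB : B ⊆ t') :
    convexHull ℝ (φ '' A) ∩ convexHull ℝ (φ '' B) ⊆ convexHull ℝ (φ '' (A ∩ B)) := by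
  rintro y ⟨hyA, hyB⟩
  obtain ⟨f, ⟨h0, h1⟩, hfA, hfy⟩ := mem_convexHull_image_iff.1 hyA
  obtain ⟨f', ⟨h0', h1'⟩, hfB, hfy'⟩ := mem_convexHull_image_iff.1 hyB
  have hf : f ∈ carrier K := mem_carrier_of_forall h0 h1 ht fun v hv => hA (hfA v hv)
  have hf' : f' ∈ carrier K := mem_carrier_of_forall h0' h1' ht' fun v hv => hB (hfB v hv)
  obtain rfl := h hf hf' (hfy.trans hfy'.symm)
  exact mem_convexHull_image_iff.2 ⟨f, ⟨h0, h1⟩, fun v hv => ⟨hfA v hv, hfB v hv⟩, hfy⟩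

theorem affineIndependent_of_injOn_carrier
    (h : Set.InjOn (Fintype.linearCombination ℝ φ) (carrier K)) {t : Finset V} (ht : t ∈ K.faces) :
    AffineIndependent ℝ fun v : t => φ v := by
  by_contra hdep
  obtain ⟨I, y, hy, hy'⟩ := Convex.radon_partition hdep
  have himage (J : Set t) : (fun v : t => φ v) '' J = φ '' (Subtype.val '' J) :=
    (Set.image_image φ _ J).symm
  have hsub (J : Set t) : Subtype.val '' J ⊆ (t : Set V) := Subtype.coe_image_subset _ J
  rw [himage] at hy hy'
  have := convexHull_image_inter_subset h ht ht (hsub I) (hsub Iᶜ) ⟨hy, hy'⟩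
  rw [← Set.image_inter Subtype.val_injective, Set.inter_compl_self] at this
  simp at this

/-- The geometric simplicial complex formed by the images of the faces of `K` under `φ`, if the
linear extension of `φ` is injective on the carrier. -/
def realization (h : Set.InjOn (Fintype.linearCombination ℝ φ) (carrier K)) :
    Geometry.SimplicialComplex ℝ E where
  faces := {s : Finset E | ∃ t ∈ K.faces, (s : Set E) = φ '' (t : Set V)}
  isRelLowerSet_faces := by
    classical
    rintro s ⟨t, ht, hst⟩
    refine ⟨?_, fun u hus hu => ?_⟩
    · rw [← Finset.coe_nonempty, hst]
      exact (Finset.coe_nonempty.2 (K.isRelLowerSet_faces ht).1).image φ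
    · obtain ⟨r, hr, rfl⟩ := Finset.subset_set_image_iff.1 (hst ▸ Finset.coe_subset.2 hus)
      exact ⟨r, (K.isRelLowerSet_faces ht).2 hr (Finset.image_nonempty.1 hu), Finset.coe_image⟩
  indep := by
    rintro s ⟨t, ht, hst⟩
    refine (affineIndependent_of_injOn_carrier h ht).range.mono ?_
    rw [hst]
    rintro _ ⟨v, hv, rfl⟩
    exact ⟨⟨v, hv⟩, rfl⟩
  inter_subset_convexHull := by
    rintro s s' ⟨t, ht, hst⟩ ⟨t', ht', hst'⟩
    rw [hst, hst']
    exact (convexHull_image_inter_subset h ht ht' subset_rfl subset_rfl).trans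
      (convexHull_mono (Set.image_inter_subset φ _ _))

theorem space_realization (h : Set.InjOn (Fintype.linearCombination ℝ φ) (carrier K)) :
    (realization h).space = Fintype.linearCombination ℝ φ '' carrier K := by
  classical
  ext y
  rw [image_carrier_eq_iUnion, Geometry.SimplicialComplex.mem_space_iff]
  simp only [Set.mem_iUnion, exists_prop]
  constructor
  · rintro ⟨s, ⟨t, ht, hst⟩, hy⟩
    exact ⟨t, ht, hst ▸ hy⟩
  · rintro ⟨t, ht, hy⟩
    exact ⟨t.image φ, ⟨t, ht, Finset.coe_image⟩, by rwa [Finset.coe_image]⟩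

end Realization

section SimplexBoundary

/-- The boundary of the standard simplex with vertex set `ι`. -/
def simplexBoundary (ι : Type*) [Fintype ι] : Set (ι → ℝ) := {p ∈ stdSimplex ℝ ι | ∃ i, p i = 0}

theorem bijOn_coords_frontier {ι E : Type*} [Fintype ι] [NormedAddCommGroup E] [NormedSpace ℝ E]
    (b : AffineBasis ι ℝ E) :
    Set.BijOn b.coords (frontier (convexHull ℝ (Set.range b))) (simplexBoundary ι) := by
  have hclosed : IsClosed (convexHull ℝ (Set.range b)) :=
    ((Set.finite_range b).isCompact_convexHull ℝ).isClosed
  rw [hclosed.frontier_eq, b.interior_convexHull, b.convexHull_eq_nonneg_coord]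
  refine ⟨fun u hu => ⟨⟨hu.1, b.sum_coord_apply_eq_one u⟩, ?_⟩, fun u _ u' _ h => ?_, ?_⟩
  · by_contra! hne
    exact hu.2 fun i => (hu.1 i).lt_of_ne (hne i).symm
  · exact b.ext_elem (congrFun h)
  · rintro p ⟨⟨h0, h1⟩, i, hi⟩
    have hp : ∀ i, b.coord i (Finset.univ.affineCombination ℝ b p) = p i := fun i =>
      b.coord_apply_combination_of_mem (Finset.mem_univ i) h1
    refine ⟨_, ⟨fun i => (h0 i).trans_eq (hp i).symm, fun hpos => ?_⟩, funext hp⟩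
    exact (hpos i).ne' ((hp i).trans hi)

theorem nonempty_simplexBoundary_homeomorph_sphere {ι : Type*} [Fintype ι] {d : ℕ}
    (hι : Fintype.card ι = d + 1) :
    Nonempty (simplexBoundary ι ≃ₜ Metric.sphere (0 : EuclideanSpace ℝ (Fin d)) 1) := by
  obtain ⟨b⟩ := AffineBasis.exists_affineBasis_of_finiteDimensional (ι := ι) (k := ℝ)
    (P := EuclideanSpace ℝ (Fin d)) (by simpa using hι)
  have hcompact := (Set.finite_range b).isCompact_convexHull ℝ
  obtain ⟨e, -, -, he⟩ := exists_homeomorph_image_interior_closure_frontier_eq_unitBall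
    (convex_convexHull ℝ (Set.range b)) ⟨_, b.centroid_mem_interior_convexHull⟩ hcompact.isBounded
  have : CompactSpace (frontier (convexHull ℝ (Set.range b))) :=
    isCompact_iff_compactSpace.1 (hcompact.of_isClosed_subset isClosed_frontier
      hcompact.isClosed.frontier_subset)
  have hcoords : Continuous b.coords := continuous_pi fun i => continuous_barycentric_coord b i
  obtain ⟨e'⟩ := nonempty_homeomorph_of_bijOn hcoords.continuousOn (bijOn_coords_frontier b)
  exact ⟨e'.symm.trans ((e.image _).trans (Homeomorph.setCongr he))⟩

end SimplexBoundary

section Circuit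

variable {ι κ : Type*} [Fintype ι] [Fintype κ] {g : ι → κ → ℝ}

theorem exists_pos_neg_of_sum_eq_zero (hrow : ∀ i, ∑ j, g i j = 0) (hcol : ∀ j, ∑ i, g i j = 0)
    {i : ι} (hi : ∃ j, g i j ≠ 0) : ∃ k j, 0 < g i j ∧ g k j < 0 := by
  obtain ⟨j, hj⟩ := hi
  obtain ⟨j', -, hj'⟩ := Finset.exists_pos_of_sum_zero_of_exists_nonzero _ (hrow i)
    ⟨j, Finset.mem_univ j, hj⟩
  have hneg : ∑ k, -g k j' = 0 := by rw [Finset.sum_neg_distrib, hcol, neg_zero]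
  obtain ⟨k, -, hk⟩ := Finset.exists_pos_of_sum_zero_of_exists_nonzero _ hneg
    ⟨i, Finset.mem_univ i, neg_ne_zero.2 hj'.ne'⟩
  exact ⟨k, j', hj', neg_pos.1 hk⟩

theorem exists_alternating_circuit (hrow : ∀ i, ∑ j, g i j = 0) (hcol : ∀ j, ∑ i, g i j = 0)
    {S : Finset ι} (hS : S.card ≤ 3) (hgS : ∀ i j, g i j ≠ 0 → i ∈ S) (hg : ∃ i j, g i j ≠ 0) :
    (∃ i k j l, 0 < g i j ∧ g k j < 0 ∧ 0 < g k l ∧ g i l < 0) ∨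
      ∃ i k m j l n, i ≠ m ∧ 0 < g i j ∧ g k j < 0 ∧ 0 < g k l ∧ g m l < 0 ∧ 0 < g m n ∧
        g i n < 0 := by
  classical
  choose! F hF using fun i => exists_pos_neg_of_sum_eq_zero hrow hcol (i := i)
  have hnext (i : ι) (hi : ∃ j, g i j ≠ 0) : ∃ j, g (F i) j ≠ 0 := by
    obtain ⟨j, -, hneg⟩ := hF i hi
    exact ⟨j, hneg.ne⟩
  have hmem (i : ι) (hi : ∃ j, g i j ≠ 0) : i ∈ S := hi.elim (hgS i)
  have hne (i : ι) (hi : ∃ j, g i j ≠ 0) : i ≠ F i := by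
    obtain ⟨j, hpos, hneg⟩ := hF i hi
    exact fun h => lt_asymm hpos (h ▸ hneg)
  obtain ⟨i, h0⟩ := hg
  have h1 := hnext _ h0
  have h2 := hnext _ h1
  have hreturn : i = F (F i) ∨ F i = F (F (F i)) ∨ i = F (F (F i)) := by
    by_contra! hcon
    have hcard : ({i, F i, F (F i), F (F (F i))} : Finset ι).card = 4 := by
      rw [Finset.card_insert_of_notMem, Finset.card_insert_of_notMem, Finset.card_pair] <;>
        simp [hne, hcon, h0, h1, h2]
    have hsub : ({i, F i, F (F i), F (F (F i))} : Finset ι) ⊆ S := by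
      simp [Finset.insert_subset_iff, hmem, hnext, h0, h1, h2]
    have := Finset.card_le_card hsub
    omega
  obtain ⟨a, ha, ha'⟩ := hF _ h0
  obtain ⟨b, hb, hb'⟩ := hF _ h1
  obtain ⟨c, hc, hc'⟩ := hF _ h2
  by_cases hik : i = F (F i)
  · exact Or.inl ⟨_, _, a, b, ha, ha', hb, hik ▸ hb'⟩
  · rcases hreturn.resolve_left hik with h | h
    · exact Or.inl ⟨_, _, b, c, hb, hb', hc, h ▸ hc'⟩
    · exact Or.inr ⟨_, _, _, a, b, c, hik, ha, ha', hb, hb', hc, h ▸ hc'⟩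

end Circuit

section Subdivision

theorem toFinset_mem_maskComplex {V : Type*} [Fintype V] [DecidableEq V] {c : V → ℕ}
    (hc : Function.Injective c) {L : List ℕ} {l : List V} :
    l.toFinset ∈ (maskComplex c L).faces ↔ l ≠ [] ∧ ∃ m ∈ L, mask c l &&& m = mask c l := by
  simp only [mem_maskComplex, mask_land_eq_iff hc, List.toFinset_nonempty_iff]

theorem toFinset_mem_S16second {l : List (Fin 4 × Fin 4)} :
    l.toFinset ∈ S16second.faces ↔ l ≠ [] ∧ ∃ m ∈ facets16, mask code l &&& m = mask code l := by
  rw [S16second_eq, toFinset_mem_maskComplex code_injective]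

theorem not_four_circuit_S16second : ∀ i k j l : Fin 4, i ≠ k → j ≠ l →
    [(i, j), (k, l)].toFinset ∈ S16second.faces → [(k, j), (i, l)].toFinset ∉ S16second.faces := by
  simp only [toFinset_mem_S16second]
  decide +kernel

theorem not_six_circuit_S16second :
    ∀ i k m j l n : Fin 4, i ≠ k → k ≠ m → i ≠ m → j ≠ l → l ≠ n → j ≠ n →
      [(i, j), (k, l), (m, n)].toFinset ∈ S16second.faces →
        [(k, j), (m, l), (i, n)].toFinset ∉ S16second.faces := by
  simp only [toFinset_mem_S16second]
  decide +kernel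

theorem exists_row_column_ne_of_mem_facets16 :
    ∀ m ∈ facets16, ∃ i j, ∀ v, m.testBit (code v) → v.1 ≠ i ∧ v.2 ≠ j := by
  decide +kernel

theorem exists_row_column_ne {t : Finset (Fin 4 × Fin 4)} (ht : t ∈ S16second.faces) :
    ∃ i j, ∀ v ∈ t, v.1 ≠ i ∧ v.2 ≠ j := by
  rw [S16second_eq, mem_maskComplex] at ht
  obtain ⟨-, m, hm, htm⟩ := ht
  obtain ⟨i, j, hij⟩ := exists_row_column_ne_of_mem_facets16 m hm
  exact ⟨i, j, fun v hv => hij v (mem_ofMask.1 (htm hv))⟩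

theorem linearCombination_vertexPoint (f : Fin 4 × Fin 4 → ℝ) :
    Fintype.linearCombination ℝ vertexPoint f =
      (fun i => ∑ j, f (i, j), fun j => ∑ i, f (i, j)) := by
  rw [Fintype.linearCombination_apply]
  ext i
  · rw [Prod.fst_sum, Finset.sum_apply, Fintype.sum_prod_type]
    simp [vertexPoint, Pi.single_apply]
  · rw [Prod.snd_sum, Finset.sum_apply, Fintype.sum_prod_type_right]
    simp [vertexPoint, Pi.single_apply]

theorem eq_zero_of_pos_of_neg {g : Fin 4 → Fin 4 → ℝ} (hrow : ∀ i, ∑ j, g i j = 0)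
    (hcol : ∀ j, ∑ i, g i j = 0) {t t' : Finset (Fin 4 × Fin 4)} (ht : t ∈ S16second.faces)
    (ht' : t' ∈ S16second.faces) (hpos : ∀ i j, 0 < g i j → (i, j) ∈ t)
    (hneg : ∀ i j, g i j < 0 → (i, j) ∈ t') : g = 0 := by
  obtain ⟨i₀, j₀, hi₀⟩ := exists_row_column_ne ht
  have hg₀ : ∀ j ∈ Finset.univ, g i₀ j = 0 :=
    (Finset.sum_eq_zero_iff_of_nonpos fun j _ =>
      not_lt.1 fun h => (hi₀ _ (hpos i₀ j h)).1 rfl).1 (hrow i₀)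
  have hface {l : List (Fin 4 × Fin 4)} {s : Finset (Fin 4 × Fin 4)} (hs : s ∈ S16second.faces)
      (hl : l ≠ []) (h : ∀ v ∈ l, v ∈ s) : l.toFinset ∈ S16second.faces :=
    (S16second.isRelLowerSet_faces hs).2 (fun v hv => h v (List.mem_toFinset.1 hv))
      ((List.toFinset_nonempty_iff l).2 hl)
  by_contra hne
  rcases exists_alternating_circuit hrow hcol (S := Finset.univ.erase i₀) (by simp)
      (fun i j h => Finset.mem_erase.2 ⟨by rintro rfl; exact h (hg₀ j (Finset.mem_univ j)),
        Finset.mem_univ i⟩) (by simpa [funext_iff] using hne) with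
    ⟨i, k, j, l, h1, h2, h3, h4⟩ | ⟨i, k, m, j, l, n, him, h1, h2, h3, h4, h5, h6⟩
  · have := hface (l := [(i, j), (k, l)]) ht (by simp) (by simp [hpos, h1, h3])
    have := hface (l := [(k, j), (i, l)]) ht' (by simp) (by simp [hneg, h2, h4])
    grind [not_four_circuit_S16second]
  · have := hface (l := [(i, j), (k, l), (m, n)]) ht (by simp) (by simp [hpos, h1, h3, h5])
    have := hface (l := [(k, j), (m, l), (i, n)]) ht' (by simp) (by simp [hneg, h2, h4, h6])
    grind [not_six_circuit_S16second]

theorem injOn_carrier_S16second :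
    Set.InjOn (Fintype.linearCombination ℝ vertexPoint) (carrier S16second) := by
  rintro f ⟨h0, -, t, ht, hft⟩ f' ⟨h0', -, t', ht', hft'⟩ heq
  simp only [linearCombination_vertexPoint, Prod.mk.injEq, funext_iff] at heq
  have hzero : (fun i j => f (i, j) - f' (i, j)) = 0 :=
    eq_zero_of_pos_of_neg (by simp [heq.1]) (by simp [heq.2]) ht ht'
      (fun i j h => (hft _).1 ((h0' _).trans_lt (sub_pos.1 h)).ne')
      (fun i j h => (hft' _).1 ((h0 _).trans_lt (sub_neg.1 h)).ne')
  exact funext fun v => sub_eq_zero.1 (congrFun₂ hzero v.1 v.2)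

theorem image_mem_S16second {a : Equiv.Perm (Fin 4)} (ha : a ∈ alternatingGroup (Fin 4))
    {t : Finset (Fin 4 × Fin 4)} (ht : t ∈ S16second.faces) :
    t.image (Prod.map a a) ∈ S16second.faces := by
  obtain ⟨hne, _, ⟨a', ha', b, hb, rfl⟩, hts⟩ := ht
  refine ⟨hne.image _, _, ⟨a * a', mul_mem ha ha', b, hb, rfl⟩, ?_⟩
  refine (Finset.image_subset_image hts).trans_eq ?_
  rw [Finset.image_image]
  rfl

/-- The points of the product of two tetrahedra that lie in a simplex of the subdivision. -/
def IsCovered (p q : Fin 4 → ℝ) : Prop :=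
  ∃ t ∈ S16second.faces, (p, q) ∈ convexHull ℝ (vertexPoint '' (t : Set (Fin 4 × Fin 4)))

variable {p q : Fin 4 → ℝ}

theorem isCovered_of_comp {a : Equiv.Perm (Fin 4)} (ha : Equiv.Perm.sign a = 1)
    (h : IsCovered (p ∘ a) (q ∘ a)) : IsCovered p q := by
  obtain ⟨t, ht, hpq⟩ := h
  refine ⟨_, image_mem_S16second (Equiv.Perm.mem_alternatingGroup.2 ha) ht, ?_⟩
  let Λ := (LinearMap.funLeft ℝ ℝ a.symm).prodMap (LinearMap.funLeft ℝ ℝ a.symm)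
  have hΛ (v : Fin 4 × Fin 4) : Λ (vertexPoint v) = vertexPoint (Prod.map a a v) := by
    ext i <;> simp [Λ, vertexPoint, LinearMap.funLeft_apply, Pi.single_apply, Equiv.symm_apply_eq]
  have hmem := Set.mem_image_of_mem Λ hpq
  rw [LinearMap.image_convexHull, Set.image_image] at hmem
  have hpq' : Λ (p ∘ a, q ∘ a) = (p, q) := by
    ext i <;> simp [Λ, LinearMap.funLeft_apply]
  rw [Finset.coe_image, Set.image_image]
  simpa only [hΛ, hpq'] using hmem

theorem isCovered_of_weights (v : Fin 5 → Fin 4 × Fin 4) (c : Fin 5 → ℝ)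
    (hv : ∃ m ∈ facets16, ∀ k, m.testBit (code (v k))) (hc : ∀ k, 0 ≤ c k) (hc1 : ∑ k, c k = 1)
    (hp : ∀ i, (∑ k, if (v k).1 = i then c k else 0) = p i)
    (hq : ∀ j, (∑ k, if (v k).2 = j then c k else 0) = q j) : IsCovered p q := by
  obtain ⟨m, hm, hmv⟩ := hv
  refine ⟨ofMask code m, ?_, ?_⟩
  · rw [S16second_eq, mem_maskComplex]
    exact ⟨⟨v 0, mem_ofMask.2 (hmv 0)⟩, m, hm, subset_rfl⟩
  · refine mem_convexHull_of_exists_fintype c (fun k => vertexPoint (v k)) hc hc1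
      (fun k => ⟨v k, mem_ofMask.2 (hmv k), rfl⟩) ?_
    ext i
    · refine Eq.trans ?_ (hp i)
      rw [Prod.fst_sum, Finset.sum_apply]
      simp [vertexPoint, Pi.single_apply, eq_comm]
    · refine Eq.trans ?_ (hq i)
      rw [Prod.snd_sum, Finset.sum_apply]
      simp [vertexPoint, Pi.single_apply, eq_comm]

theorem comp_mem_stdSimplex {ι : Type*} [Fintype ι] {p : ι → ℝ} (hp : p ∈ stdSimplex ℝ ι)
    (a : Equiv.Perm ι) : p ∘ a ∈ stdSimplex ℝ ι :=
  ⟨fun i => hp.1 (a i), (Equiv.sum_comp a p).trans hp.2⟩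

theorem isCovered_of_one_le (hp : p ∈ stdSimplex ℝ (Fin 4)) (hq : q ∈ stdSimplex ℝ (Fin 4))
    (hp0 : p 0 = 0) (hq0 : q 0 = 0) (h : 1 ≤ p 1 + q 1) : IsCovered p q := by
  obtain ⟨⟨hp, hp1⟩, hq, hq1⟩ := And.intro hp hq
  rw [Fin.sum_univ_four] at hp1 hq1
  refine isCovered_of_weights ![(1, 1), (1, 2), (1, 3), (2, 1), (3, 1)]
    ![p 1 + q 1 - 1, q 2, q 3, p 2, p 3] (by decide +kernel) ?_ ?_ ?_ ?_ <;>
    simp [Fin.forall_fin_succ, Fin.sum_univ_five] <;> grind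

theorem isCovered_of_le (hp : p ∈ stdSimplex ℝ (Fin 4)) (hq : q ∈ stdSimplex ℝ (Fin 4))
    (hp0 : p 0 = 0) (hq0 : q 0 = 0) (h23 : p 2 ≤ q 3) (h13 : q 1 ≤ p 3)
    (h3 : p 3 + q 3 ≤ 1) : IsCovered p q := by
  obtain ⟨⟨hp, hp1⟩, hq, hq1⟩ := And.intro hp hq
  rw [Fin.sum_univ_four] at hp1 hq1
  refine isCovered_of_weights ![(1, 2), (1, 3), (2, 3), (3, 1), (3, 2)]
    ![p 1 - q 3 + p 2, q 3 - p 2, p 2, q 1, p 3 - q 1] (by decide +kernel) ?_ ?_ ?_ ?_ <;>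
    simp [Fin.forall_fin_succ, Fin.sum_univ_five] <;> grind

theorem isCovered_of_diagonal (hp : p ∈ stdSimplex ℝ (Fin 4)) (hq : q ∈ stdSimplex ℝ (Fin 4))
    (hp0 : p 0 = 0) (hq0 : q 0 = 0) : IsCovered p q := by
  by_contra hcon
  have hone (i j k : Fin 4) {a : Equiv.Perm (Fin 4)} (ha : Equiv.Perm.sign a = 1)
      (ha0 : a 0 = 0) (h1 : a 1 = i) (h2 : a 2 = j) (h3 : a 3 = k) :
      p i + q i < 1 ∧ (p j ≤ q k → q i ≤ p k → 1 < p k + q k) := by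
    subst h1 h2 h3
    have hpa := comp_mem_stdSimplex hp a
    have hqa := comp_mem_stdSimplex hq a
    have hpa0 : p (a 0) = 0 := by rw [ha0, hp0]
    have hqa0 : q (a 0) = 0 := by rw [ha0, hq0]
    constructor
    · by_contra! h
      exact hcon (isCovered_of_comp ha (isCovered_of_one_le hpa hqa hpa0 hqa0 h))
    · intro h h'
      by_contra! h''
      exact hcon (isCovered_of_comp ha (isCovered_of_le hpa hqa hpa0 hqa0 h h' h''))
  have h1 := hone 1 2 3 (a := 1) (by decide +kernel) rfl rfl rfl rfl
  have h2 := hone 2 3 1 (a := c[1, 2, 3]) (by decide +kernel) rfl rfl rfl rfl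
  have h3 := hone 3 1 2 (a := c[1, 3, 2]) (by decide +kernel) rfl rfl rfl rfl
  obtain ⟨⟨-, hp1⟩, hq, hq1⟩ := And.intro hp hq
  rw [Fin.sum_univ_four] at hp1 hq1
  grind

theorem isCovered_of_offDiagonal (hp : p ∈ stdSimplex ℝ (Fin 4)) (hq : q ∈ stdSimplex ℝ (Fin 4))
    (hp0 : p 0 = 0) (hq3 : q 3 = 0) : IsCovered p q := by
  obtain ⟨⟨hp, hp1⟩, hq, hq1⟩ := And.intro hp hq
  rw [Fin.sum_univ_four] at hp1 hq1
  rcases le_total (q 2) (p 1) with h21 | h21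
  · rcases le_total (q 1) (p 3) with h13 | h13
    · refine isCovered_of_weights ![(1, 0), (1, 2), (2, 0), (3, 0), (3, 1)]
        ![p 1 - q 2, q 2, p 2, p 3 - q 1, q 1] (by decide +kernel) ?_ ?_ ?_ ?_ <;>
        simp [Fin.forall_fin_succ, Fin.sum_univ_five] <;> grind
    rcases le_total (q 1) (p 2 + p 3) with h123 | h123
    · refine isCovered_of_weights ![(1, 0), (1, 2), (2, 0), (2, 1), (3, 1)]
        ![p 1 - q 2, q 2, p 2 + p 3 - q 1, q 1 - p 3, p 3] (by decide +kernel) ?_ ?_ ?_ ?_ <;>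
        simp [Fin.forall_fin_succ, Fin.sum_univ_five] <;> grind
    · refine isCovered_of_weights ![(1, 0), (1, 1), (1, 2), (2, 1), (3, 1)]
        ![q 0, q 1 - p 2 - p 3, q 2, p 2, p 3] (by decide +kernel) ?_ ?_ ?_ ?_ <;>
        simp [Fin.forall_fin_succ, Fin.sum_univ_five] <;> grind
  · rcases le_total (p 1 + p 3) (q 2) with h132 | h132
    · refine isCovered_of_weights ![(1, 2), (2, 0), (2, 1), (2, 2), (3, 2)]
        ![p 1, q 0, q 1, q 2 - p 1 - p 3, p 3] (by decide +kernel) ?_ ?_ ?_ ?_ <;>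
        simp [Fin.forall_fin_succ, Fin.sum_univ_five] <;> grind
    rcases le_total (p 1 + p 3) (q 1 + q 2) with h1312 | h1312
    · refine isCovered_of_weights ![(1, 2), (2, 0), (2, 1), (3, 1), (3, 2)]
        ![p 1, q 0, q 1 + q 2 - p 1 - p 3, p 1 + p 3 - q 2, q 2 - p 1]
        (by decide +kernel) ?_ ?_ ?_ ?_ <;>
        simp [Fin.forall_fin_succ, Fin.sum_univ_five] <;> grind
    · refine isCovered_of_weights ![(1, 2), (2, 0), (3, 0), (3, 1), (3, 2)]
        ![p 1, p 2, p 1 + p 3 - q 1 - q 2, q 1, q 2 - p 1]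
        (by decide +kernel) ?_ ?_ ?_ ?_ <;>
        simp [Fin.forall_fin_succ, Fin.sum_univ_five] <;> grind

theorem isCovered_of_mem_simplexBoundary (hp : p ∈ simplexBoundary (Fin 4))
    (hq : q ∈ simplexBoundary (Fin 4)) : IsCovered p q := by
  obtain ⟨⟨hp, i, hi⟩, hq, j, hj⟩ := And.intro hp hq
  have hpa := comp_mem_stdSimplex hp
  have hqa := comp_mem_stdSimplex hq
  obtain rfl | hij := eq_or_ne i j
  · obtain ⟨a, ha, rfl⟩ : ∃ a : Equiv.Perm (Fin 4), Equiv.Perm.sign a = 1 ∧ a 0 = i := by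
      clear hi hj
      decide +kernel +revert
    exact isCovered_of_comp ha (isCovered_of_diagonal (hpa a) (hqa a) hi hj)
  · obtain ⟨a, ha, rfl, rfl⟩ : ∃ a : Equiv.Perm (Fin 4), Equiv.Perm.sign a = 1 ∧
        a 0 = i ∧ a 3 = j := by
      clear hi hj
      decide +kernel +revert
    exact isCovered_of_comp ha (isCovered_of_offDiagonal (hpa a) (hqa a) hi hj)

theorem mem_tetraFace {A : Finset (Fin 4)} :
    p ∈ tetraFace A ↔ p ∈ stdSimplex ℝ (Fin 4) ∧ ∀ i, p i ≠ 0 → i ∈ A := by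
  rw [tetraFace, convexHull_image_single]
  rfl

theorem iUnion_tetraFace : (⋃ A ∈ {A : Finset (Fin 4) | A ≠ Finset.univ}, tetraFace A) =
    simplexBoundary (Fin 4) := by
  ext p
  simp only [Set.mem_iUnion, Set.mem_ofPred_eq, mem_tetraFace, exists_prop, simplexBoundary]
  constructor
  · rintro ⟨A, hA, hp, hpA⟩
    refine ⟨hp, ?_⟩
    by_contra! hne
    exact hA (Finset.eq_univ_iff_forall.2 fun i => hpA i (hne i))
  · rintro ⟨hp, i, hi⟩
    refine ⟨{i}ᶜ, by simp, hp, fun j hj => ?_⟩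
    rw [Finset.mem_compl, Finset.mem_singleton]
    exact fun h => hj (h ▸ hi)

theorem exists_convexHull_subset_prod_tetraFace {t : Finset (Fin 4 × Fin 4)}
    (ht : t ∈ S16second.faces) : ∃ A B : Finset (Fin 4), A ≠ Finset.univ ∧ B ≠ Finset.univ ∧
      convexHull ℝ (vertexPoint '' (t : Set (Fin 4 × Fin 4))) ⊆ tetraFace A ×ˢ tetraFace B := by
  obtain ⟨i, j, hij⟩ := exists_row_column_ne ht
  refine ⟨{i}ᶜ, {j}ᶜ, by simp, by simp,
    convexHull_min ?_ ((convex_convexHull ℝ _).prod (convex_convexHull ℝ _))⟩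
  rintro _ ⟨v, hv, rfl⟩
  exact ⟨subset_convexHull ℝ _ ⟨v.1, by simpa using (hij v hv).1, rfl⟩,
    subset_convexHull ℝ _ ⟨v.2, by simpa using (hij v hv).2, rfl⟩⟩

theorem image_carrier_S16second : Fintype.linearCombination ℝ vertexPoint '' carrier S16second =
    simplexBoundary (Fin 4) ×ˢ simplexBoundary (Fin 4) := by
  rw [image_carrier_eq_iUnion]
  refine Set.Subset.antisymm (Set.iUnion₂_subset fun t ht => ?_) fun x hx => ?_
  · obtain ⟨A, B, hA, hB, htAB⟩ := exists_convexHull_subset_prod_tetraFace ht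
    rw [← iUnion_tetraFace]
    exact htAB.trans (Set.prod_mono (Set.subset_biUnion_of_mem hA) (Set.subset_biUnion_of_mem hB))
  · obtain ⟨t, ht, hxt⟩ := isCovered_of_mem_simplexBoundary hx.1 hx.2
    exact Set.mem_iUnion₂.2 ⟨t, ht, hxt⟩

theorem isSubdivisionOfProduct_S16second : IsSubdivisionOfProduct S16second := by
  refine ⟨realization injOn_carrier_S16second, rfl, ?_, ?_⟩
  · rintro s ⟨t, ht, hst⟩
    exact hst ▸ exists_convexHull_subset_prod_tetraFace ht
  · rw [space_realization, image_carrier_S16second, iUnion_tetraFace]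

theorem triangulates_S16second : Triangulates S16second (Sphere2 × Sphere2) := by
  obtain ⟨e⟩ := nonempty_simplexBoundary_homeomorph_sphere (ι := Fin 4) (d := 3) rfl
  have hcont : Continuous (Fintype.linearCombination ℝ vertexPoint) :=
    LinearMap.continuous_of_finiteDimensional _
  obtain ⟨e'⟩ := nonempty_homeomorph_of_bijOn hcont.continuousOn
    (image_carrier_S16second ▸ injOn_carrier_S16second.bijOn_image)
  exact ⟨e'.trans ((Homeomorph.Set.prod _ _).trans (e.prodCongr e))⟩

end Subdivision

/-! ## Uniqueness of antimorphic pairs -/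

section Iso

variable {V W : Type*} {K K₁ K₂ : PreAbstractSimplicialComplex V}
  {L L₁ L₂ : PreAbstractSimplicialComplex W} {e : V ≃ W}

theorem map_symm_map (e : V ≃ W) (s : Finset W) :
    (s.map e.symm.toEmbedding).map e.toEmbedding = s :=
  e.finsetCongr.apply_symm_apply s

theorem IsIso.symm (h : IsIso K L e) : IsIso L K e.symm := by
  intro s
  rw [← h, map_symm_map]

theorem IsIso.trans {U : Type*} {M : PreAbstractSimplicialComplex U} {e' : W ≃ U}
    (h : IsIso K L e) (h' : IsIso L M e') : IsIso K M (e.trans e') := by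
  intro s
  rw [← h, ← h', Finset.map_map]
  rfl

theorem isIso_map [DecidableEq W] (K : PreAbstractSimplicialComplex V) (e : V ≃ W) :
    IsIso K (K.map e) e := by
  intro s
  constructor
  · rintro ⟨t, ht, hts⟩
    rwa [← Finset.map_injective e.toEmbedding ((Finset.map_eq_image _ t).trans hts)]
  · exact fun hs => ⟨s, hs, (Finset.map_eq_image e.toEmbedding s).symm⟩

theorem IsIso.mem_triangles_iff (h : IsIso K L e) {s : Finset V} :
    s.map e.toEmbedding ∈ triangles L ↔ s ∈ triangles K := by
  simp only [triangles, Set.mem_ofPred_eq, h s, Finset.card_map]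

variable [DecidableEq V] [DecidableEq W]

theorem IsIso.adj_iff (h : IsIso K L e) {a b : V} :
    (edgeGraph L).Adj (e a) (e b) ↔ (edgeGraph K).Adj a b :=
  and_congr e.injective.ne_iff (by simpa using h {a, b})

theorem IsIso.corresponds (h₁ : IsIso K₁ L₁ e) (h₂ : IsIso K₂ L₂ e) {s t : Finset V}
    (h : Corresponds K₁ K₂ s t) :
    Corresponds L₁ L₂ (s.map e.toEmbedding) (t.map e.toEmbedding) := by
  obtain ⟨hs, ht, a, b, c, i, j, k, rfl, rfl, haij, hbjk, hcik⟩ := h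
  have map_triple (u v w : V) : ({u, v, w} : Finset V).map e.toEmbedding = {e u, e v, e w} := by
    simp only [Finset.map_insert, Finset.map_singleton, Equiv.coe_toEmbedding]
  refine ⟨h₁.mem_triangles_iff.2 hs, h₂.mem_triangles_iff.2 ht, e a, e b, e c, e i, e j, e k,
    map_triple a b c, map_triple i j k, ?_, ?_, ?_⟩
  · exact map_triple a i j ▸ h₂.mem_triangles_iff.2 haij
  · exact map_triple b j k ▸ h₂.mem_triangles_iff.2 hbjk
  · exact map_triple c i k ▸ h₂.mem_triangles_iff.2 hcik

theorem IsIso.map_mem_pairComplex (h₁ : IsIso K₁ L₁ e) (h₂ : IsIso K₂ L₂ e) {s : Finset V}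
    (hs : s ∈ (pairComplex K₁ K₂).faces) :
    s.map e.toEmbedding ∈ (pairComplex L₁ L₂).faces := by
  obtain ⟨hne, f, hf, hsf⟩ := hs
  refine ⟨hne.map, f.map e.toEmbedding, ?_, Finset.map_subset_map.2 hsf⟩
  rcases hf with ⟨x, hx⟩ | ⟨t, t', ht, y, hy, rfl⟩
  · refine Or.inl ⟨e x, e.forall_congr_right.1 fun y => ?_⟩
    rw [h₁.adj_iff, ← hx]
    exact Finset.mem_map' e.toEmbedding
  · refine Or.inr ⟨_, _, h₁.corresponds h₂ ht, e y, (Finset.mem_map' e.toEmbedding).2 hy, ?_⟩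
    rw [Finset.map_erase, Finset.map_union, Equiv.coe_toEmbedding]

theorem IsIso.pairComplex (h₁ : IsIso K₁ L₁ e) (h₂ : IsIso K₂ L₂ e) :
    IsIso (pairComplex K₁ K₂) (pairComplex L₁ L₂) e := by
  refine fun s => ⟨fun hs => ?_, h₁.map_mem_pairComplex h₂⟩
  exact e.finsetCongr.symm_apply_apply s ▸ h₁.symm.map_mem_pairComplex h₂.symm hs

end Iso

section Flag

theorem dist_eq_two_iff {V : Type*} {G : SimpleGraph V} {a b : V} :
    G.dist a b = 2 ↔ a ≠ b ∧ ¬G.Adj a b ∧ ∃ c, G.Adj a c ∧ G.Adj b c :=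
  (ENat.toNat_eq_iff two_ne_zero).trans SimpleGraph.edist_eq_two_iff

theorem isClique_map_iff {V W : Type*} {e : V ≃ W} {s : Finset V} {G : SimpleGraph V}
    {H : SimpleGraph W} (h : ∀ a b, H.Adj (e a) (e b) ↔ G.Adj a b) :
    H.IsClique (s.map e.toEmbedding) ↔ G.IsClique s := by
  rw [SimpleGraph.IsClique, Finset.coe_map, e.toEmbedding.injective.injOn.pairwise_image]
  exact ⟨fun hs => hs.imp fun a b => (h a b).1, fun hs => hs.imp fun a b => (h a b).2⟩

variable {V W : Type*} [DecidableEq V] [DecidableEq W] {K : PreAbstractSimplicialComplex V}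
  {L : PreAbstractSimplicialComplex W} {e : V ≃ W} {s : Finset V}

/-- A complex is flag if its faces are the nonempty cliques of its edge graph. -/
def IsFlag (K : PreAbstractSimplicialComplex V) : Prop :=
  ∀ s : Finset V, s.Nonempty → (edgeGraph K).IsClique s → s ∈ K.faces

theorem isClique_of_mem_faces (hs : s ∈ K.faces) : (edgeGraph K).IsClique s := by
  refine fun a ha b hb hab => ⟨hab, (K.isRelLowerSet_faces hs).2 ?_ (Finset.insert_nonempty _ _)⟩
  exact Finset.insert_subset ha (Finset.singleton_subset_iff.2 hb)

theorem IsFlag.mem_faces_iff (hK : IsFlag K) :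
    s ∈ K.faces ↔ s.Nonempty ∧ (edgeGraph K).IsClique s :=
  ⟨fun hs => ⟨(K.isRelLowerSet_faces hs).1, isClique_of_mem_faces hs⟩, fun hs => hK s hs.1 hs.2⟩

theorem IsFlag.isIso (hK : IsFlag K) (hL : IsFlag L)
    (h : ∀ a b, (edgeGraph L).Adj (e a) (e b) ↔ (edgeGraph K).Adj a b) : IsIso K L e := by
  intro s
  rw [hL.mem_faces_iff, hK.mem_faces_iff, Finset.map_nonempty, isClique_map_iff h]

theorem IsFlag.of_isIso (hK : IsFlag K) (h : IsIso K L e) : IsFlag L := by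
  intro s hne hs
  rw [← map_symm_map e s, h]
  exact hK _ hne.map ((isClique_map_iff fun _ _ => h.symm.adj_iff).2 hs)

theorem IsFlag.triple_mem_triangles_iff (hK : IsFlag K) {a b c : V} :
    {a, b, c} ∈ triangles K ↔
      (edgeGraph K).Adj a b ∧ (edgeGraph K).Adj a c ∧ (edgeGraph K).Adj b c := by
  rw [← SimpleGraph.is3Clique_triple_iff, SimpleGraph.isNClique_iff]
  refine and_congr_left fun _ => hK.mem_faces_iff.trans (and_iff_right (Finset.insert_nonempty _ _))

theorem IsIso.dist_eq_two_iff (h : IsIso K L e) {a b : V} :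
    (edgeGraph L).dist (e a) (e b) = 2 ↔ (edgeGraph K).dist a b = 2 := by
  simp only [SimplicialSurgery.dist_eq_two_iff, e.injective.ne_iff, h.adj_iff,
    e.surjective.exists]

end Flag

section Icosahedron

/-- Adjacency in the icosahedron, as a Boolean function so that the kernel can evaluate it. -/
def icoAdj : Bool × Option (Fin 5) → Bool × Option (Fin 5) → Bool
  | (_, none), (_, none) => false
  | (b, none), (c, some _) => b == c
  | (b, some _), (c, none) => b == c
  | (true, some i), (true, some j) => i == j + 1 || j == i + 1
  | (false, some i), (false, some j) => i == j + 1 || j == i + 1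
  | (true, some i), (false, some j) => i == j || i == j + 1
  | (false, some i), (true, some j) => i == j || j == i + 1

/-- The antipodal map of the icosahedron. -/
def antipode : Bool × Option (Fin 5) → Bool × Option (Fin 5)
  | (b, none) => (!b, none)
  | (true, some i) => (false, some (i + 2))
  | (false, some i) => (true, some (i + 3))

/-- The relation of being at distance two in the icosahedron, whose graph is again that of an
icosahedron. -/
def icoAdj₂ (a b : Bool × Option (Fin 5)) : Bool := icoAdj a (antipode b)

/-- `s` is one of the twenty triangles generating the icosahedron. -/
def IsIcoTriangle (s : Finset (Bool × Option (Fin 5))) : Prop :=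
  ((∃ (b : Bool) (i : Fin 5), s = {(b, none), (b, some i), (b, some (i + 1))}) ∨
    (∃ i : Fin 5, s = {(true, some i), (true, some (i + 1)), (false, some i)})) ∨
    (∃ i : Fin 5, s = {(false, some i), (false, some (i + 1)), (true, some (i + 1))})

instance : DecidablePred IsIcoTriangle := fun _ => by
  unfold IsIcoTriangle
  infer_instance

theorem mem_faces_icosahedron {s : Finset (Bool × Option (Fin 5))} :
    s ∈ icosahedron.faces ↔ s.Nonempty ∧ ∃ t, IsIcoTriangle t ∧ s ⊆ t := Iff.rfl

theorem IsIcoTriangle.icoAdj {t : Finset (Bool × Option (Fin 5))} (ht : IsIcoTriangle t) :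
    ∀ a ∈ t, ∀ b ∈ t, a ≠ b → icoAdj a b := by
  rcases ht with (⟨b, i, rfl⟩ | ⟨i, rfl⟩) | ⟨i, rfl⟩
  · revert b i
    decide +kernel
  · revert i
    decide +kernel
  · revert i
    decide +kernel

theorem isIcoTriangle_of_icoAdj :
    ∀ a b, icoAdj a b → ∀ c, icoAdj a c → icoAdj b c → IsIcoTriangle {a, b, c} := by
  decide +kernel

theorem exists_icoAdj_icoAdj : ∀ a b, icoAdj a b → ∃ c, icoAdj a c ∧ icoAdj b c := by
  decide +kernel

theorem edgeGraph_icosahedron_adj {a b : Bool × Option (Fin 5)} :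
    (edgeGraph icosahedron).Adj a b ↔ icoAdj a b := by
  constructor
  · rintro ⟨hab, -, t, ht, hsub⟩
    rw [Finset.insert_subset_iff, Finset.singleton_subset_iff] at hsub
    exact IsIcoTriangle.icoAdj ht a hsub.1 b hsub.2 hab
  · intro hab
    have icoAdj_irrefl : ∀ a, icoAdj a a = false := by decide +kernel
    obtain ⟨c, hac, hbc⟩ := exists_icoAdj_icoAdj a b hab
    refine ⟨?_, Finset.insert_nonempty _ _, {a, b, c},
      isIcoTriangle_of_icoAdj a b hab c hac hbc, ?_⟩
    · rintro rfl
      rw [icoAdj_irrefl] at hab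
      cases hab
    · refine Finset.insert_subset_insert a (Finset.singleton_subset_iff.2 ?_)
      exact Finset.mem_insert_self b _

theorem cliqueFree_icosahedron : (edgeGraph icosahedron).CliqueFree 4 := by
  have not_icoAdj : ∀ a b, icoAdj a b → ∀ c, icoAdj a c → icoAdj b c →
      ∀ d, icoAdj a d → icoAdj b d → ¬icoAdj c d := by decide +kernel
  intro s hs
  obtain ⟨a, b, c, d, hab, hac, had, hbc, hbd, hcd, rfl⟩ := Finset.card_eq_four.1 hs.2
  have adj {u v : Bool × Option (Fin 5)} (hu : u ∈ ({a, b, c, d} : Finset _))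
      (hv : v ∈ ({a, b, c, d} : Finset _)) (huv : u ≠ v) : icoAdj u v :=
    edgeGraph_icosahedron_adj.1 (hs.1 hu hv huv)
  exact not_icoAdj a b (adj (by simp) (by simp) hab) c (adj (by simp) (by simp) hac)
    (adj (by simp) (by simp) hbc) d (adj (by simp) (by simp) had) (adj (by simp) (by simp) hbd)
    (adj (by simp) (by simp) hcd)

theorem exists_isNClique_three {V : Type*} {G : SimpleGraph V} (hG : G.CliqueFree 4)
    (exists_adj : ∀ a, ∃ b, G.Adj a b)
    (exists_adj_adj : ∀ a b, G.Adj a b → ∃ c, G.Adj a c ∧ G.Adj b c) {s : Finset V}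
    (hne : s.Nonempty) (hs : G.IsClique s) : ∃ t, G.IsNClique 3 t ∧ s ⊆ t := by
  classical
  have edge_subset (a b : V) (hab : G.Adj a b) : ∃ t, G.IsNClique 3 t ∧ {a, b} ⊆ t := by
    obtain ⟨c, hac, hbc⟩ := exists_adj_adj a b hab
    exact ⟨{a, b, c}, SimpleGraph.is3Clique_triple_iff.2 ⟨hab, hac, hbc⟩,
      Finset.insert_subset_insert a (Finset.singleton_subset_iff.2 (Finset.mem_insert_self b _))⟩
  have hcard : s.card < 4 := by
    by_contra! h
    exact hG.mono h s ⟨hs, rfl⟩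
  have hpos := hne.card_pos
  interval_cases hn : s.card
  · obtain ⟨a, rfl⟩ := Finset.card_eq_one.1 hn
    obtain ⟨b, hab⟩ := exists_adj a
    obtain ⟨t, ht, hst⟩ := edge_subset a b hab
    exact ⟨t, ht, (Finset.singleton_subset_iff.2 (Finset.mem_insert_self a _)).trans hst⟩
  · obtain ⟨a, b, hab, rfl⟩ := Finset.card_eq_two.1 hn
    exact edge_subset a b (hs (by simp) (by simp) hab)
  · exact ⟨s, ⟨hs, hn⟩, subset_rfl⟩

theorem isFlag_icosahedron : IsFlag icosahedron := by
  have exists_icoAdj : ∀ a, ∃ b, icoAdj a b := by decide +kernel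
  intro s hne hs
  obtain ⟨t, ht, hst⟩ := exists_isNClique_three cliqueFree_icosahedron
    (by simpa only [edgeGraph_icosahedron_adj] using exists_icoAdj)
    (by simpa only [edgeGraph_icosahedron_adj] using exists_icoAdj_icoAdj) hne hs
  obtain ⟨a, b, c, hab, hac, hbc, rfl⟩ := SimpleGraph.is3Clique_iff.1 ht
  rw [edgeGraph_icosahedron_adj] at hab hac hbc
  exact mem_faces_icosahedron.2 ⟨hne, _, isIcoTriangle_of_icoAdj a b hab c hac hbc, hst⟩

theorem dist_icosahedron_eq_two_iff {a b : Bool × Option (Fin 5)} :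
    (edgeGraph icosahedron).dist a b = 2 ↔ icoAdj₂ a b := by
  have key : ∀ a b, (a ≠ b ∧ ¬icoAdj a b ∧ ∃ c, icoAdj a c ∧ icoAdj b c) ↔ icoAdj₂ a b := by
    decide +kernel
  rw [dist_eq_two_iff, ← key]
  simp only [edgeGraph_icosahedron_adj]

theorem IsIcosahedron.isFlag {V : Type*} [DecidableEq V] {I : PreAbstractSimplicialComplex V}
    (h : IsIcosahedron I) : IsFlag I := by
  obtain ⟨e, he⟩ := h
  exact isFlag_icosahedron.of_isIso he

end Icosahedron

section AntimorphicPair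

variable {V W : Type*} [DecidableEq V] [DecidableEq W] {I₁ I₂ : PreAbstractSimplicialComplex V}
  {J₁ J₂ : PreAbstractSimplicialComplex W}

theorem IsAntimorphicPair.adj_snd_iff (hI : IsAntimorphicPair I₁ I₂) {a b : V} :
    (edgeGraph I₂).Adj a b ↔ (edgeGraph I₁).dist a b = 2 :=
  SimpleGraph.dist_eq_one_iff_adj.symm.trans (hI.2.2 a b).2.symm

theorem IsAntimorphicPair.isIso_snd (hI : IsAntimorphicPair I₁ I₂)
    (hJ : IsAntimorphicPair J₁ J₂) {e : V ≃ W} (he : IsIso I₁ J₁ e) : IsIso I₂ J₂ e := by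
  refine hI.2.1.isFlag.isIso hJ.2.1.isFlag fun a b => ?_
  rw [hI.adj_snd_iff, hJ.adj_snd_iff, he.dist_eq_two_iff]

theorem IsAntimorphicPair.exists_isIso_pairComplex (hI : IsAntimorphicPair I₁ I₂)
    (hJ : IsAntimorphicPair J₁ J₂) :
    ∃ e : V ≃ W, IsIso (pairComplex I₁ I₂) (pairComplex J₁ J₂) e := by
  obtain ⟨e, he⟩ := hI.1
  obtain ⟨e', he'⟩ := hJ.1
  have h := he.symm.trans he'
  exact ⟨_, h.pairComplex (hI.isIso_snd hJ h)⟩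

/-- The three vertices are pairwise related by `adj`. -/
def isTriangle {α : Type*} (adj : α → α → Bool) (a b c : α) : Bool := adj a b && adj a c && adj b c

/-- The triangle corresponding to a triangle `s` of the icosahedron: the antipodes of the vertices
outside `s` that span a triangle with an edge of `s`. -/
def correspondent (s : Finset (Bool × Option (Fin 5))) : Finset (Bool × Option (Fin 5)) :=
  Finset.univ.filter fun v => antipode v ∉ s ∧ (s.filter fun a => icoAdj₂ a v).card = 2

theorem exists_isTriangle_icoAdj₂ : ∀ a b c, isTriangle icoAdj a b c →
    ∃ i j, isTriangle icoAdj₂ a i j ∧ ∃ k, isTriangle icoAdj₂ b j k ∧ isTriangle icoAdj₂ c i k := by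
  decide +kernel

theorem eq_correspondent : ∀ a b c, isTriangle icoAdj a b c → ∀ i j, isTriangle icoAdj₂ a i j →
    ∀ k, isTriangle icoAdj₂ b j k → isTriangle icoAdj₂ c i k →
      {i, j, k} = correspondent {a, b, c} := by
  decide +kernel

theorem mem_triangles_iff_of_adj_iff {α : Type*} {adj : α → α → Bool} (e : α ≃ V) (hK : IsFlag I₁)
    (h : ∀ a b, (edgeGraph I₁).Adj (e a) (e b) ↔ adj a b) {a b c : α} :
    {e a, e b, e c} ∈ triangles I₁ ↔ isTriangle adj a b c := by
  rw [hK.triple_mem_triangles_iff, h, h, h, isTriangle, Bool.and_eq_true, Bool.and_eq_true,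
    and_assoc]

theorem IsAntimorphicPair.mem_triangles_fst_iff (hI : IsAntimorphicPair I₁ I₂)
    {e : Bool × Option (Fin 5) ≃ V} (he : IsIso icosahedron I₁ e)
    {a b c : Bool × Option (Fin 5)} :
    {e a, e b, e c} ∈ triangles I₁ ↔ isTriangle icoAdj a b c :=
  mem_triangles_iff_of_adj_iff e hI.1.isFlag fun _ _ => he.adj_iff.trans edgeGraph_icosahedron_adj

theorem IsAntimorphicPair.mem_triangles_snd_iff (hI : IsAntimorphicPair I₁ I₂)
    {e : Bool × Option (Fin 5) ≃ V} (he : IsIso icosahedron I₁ e)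
    {a b c : Bool × Option (Fin 5)} :
    {e a, e b, e c} ∈ triangles I₂ ↔ isTriangle icoAdj₂ a b c :=
  mem_triangles_iff_of_adj_iff e hI.2.1.isFlag fun _ _ =>
    (hI.adj_snd_iff.trans he.dist_eq_two_iff).trans dist_icosahedron_eq_two_iff

theorem IsAntimorphicPair.corresponds_iff (hI : IsAntimorphicPair I₁ I₂)
    {e : Bool × Option (Fin 5) ≃ V} (he : IsIso icosahedron I₁ e) {s t : Finset V} :
    Corresponds I₁ I₂ s t ↔ ∃ a b c i j k, isTriangle icoAdj a b c ∧ isTriangle icoAdj₂ a i j ∧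
      isTriangle icoAdj₂ b j k ∧ isTriangle icoAdj₂ c i k ∧
      s = {e a, e b, e c} ∧ t = {e i, e j, e k} := by
  simp only [← hI.mem_triangles_fst_iff he, ← hI.mem_triangles_snd_iff he, e.surjective.exists,
    Corresponds]
  constructor
  · rintro ⟨hs, ht, a, b, c, i, j, k, rfl, rfl, haij, hbjk, hcik⟩
    exact ⟨a, b, c, i, j, k, hs, haij, hbjk, hcik, rfl, rfl⟩
  · rintro ⟨a, b, c, i, j, k, hs, haij, hbjk, hcik, rfl, rfl⟩
    refine ⟨hs, ?_, a, b, c, i, j, k, rfl, rfl, haij, hbjk, hcik⟩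
    rw [hI.2.1.isFlag.triple_mem_triangles_iff] at haij hbjk hcik ⊢
    exact ⟨haij.2.2, hcik.2.2, hbjk.2.2⟩

theorem IsAntimorphicPair.existsUnique_corresponds (hI : IsAntimorphicPair I₁ I₂) {s : Finset V}
    (hs : s ∈ triangles I₁) : ∃! t, Corresponds I₁ I₂ s t := by
  obtain ⟨e, he⟩ := hI.1
  have map_triple (u v w : Bool × Option (Fin 5)) :
      ({e u, e v, e w} : Finset V) = ({u, v, w} : Finset _).map e.toEmbedding := by
    simp only [Finset.map_insert, Finset.map_singleton, Equiv.coe_toEmbedding]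
  have eq_map {t : Finset V} (ht : Corresponds I₁ I₂ s t) :
      t = (correspondent (s.map e.symm.toEmbedding)).map e.toEmbedding := by
    obtain ⟨a, b, c, i, j, k, habc, haij, hbjk, hcik, rfl, rfl⟩ := (hI.corresponds_iff he).1 ht
    rw [map_triple, map_triple, eq_correspondent a b c habc i j haij k hbjk hcik]
    congr 2
    exact (e.finsetCongr.symm_apply_apply _).symm
  obtain ⟨a, b, c, -, -, -, rfl⟩ := Finset.card_eq_three.1 hs.2
  obtain ⟨a, rfl⟩ := e.surjective a
  obtain ⟨b, rfl⟩ := e.surjective b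
  obtain ⟨c, rfl⟩ := e.surjective c
  have habc := (hI.mem_triangles_fst_iff he).1 hs
  obtain ⟨i, j, haij, k, hbjk, hcik⟩ := exists_isTriangle_icoAdj₂ a b c habc
  have ht : Corresponds I₁ I₂ {e a, e b, e c} {e i, e j, e k} :=
    (hI.corresponds_iff he).2 ⟨a, b, c, i, j, k, habc, haij, hbjk, hcik, rfl, rfl⟩
  exact ⟨_, ht, fun t' ht' => (eq_map ht').trans (eq_map ht).symm⟩

end AntimorphicPair

section ExplicitPair

/-- `label₁` as a bijection. -/
noncomputable def labelEquiv₁ : Bool × Option (Fin 5) ≃ OffDiag :=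
  Equiv.ofBijective label₁ (by
    rw [Fintype.bijective_iff_injective_and_card]
    decide +kernel)

/-- `label₂` as a bijection. -/
noncomputable def labelEquiv₂ : Bool × Option (Fin 5) ≃ OffDiag :=
  Equiv.ofBijective label₂ (by
    rw [Fintype.bijective_iff_injective_and_card]
    decide +kernel)

theorem isIso_ico₁ : IsIso icosahedron ico₁ labelEquiv₁ := isIso_map icosahedron labelEquiv₁

theorem isIso_ico₂ : IsIso icosahedron ico₂ labelEquiv₂ := isIso_map icosahedron labelEquiv₂

theorem edgeGraph_ico₁_adj {a b : Bool × Option (Fin 5)} :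
    (edgeGraph ico₁).Adj (labelEquiv₁ a) (labelEquiv₁ b) ↔ icoAdj a b :=
  isIso_ico₁.adj_iff.trans edgeGraph_icosahedron_adj

theorem edgeGraph_ico₂_adj {a b : Bool × Option (Fin 5)} :
    (edgeGraph ico₂).Adj (labelEquiv₁ a) (labelEquiv₁ b) ↔ icoAdj₂ a b := by
  have relabel : ∀ a a', label₂ a' = label₁ a → ∀ b b', label₂ b' = label₁ b →
      (icoAdj a' b' ↔ icoAdj₂ a b) := by decide +kernel
  obtain ⟨a', ha⟩ := labelEquiv₂.surjective (labelEquiv₁ a)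
  obtain ⟨b', hb⟩ := labelEquiv₂.surjective (labelEquiv₁ b)
  rw [← relabel a a' ha b b' hb, ← edgeGraph_icosahedron_adj, ← isIso_ico₂.adj_iff, ha, hb]

theorem isAntimorphicPair_ico : IsAntimorphicPair ico₁ ico₂ := by
  have icoAdj_iff : ∀ a b, icoAdj a b ↔ a ≠ b ∧ ¬icoAdj₂ a b ∧ ∃ c, icoAdj₂ a c ∧ icoAdj₂ b c := by
    decide +kernel
  refine ⟨⟨_, isIso_ico₁⟩, ⟨_, isIso_ico₂⟩, labelEquiv₁.surjective.forall₂.2 fun a b => ⟨?_, ?_⟩⟩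
  · simp only [SimpleGraph.dist_eq_one_iff_adj, dist_eq_two_iff, Equiv.refl_apply,
      labelEquiv₁.injective.ne_iff, labelEquiv₁.surjective.exists, edgeGraph_ico₁_adj,
      edgeGraph_ico₂_adj, icoAdj_iff]
  · rw [SimpleGraph.dist_eq_one_iff_adj]
    exact (isIso_ico₁.dist_eq_two_iff.trans dist_icosahedron_eq_two_iff).trans
      edgeGraph_ico₂_adj.symm

end ExplicitPair

/-! ## Facets and surgery -/

section Facets

/-- The position of the bit representing an off-diagonal vertex. -/
def num (v : OffDiag) : ℕ := code v.1

theorem num_injective : Function.Injective num := code_injective.comp Subtype.val_injective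

/-- The basic facets of the complex with twelve vertices. -/
def basicList12 : List (List OffDiag) :=
  [[x 1 2, x 1 4, x 2 1, x 2 4, x 3 1], [x 1 2, x 1 3, x 1 4, x 2 1, x 3 1]]

theorem mem_basicFacets12 {s : Finset OffDiag} :
    s ∈ basicFacets12 ↔ ∃ l ∈ basicList12, s = l.toFinset := by
  simp [basicFacets12, basicList12]

/-- Elements of the group generated by `g` and `h`. They move the basic facets to all facets. -/
def words : List (Equiv.Perm OffDiag) :=
  (List.range 12).flatMap fun m => (List.range 5).map fun n => g ^ m * h ^ n

/-- The facets of the complex with twelve vertices. -/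
def facetLists12 : List (List OffDiag) :=
  words.flatMap fun γ : Equiv.Perm OffDiag => basicList12.map (List.map γ)

/-- The bit masks of the facets of the complex with twelve vertices. -/
def facets12 : List ℕ := (facetLists12.map (mask num)).dedup

/-- The vertices of the icosahedron. -/
def icoVertices : List (Bool × Option (Fin 5)) :=
  [true, false].flatMap fun b => (b, none) :: (List.finRange 5).map fun i => (b, some i)

theorem mem_icoVertices : ∀ a, a ∈ icoVertices := by decide +kernel

/-- The common neighbours of the vertices in a list. -/
def commonNeighbors (adj : Bool × Option (Fin 5) → Bool × Option (Fin 5) → Bool)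
    (l : List (Bool × Option (Fin 5))) : List (Bool × Option (Fin 5)) :=
  icoVertices.filter fun v => l.all fun w => adj w v

/-- The lists of vertices `a, b, c, i, j, k` such that the triangle `ijk` corresponds to the
triangle `abc`. -/
def icoTuples : List (List (Bool × Option (Fin 5))) :=
  icoVertices.flatMap fun a => (commonNeighbors icoAdj [a]).flatMap fun b =>
    (commonNeighbors icoAdj [a, b]).flatMap fun c =>
      (commonNeighbors icoAdj₂ [a, c]).flatMap fun i =>
        (commonNeighbors icoAdj₂ [a, b, i]).flatMap fun j =>
          (commonNeighbors icoAdj₂ [b, j, c, i]).map fun k => [a, b, c, i, j, k]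

theorem mem_icoTuples {l : List (Bool × Option (Fin 5))} :
    l ∈ icoTuples ↔ ∃ a b c i j k, isTriangle icoAdj a b c ∧ isTriangle icoAdj₂ a i j ∧
      isTriangle icoAdj₂ b j k ∧ isTriangle icoAdj₂ c i k ∧ l = [a, b, c, i, j, k] := by
  simp only [icoTuples, commonNeighbors, List.mem_flatMap, List.mem_map, List.mem_filter,
    mem_icoVertices, true_and, List.all_cons, List.all_nil, Bool.and_true, Bool.and_eq_true,
    isTriangle]
  constructor
  · rintro ⟨a, b, hab, c, ⟨hac, hbc⟩, i, ⟨hai, hci⟩, j, ⟨haj, hbj, hij⟩, k, ⟨hbk, hjk, hck, hik⟩,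
      rfl⟩
    exact ⟨a, b, c, i, j, k, ⟨⟨hab, hac⟩, hbc⟩, ⟨⟨hai, haj⟩, hij⟩, ⟨⟨hbj, hbk⟩, hjk⟩,
      ⟨⟨hci, hck⟩, hik⟩, rfl⟩
  · rintro ⟨a, b, c, i, j, k, ⟨⟨hab, hac⟩, hbc⟩, ⟨⟨hai, haj⟩, hij⟩, ⟨⟨hbj, hbk⟩, hjk⟩,
      ⟨⟨hci, hck⟩, hik⟩, rfl⟩
    exact ⟨a, b, hab, c, ⟨hac, hbc⟩, i, ⟨hai, hci⟩, j, ⟨haj, hbj, hij⟩, k, ⟨hbk, hjk, hck, hik⟩,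
      rfl⟩

/-- The facets of the complex built from the pair of icosahedra, in the vertices of the first
one. -/
def pairFacetLists : List (List (Bool × Option (Fin 5))) :=
  (icoVertices.map fun a => commonNeighbors icoAdj [a]) ++
    icoTuples.flatMap fun l => (l.drop 3).map fun y => l.filter (· ≠ y)

/-- The bit masks of the facets of the complex built from the explicit pair of icosahedra. -/
def pairFacets : List ℕ := pairFacetLists.map fun l => mask num (l.map label₁)

theorem image_toFinset_filter_ne {α β : Type*} [DecidableEq α] [DecidableEq β] (e : α ≃ β)
    (a b c i j k y : α) :
    ([a, b, c, i, j, k].filter (· ≠ y)).toFinset.image e =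
      ({e a, e b, e c} ∪ {e i, e j, e k} : Finset β).erase (e y) := by
  rw [List.toFinset_filter]
  simp only [decide_eq_true_eq, Finset.filter_ne', Finset.image_erase e.injective]
  congr 1
  ext v
  simp only [List.mem_toFinset, List.mem_cons, List.not_mem_nil, Finset.mem_image, Finset.mem_union,
    Finset.mem_insert, Finset.mem_singleton]
  aesop

theorem S12_eq_maskComplex_pairFacets : S12 = maskComplex num pairFacets := by
  refine congrArg generatedBy (Set.ext fun s => ?_)
  have hs : (∃ m ∈ pairFacets, s = ofMask num m) ↔
      ∃ l ∈ pairFacetLists, s = l.toFinset.image labelEquiv₁ := by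
    simp only [pairFacets, List.mem_map, exists_exists_and_eq_and, ofMask_mask_map num_injective]
    rfl
  refine Iff.trans ?_ hs.symm
  simp only [pairFacetLists, List.mem_append, or_and_right, exists_or]
  refine or_congr ?_ ?_
  · simp only [Set.mem_ofPred_eq, List.mem_map, mem_icoVertices, true_and, exists_exists_eq_and,
      labelEquiv₁.surjective.exists, Finset.ext_iff, labelEquiv₁.surjective.forall,
      edgeGraph_ico₁_adj, commonNeighbors, labelEquiv₁.injective.mem_finset_image,
      List.mem_toFinset, List.mem_filter, List.all_cons, List.all_nil, Bool.and_true]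
  · simp only [Set.mem_ofPred_eq, isAntimorphicPair_ico.corresponds_iff isIso_ico₁,
      List.mem_flatMap, List.mem_map, mem_icoTuples]
    constructor
    · rintro ⟨_, _, ⟨a, b, c, i, j, k, h₁, h₂, h₃, h₄, rfl, rfl⟩, _, hv, rfl⟩
      obtain ⟨y, hy, rfl⟩ : ∃ y ∈ [i, j, k], labelEquiv₁ y = _ := by simpa [eq_comm] using hv
      exact ⟨_, ⟨_, ⟨a, b, c, i, j, k, h₁, h₂, h₃, h₄, rfl⟩, y, hy, rfl⟩,
        (image_toFinset_filter_ne ..).symm⟩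
    · rintro ⟨_, ⟨_, ⟨a, b, c, i, j, k, h₁, h₂, h₃, h₄, rfl⟩, y, hy, rfl⟩, rfl⟩
      have hy' : labelEquiv₁ y ∈ [i, j, k].toFinset.image labelEquiv₁ :=
        Finset.mem_image_of_mem _ (List.mem_toFinset.2 hy)
      exact ⟨_, _, ⟨a, b, c, i, j, k, h₁, h₂, h₃, h₄, rfl, rfl⟩, labelEquiv₁ y,
        by simpa using hy', image_toFinset_filter_ne ..⟩

theorem facets12_subset_pairFacets : facets12 ⊆ pairFacets := by decide +kernel

theorem pairFacets_subset_facets12 : pairFacets ⊆ facets12 := by decide +kernel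

theorem S12_eq_maskComplex : S12 = maskComplex num facets12 := by
  rw [S12_eq_maskComplex_pairFacets]
  exact maskComplex_congr pairFacets_subset_facets12 facets12_subset_pairFacets

end Facets

section Surgery

theorem map_generatedBy {V W : Type*} [DecidableEq W] (f : V → W) (F : Set (Finset V)) :
    (generatedBy F).map f = generatedBy (Finset.image f '' F) := by
  ext t
  constructor
  · rintro ⟨s, ⟨hs, r, hr, hsr⟩, rfl⟩
    exact ⟨hs.image f, _, ⟨r, hr, rfl⟩, Finset.image_subset_image hsr⟩
  · rintro ⟨ht, _, ⟨r, hr, rfl⟩, htr⟩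
    obtain ⟨s, hsr, rfl⟩ := Finset.subset_image_iff.1 htr
    exact ⟨s, ⟨Finset.image_nonempty.1 ht, r, hr, hsr⟩, rfl⟩

theorem facets_S12 : {s | ∃ m ∈ facets12, s = ofMask num m} =
    {s | ∃ l ∈ facetLists12, s = l.toFinset} := by
  ext s
  simp only [Set.mem_ofPred_eq, facets12, List.mem_dedup, List.mem_map, exists_exists_and_eq_and,
    ofMask_mask num_injective]

theorem map_S12 : S12.map Subtype.val =
    maskComplex code (facetLists12.map fun l => mask code (l.map Subtype.val)) := by
  rw [S12_eq_maskComplex, maskComplex, facets_S12, map_generatedBy]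
  refine congrArg generatedBy (Set.ext fun s => ?_)
  simp only [Set.mem_image, Set.mem_ofPred_eq, List.mem_map, exists_exists_and_eq_and,
    ofMask_mask_map code_injective]
  exact ⟨fun ⟨_, ⟨l, hl, hs⟩, ht⟩ => ⟨l, hl, hs ▸ ht.symm⟩,
    fun ⟨l, hl, hs⟩ => ⟨_, ⟨l, hl, rfl⟩, hs.symm⟩⟩

theorem map_S12_eq_flipAll :
    S12.map Subtype.val = maskComplex code (FlipData.flipAll code 4 flips facets16) := by
  rw [map_S12]
  apply maskComplex_congr <;> decide +kernel

theorem reflTransGen_isGBM_S16second_S12 :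
    Relation.ReflTransGen (IsGBM 4) S16second (S12.map Subtype.val) := by
  rw [S16second_eq, map_S12_eq_flipAll]
  exact allValid_flips.reflTransGen code_injective

theorem triangulates_S12 : Triangulates S12 (Sphere2 × Sphere2) := by
  obtain ⟨e₁⟩ := nonempty_carrier_map_homeomorph S12 Subtype.val_injective
  obtain ⟨e₂⟩ := allValid_flips.nonempty_carrier_homeomorph code_injective
  obtain ⟨e₃⟩ := triangulates_S16second
  rw [S16second_eq] at e₃
  rw [map_S12_eq_flipAll] at e₁
  exact ⟨e₁.symm.trans (e₂.symm.trans e₃)⟩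

theorem vertexSet_S12 : vertexSet S12 = Set.univ := by
  rw [S12_eq_maskComplex]
  exact vertexSet_maskComplex (by decide +kernel)

end Surgery

/-! ## The automorphism group -/

section FacetCount

variable {V : Type*} {K : PreAbstractSimplicialComplex V} {σ : Equiv.Perm V} {d : ℕ}

theorem mem_aut_of_map_mem_faces [Finite V] (h : ∀ s ∈ K.faces, s.map σ.toEmbedding ∈ K.faces) :
    σ ∈ Aut K := by
  have himage : σ.finsetCongr '' K.faces = K.faces :=
    Set.eq_of_subset_of_ncard_le (Set.image_subset_iff.2 h)
      (Set.ncard_image_of_injective _ σ.finsetCongr.injective).ge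
  intro s
  exact (Set.ext_iff.1 himage _).symm.trans σ.finsetCongr.injective.mem_set_image

/-- The number of `d`-dimensional simplices that contain a given set. -/
noncomputable def facetCount (K : PreAbstractSimplicialComplex V) (d : ℕ) (s : Finset V) : ℕ :=
  {f | f ∈ K.faces ∧ f.card = d + 1 ∧ s ⊆ f}.ncard

theorem facetCount_map (hσ : σ ∈ Aut K) (s : Finset V) :
    facetCount K d (s.map σ.toEmbedding) = facetCount K d s := by
  have hpreimage : {f | f ∈ K.faces ∧ f.card = d + 1 ∧ s ⊆ f} = σ.finsetCongr ⁻¹'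
      {f | f ∈ K.faces ∧ f.card = d + 1 ∧ s.map σ.toEmbedding ⊆ f} := by
    ext f
    simp only [Set.mem_ofPred_eq, Set.mem_preimage, Equiv.finsetCongr_apply, hσ f,
      Finset.card_map, Finset.map_subset_map]
  rw [facetCount, facetCount, hpreimage, Set.ncard_preimage_of_injective_subset_range
    σ.finsetCongr.injective (by simp [σ.finsetCongr.surjective.range_eq])]

theorem facetCount_maskComplex [Fintype V] [DecidableEq V] {c : V → ℕ} (hc : Function.Injective c)
    {Ls : List (List V)} (hLs : ∀ l ∈ Ls, l.toFinset.card = d + 1) (k : List V) :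
    facetCount (maskComplex c (Ls.map (mask c)).dedup) d k.toFinset =
      ((Ls.map (mask c)).dedup.filter fun m => mask c k &&& m = mask c k).length := by
  have hinj : Set.InjOn (ofMask c) (Set.range (mask c)) := by
    rintro _ ⟨l, rfl⟩ _ ⟨l', rfl⟩ h
    rw [ofMask_mask hc] at h
    have h' : l'.toFinset ⊆ ofMask c (mask c l) := by rw [← ofMask_mask hc, ofMask_mask hc l, h]
    rw [← (mask_land_eq_iff hc).2 h.subset, Nat.land_comm, (mask_land_eq_iff hc).2 h']
  rw [← List.toFinset_card_of_nodup ((List.nodup_dedup _).filter _), ← Set.ncard_coe_finset,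
    ← Set.InjOn.ncard_image (hinj.mono _), facetCount]
  · congr 1
    ext f
    simp only [mem_maskComplex, Set.mem_ofPred_eq, List.mem_dedup, List.mem_map, Set.mem_image,
      List.coe_toFinset, List.mem_filter, decide_eq_true_eq, exists_exists_and_eq_and]
    constructor
    · rintro ⟨⟨-, l, hl, hf⟩, hcard, hk⟩
      rw [ofMask_mask hc] at hf
      obtain rfl := Finset.eq_of_subset_of_card_le hf (by rw [hLs l hl, hcard])
      exact ⟨_, ⟨⟨l, hl, rfl⟩, (mask_land_eq_iff hc).2 ((ofMask_mask hc l).symm ▸ hk)⟩,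
        ofMask_mask hc l⟩
    · rintro ⟨_, ⟨⟨l, hl, rfl⟩, hk⟩, rfl⟩
      have hcard : (ofMask c (mask c l)).card = d + 1 := by rw [ofMask_mask hc, hLs l hl]
      exact ⟨⟨Finset.card_pos.1 (by omega), l, hl, subset_rfl⟩, hcard, (mask_land_eq_iff hc).1 hk⟩
  · intro m hm
    obtain ⟨l, -, hl⟩ := List.mem_map.1 (List.mem_dedup.1 (List.mem_filter.1
      (List.mem_toFinset.1 hm)).1)
    exact ⟨l, hl⟩

end FacetCount

section Automorphisms

theorem mem_aut_S12 {γ : Equiv.Perm OffDiag}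
    (hγ : ∀ l ∈ facetLists12, mask num (l.map γ) ∈ facets12) : γ ∈ Aut S12 := by
  refine mem_aut_of_map_mem_faces fun s hs => ?_
  rw [S12_eq_maskComplex, mem_maskComplex] at hs ⊢
  obtain ⟨hs, m, hm, hsm⟩ := hs
  obtain ⟨l, hl, rfl⟩ := List.mem_map.1 (List.mem_dedup.1 hm)
  refine ⟨hs.map, _, hγ l hl, ?_⟩
  rw [ofMask_mask num_injective] at hsm
  rw [ofMask_mask_map num_injective, Finset.map_eq_image]
  exact Finset.image_subset_image hsm

theorem g_mem_aut : g ∈ Aut S12 := mem_aut_S12 (by decide +kernel)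

theorem h_mem_aut : h ∈ Aut S12 := mem_aut_S12 (by decide +kernel)

theorem groupGH_le_aut : groupGH ≤ Aut S12 :=
  (Subgroup.closure_le _).2 (Set.pair_subset g_mem_aut h_mem_aut)

theorem g_mem_groupGH : g ∈ groupGH := Subgroup.subset_closure (Set.mem_insert g {h})

theorem h_mem_groupGH : h ∈ groupGH := Subgroup.subset_closure (Set.mem_insert_of_mem g rfl)

theorem words_subset_groupGH {γ : Equiv.Perm OffDiag} (hγ : γ ∈ words) : γ ∈ groupGH := by
  simp only [words, List.mem_flatMap, List.mem_map] at hγ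
  obtain ⟨m, -, n, -, rfl⟩ := hγ
  exact mul_mem (pow_mem g_mem_groupGH m) (pow_mem h_mem_groupGH n)

theorem mem_S12 {t : Finset OffDiag} :
    t ∈ S12.faces ↔ t.Nonempty ∧ ∃ l ∈ facetLists12, t ⊆ l.toFinset := by
  rw [S12_eq_maskComplex, maskComplex, facets_S12]
  exact and_congr_right fun _ => ⟨fun ⟨_, ⟨l, hl, h⟩, ht⟩ => ⟨l, hl, h ▸ ht⟩,
    fun ⟨l, hl, ht⟩ => ⟨_, ⟨l, hl, rfl⟩, ht⟩⟩

theorem S12_eq_generatedBy_orbits : S12 = generatedBy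
    {s | ∃ γ ∈ groupGH, ∃ b ∈ basicFacets12, s = b.map γ.toEmbedding} := by
  ext t
  constructor
  · intro ht
    obtain ⟨ht, l, hl, htl⟩ := mem_S12.1 ht
    simp only [facetLists12, List.mem_flatMap, List.mem_map] at hl
    obtain ⟨γ, hγ, b, hb, rfl⟩ := hl
    refine ⟨ht, _, ⟨γ, words_subset_groupGH hγ, _, mem_basicFacets12.2 ⟨b, hb, rfl⟩, rfl⟩, ?_⟩
    rwa [← ofMask_mask num_injective, ofMask_mask_map num_injective, ← Equiv.coe_toEmbedding,
      ← Finset.map_eq_image] at htl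
  · rintro ⟨ht, _, ⟨γ, hγ, b, hb, rfl⟩, htb⟩
    refine (S12.isRelLowerSet_faces ((groupGH_le_aut hγ b).2 (mem_S12.2 ?_))).2 htb ht
    obtain ⟨l, hl, rfl⟩ := mem_basicFacets12.1 hb
    have hsub : ∀ l ∈ basicList12, l ∈ facetLists12 ∧ l ≠ [] := by decide +kernel
    exact ⟨(List.toFinset_nonempty_iff l).2 (hsub l hl).2, l, (hsub l hl).1, subset_rfl⟩

end Automorphisms

section AutomorphismGroup

variable {σ : Equiv.Perm OffDiag}

/-- The number of facets of the complex with twelve vertices that contain three given vertices. -/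
def tripleCount (a b c : OffDiag) : ℕ :=
  (facets12.filter fun m => mask num [a, b, c] &&& m = mask num [a, b, c]).length

theorem card_toFinset_of_mem_facetLists12 {l : List OffDiag} (hl : l ∈ facetLists12) :
    l.toFinset.card = 5 := by
  simp only [facetLists12, List.mem_flatMap, List.mem_map] at hl
  obtain ⟨γ, -, b, hb, rfl⟩ := hl
  have hbasic : ∀ b ∈ basicList12, b.Nodup ∧ b.length = 5 := by decide
  rw [List.toFinset_card_of_nodup ((hbasic b hb).1.map γ.injective), List.length_map,
    (hbasic b hb).2]

theorem facetCount_S12 (a b c : OffDiag) :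
    facetCount S12 4 [a, b, c].toFinset = tripleCount a b c := by
  rw [S12_eq_maskComplex]
  exact facetCount_maskComplex num_injective (fun _ => card_toFinset_of_mem_facetLists12) _

theorem tripleCount_map (hσ : σ ∈ Aut S12) (a b c : OffDiag) :
    tripleCount (σ a) (σ b) (σ c) = tripleCount a b c := by
  rw [← facetCount_S12, ← facetCount_S12, ← facetCount_map hσ [a, b, c].toFinset]
  congr 1
  ext
  simp

/-- The vertex `v` is distinguished from all others by the numbers of facets that contain it
together with two vertices from the list `A`, so that automorphisms fixing `A` fix `v`. -/
def IsDeterminedBy (A : List OffDiag) (v : OffDiag) : Prop :=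
  ∀ w, (∀ p ∈ A, ∀ q ∈ A, tripleCount p q w = tripleCount p q v) → w = v

instance (A : List OffDiag) : DecidablePred (IsDeterminedBy A) := by
  unfold IsDeterminedBy
  infer_instance

theorem IsDeterminedBy.apply_eq_self {A : List OffDiag} {v : OffDiag} (hv : IsDeterminedBy A v)
    (hσ : σ ∈ Aut S12) (hA : ∀ a ∈ A, σ a = a) : σ v = v :=
  hv _ fun p hp q hq => by rw [← tripleCount_map hσ p q v, hA p hp, hA q hq]

theorem eq_one_of_mem_aut (hσ : σ ∈ Aut S12) (h₁ : σ (x 2 3) = x 2 3) (h₂ : σ (x 1 2) = x 1 2)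
    (h₃ : σ (x 3 1) = x 3 1) : σ = 1 := by
  have hA : ∀ a ∈ [x 2 3, x 1 2, x 3 1], σ a = a := by simp [h₁, h₂, h₃]
  have hA' : ∀ v ∈ [x 1 4, x 2 4, x 3 4], IsDeterminedBy [x 2 3, x 1 2, x 3 1] v := by
    decide +kernel
  have hB : ∀ v, IsDeterminedBy ([x 2 3, x 1 2, x 3 1] ++ [x 1 4, x 2 4, x 3 4]) v := by
    decide +kernel
  refine Equiv.ext fun v => (hB v).apply_eq_self hσ (List.forall_mem_append.2 ⟨hA, fun v hv => ?_⟩)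
  exact (hA' v hv).apply_eq_self hσ hA

/-- The elements of the group generated by `g` and `h`; the last factor runs through a cyclic
group of order four that fixes the vertex `x 2 3`. -/
def groupElements : List (Equiv.Perm OffDiag) :=
  words.flatMap fun γ => (List.range 4).map fun n => γ * (g ^ 2 * h * g ^ 3) ^ n

theorem groupElements_subset_groupGH {γ : Equiv.Perm OffDiag} (hγ : γ ∈ groupElements) :
    γ ∈ groupGH := by
  simp only [groupElements, List.mem_flatMap, List.mem_map] at hγ
  obtain ⟨δ, hδ, n, -, rfl⟩ := hγ
  refine mul_mem (words_subset_groupGH hδ) (pow_mem (mul_mem (mul_mem ?_ h_mem_groupGH) ?_) n)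
  · exact pow_mem g_mem_groupGH 2
  · exact pow_mem g_mem_groupGH 3

/-- The position of the bit representing a triple of vertices. -/
def tripleCode (p : OffDiag × OffDiag × OffDiag) : ℕ :=
  num p.1 + 16 * num p.2.1 + 256 * num p.2.2

theorem tripleCode_injective : Function.Injective tripleCode := by
  have hnum : ∀ v, num v < 16 := by decide +kernel
  rintro ⟨a, b, c⟩ ⟨a', b', c'⟩ heq
  simp only [tripleCode] at heq
  have ha := hnum a
  have hb := hnum b
  have ha' := hnum a'
  have hb' := hnum b'
  simp only [Prod.mk.injEq, ← num_injective.eq_iff]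
  omega

/-- Three vertices that lie together in exactly three facets. -/
def baseTriple : OffDiag × OffDiag × OffDiag := (x 2 3, x 1 2, x 3 1)

theorem exists_groupElement_of_tripleCount {p : OffDiag × OffDiag × OffDiag}
    (hp : tripleCount p.1 p.2.1 p.2.2 = 3) : ∃ γ ∈ groupElements, γ • baseTriple = p := by
  have hbits : ∀ p : OffDiag × OffDiag × OffDiag, tripleCount p.1 p.2.1 p.2.2 = 3 →
      (mask tripleCode (groupElements.map (· • baseTriple))).testBit (tripleCode p) := by
    decide +kernel
  exact List.mem_map.1 ((testBit_mask tripleCode_injective).1 (hbits p hp))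

theorem mem_groupElements_iff : σ ∈ groupElements ↔ σ ∈ Aut S12 := by
  refine ⟨fun hσ => groupGH_le_aut (groupElements_subset_groupGH hσ), fun hσ => ?_⟩
  obtain ⟨γ, hγ, hγσ⟩ := exists_groupElement_of_tripleCount (p := σ • baseTriple)
    ((tripleCount_map hσ (x 2 3) (x 1 2) (x 3 1)).trans (by decide +kernel))
  have hfix : (γ⁻¹ * σ) • baseTriple = baseTriple := by rw [mul_smul, ← hγσ, inv_smul_smul]
  have hone : γ⁻¹ * σ = 1 :=
    eq_one_of_mem_aut (mul_mem (inv_mem (groupGH_le_aut (groupElements_subset_groupGH hγ))) hσ)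
      (congrArg (·.1) hfix) (congrArg (·.2.1) hfix) (congrArg (·.2.2) hfix)
  rwa [← inv_mul_eq_one.1 hone]

theorem aut_S12_eq : Aut S12 = groupGH :=
  le_antisymm (fun _ hσ => groupElements_subset_groupGH (mem_groupElements_iff.2 hσ)) groupGH_le_aut

theorem nodup_groupElements : groupElements.Nodup :=
  List.Nodup.of_map (fun γ => tripleCode (γ • baseTriple)) (by decide +kernel)

theorem card_aut_S12 : Nat.card (Aut S12) = 240 := by
  have hcoe : (Aut S12 : Set (Equiv.Perm OffDiag)) = groupElements.toFinset := by
    ext σ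
    rw [List.coe_toFinset]
    exact mem_groupElements_iff.symm
  rw [← SetLike.coe_sort_coe, hcoe, Nat.card_eq_card_toFinset, Finset.toFinset_coe,
    List.toFinset_card_of_nodup nodup_groupElements]
  decide +kernel

end AutomorphismGroup

section Induces

variable {G X M C : Type*} [Group G] [MulAction G X] [Group M] [MulAction M C] {F : X → Option C}
  {γ δ : G} {m n : M}

/-- The action of `γ` on `X` permutes the fibres of the partial function `F` as `m` permutes its
values. -/
def Induces (F : X → Option C) (γ : G) (m : M) : Prop :=
  ∀ x, F (γ • x) = (F x).map (m • ·)

theorem induces_one : Induces F (1 : G) (1 : M) := fun x => by simp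

theorem Induces.mul (hγ : Induces F γ m) (hδ : Induces F δ n) : Induces F (γ * δ) (m * n) :=
  fun x => by simp only [mul_smul, hγ (δ • x), hδ x, Option.map_map, Function.comp_def]

theorem Induces.inv (hγ : Induces F γ m) : Induces F γ⁻¹ m⁻¹ := fun x => by
  have := hγ (γ⁻¹ • x)
  rw [smul_inv_smul] at this
  simp [this, Function.comp_def]

variable [FaithfulSMul M C] {S : Set G}

theorem Induces.eq (hF : ∀ c, ∃ x, F x = some c) (hm : Induces F γ m) (hn : Induces F γ n) :
    m = n := by
  refine FaithfulSMul.eq_of_smul_eq_smul (α := C) fun c => ?_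
  obtain ⟨x, hx⟩ := hF c
  simpa [hx] using (hm x).symm.trans (hn x)

theorem exists_monoidHom_of_induces (hF : ∀ c, ∃ x, F x = some c) (hS : Subgroup.closure S = ⊤)
    (h : ∀ γ ∈ S, ∃ m : M, Induces F γ m) :
    ∃ π : G →* M, ∀ γ m, Induces F γ m → π γ = m := by
  have hall (γ : G) : ∃ m : M, Induces F γ m := by
    induction (hS ▸ Subgroup.mem_top γ : γ ∈ Subgroup.closure S) using
      Subgroup.closure_induction with
    | mem γ hγ => exact h γ hγ
    | one => exact ⟨1, induces_one⟩
    | mul γ δ _ _ hγ hδ =>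
      obtain ⟨⟨m, hm⟩, n, hn⟩ := hγ, hδ
      exact ⟨m * n, hm.mul hn⟩
    | inv γ _ hγ =>
      obtain ⟨m, hm⟩ := hγ
      exact ⟨m⁻¹, hm.inv⟩
  choose f hf using hall
  exact ⟨MonoidHom.mk' f fun γ δ => (hf (γ * δ)).eq hF ((hf γ).mul (hf δ)),
    fun γ m hm => (hf γ).eq hF hm⟩

end Induces

section CentralExtension

theorem le_center_of_card_eq_two {G : Type*} [Group G] {N : Subgroup G} [N.Normal]
    (hN : Nat.card N = 2) : N ≤ Subgroup.center G := by
  refine fun z hz => Subgroup.mem_center_iff.2 fun γ => ?_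
  obtain rfl | hz1 := eq_or_ne z 1
  · simp
  obtain ⟨y, -, hy⟩ := (Nat.card_eq_two_iff' (1 : N)).1 hN
  have hzy := hy ⟨z, hz⟩ fun h => hz1 (congrArg Subtype.val h)
  have hconj := hy ⟨γ * z * γ⁻¹, Subgroup.Normal.conj_mem inferInstance z hz γ⟩ fun h =>
    hz1 (conj_eq_one_iff.1 (congrArg Subtype.val h))
  exact mul_inv_eq_iff_eq_mul.1 (congrArg Subtype.val (hconj.trans hzy.symm))

theorem disjoint_ker_of_card_eq_two {G Q A : Type*} [Group G] [Group Q] [Group A] {π : G →* Q}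
    {ρ : G →* A} (hker : Nat.card π.ker = 2) {u : G} (hπu : π u = 1) (hρu : ρ u ≠ 1) :
    Disjoint ρ.ker π.ker := by
  have : Fact (Nat.card π.ker).Prime := ⟨hker ▸ Nat.prime_two⟩
  refine (Subgroup.eq_bot_or_eq_top_of_prime_card (ρ.ker.subgroupOf π.ker)).elim
    Subgroup.subgroupOf_eq_bot.1 fun htop => absurd ?_ hρu
  exact Subgroup.subgroupOf_eq_top.1 htop hπu

-- `G` is the fibre product of `s` and `χ`.
theorem nonempty_comap_ker_mulEquiv_prod {G Q A Z : Type*} [Group G] [Group Q] [Group A] [Group Z]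
    {π : G →* Q} {ρ : G →* A} {s : Q →* Z} {χ : A →* Z} (hcomp : s.comp π = χ.comp ρ)
    (hπ : Function.Surjective π) (hdisj : Disjoint ρ.ker π.ker) (hker : χ.ker ≤ π.ker.map ρ) :
    Nonempty (s.ker.comap π ≃* s.ker × χ.ker) := by
  have hmem (γ : s.ker.comap π) : ρ γ ∈ χ.ker :=
    (DFunLike.congr_fun hcomp γ.1).symm.trans γ.2
  let Φ : s.ker.comap π →* s.ker × χ.ker :=
    ((π.comp (Subgroup.subtype _)).codRestrict _ Subtype.prop).prod
      ((ρ.comp (Subgroup.subtype _)).codRestrict _ hmem)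
  refine ⟨MulEquiv.ofBijective Φ ⟨(injective_iff_map_eq_one Φ).2 fun γ hγ => ?_, ?_⟩⟩
  · have hπγ : π γ = 1 := congrArg (fun p => p.1.1) hγ
    have hργ : ρ γ = 1 := congrArg (fun p => p.2.1) hγ
    exact Subtype.ext (Subgroup.disjoint_def.1 hdisj hργ hπγ)
  · rintro ⟨⟨q, hq⟩, a, ha⟩
    obtain ⟨γ, rfl⟩ := hπ q
    obtain ⟨δ, hδ, hδa⟩ := hker (mul_mem (inv_mem (hmem ⟨γ, hq⟩)) ha)
    have hπδ : π (γ * δ) = π γ := by rw [map_mul, MonoidHom.mem_ker.1 hδ, mul_one]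
    have hρδ : ρ (γ * δ) = a := by rw [map_mul, hδa, mul_inv_cancel_left]
    exact ⟨⟨γ * δ, by rwa [Subgroup.mem_comap, hπδ]⟩,
      Prod.ext (Subtype.ext hπδ) (Subtype.ext hρδ)⟩

end CentralExtension

section Extension

/-- The generator `g` as an automorphism of the complex with twelve vertices. -/
def gAut : Aut S12 := ⟨g, g_mem_aut⟩

/-- The generator `h` as an automorphism of the complex with twelve vertices. -/
def hAut : Aut S12 := ⟨h, h_mem_aut⟩

theorem closure_gAut_hAut : Subgroup.closure {gAut, hAut} = ⊤ := by
  have hmap : (Subgroup.closure {gAut, hAut}).map (Aut S12).subtype = Aut S12 := by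
    rw [MonoidHom.map_closure, Set.image_pair]
    exact aut_S12_eq.symm
  rw [← Subgroup.map_subtype_inj, hmap, ← MonoidHom.range_eq_map, Subgroup.range_subtype]

/-- The six axes of the first icosahedron, as the points of the projective line over `𝔽₅`. -/
def axis (v : OffDiag) : Option (Fin 5) :=
  (icoVertices.find? fun a => label₁ a = v).bind fun a =>
    if a.1 then a.2 else a.2.map (· + 3)

/-- The colour of a pair of distinct axes. The automorphisms act on the axes through
`PGL(2, 5) ≅ S₅`, and the colour classes are the five perfect matchings of an invariant
one-factorization of the complete graph on the axes. -/
def colour (p : OffDiag × OffDiag) : Option (Fin 5) :=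
  match axis p.1, axis p.2 with
  | none, j => j
  | i, none => i
  | some i, some j => if i = j then none else some (3 * (i + j))

/-- The permutation of the colours induced by `g`. -/
def colourG : Equiv.Perm (Fin 5) := Equiv.swap 0 1 * List.formPerm [2, 4, 3]

theorem induces_colour_gAut : Induces colour gAut colourG := by
  have hg : ∀ p, colour (g • p) = (colour p).map (colourG • ·) := by decide +kernel
  exact hg

theorem induces_colour_hAut : Induces colour hAut (finRotate 5) := by
  have hh : ∀ p, colour (h • p) = (colour p).map (finRotate 5 • ·) := by decide +kernel
  exact hh

theorem exists_colourHom :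
    ∃ π : Aut S12 →* Equiv.Perm (Fin 5), π gAut = colourG ∧ π hAut = finRotate 5 := by
  obtain ⟨π, hπ⟩ := exists_monoidHom_of_induces (M := Equiv.Perm (Fin 5)) (F := colour)
    (by decide +kernel) closure_gAut_hAut (by
      rintro _ (rfl | rfl)
      exacts [⟨_, induces_colour_gAut⟩, ⟨_, induces_colour_hAut⟩])
  exact ⟨π, hπ _ _ induces_colour_gAut, hπ _ _ induces_colour_hAut⟩

/-- The positively oriented triangles of the first icosahedron. -/
def orientedTriangles : List (OffDiag × OffDiag × OffDiag) :=
  (List.finRange 5).flatMap fun i =>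
    [((true, none), (true, some i), (true, some (i + 1))),
      ((false, none), (false, some (i + 1)), (false, some i)),
      ((true, some (i + 1)), (true, some i), (false, some i)),
      ((false, some i), (false, some (i + 1)), (true, some (i + 1)))].flatMap
    fun (a, b, c) => [(label₁ a, label₁ b, label₁ c), (label₁ b, label₁ c, label₁ a),
      (label₁ c, label₁ a, label₁ b)]

/-- The exponent of the power of `g` that moves a positively oriented triangle of the first
icosahedron to a given triple of vertices. The automorphism `g` maps `ico₁` to `ico₂`, and `g ^ 2`
reverses the orientation of `ico₁`, so that `g` acts on the four classes of oriented triangles as a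
cycle. -/
def orientation (p : OffDiag × OffDiag × OffDiag) : Option (Multiplicative (ZMod 4)) :=
  (([0, 1, 2, 3] : List (ZMod 4)).find? fun n =>
    (mask tripleCode (orientedTriangles.map (g ^ n.val • ·))).testBit (tripleCode p)).map
      Multiplicative.ofAdd

theorem induces_orientation_gAut :
    Induces orientation gAut (Multiplicative.ofAdd (1 : ZMod 4)) := by
  have hg : ∀ p, orientation (g • p) =
      (orientation p).map (Multiplicative.ofAdd (1 : ZMod 4) • ·) := by decide +kernel
  exact hg

theorem induces_orientation_hAut : Induces orientation hAut (1 : Multiplicative (ZMod 4)) := by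
  have hh : ∀ p, orientation (h • p) =
      (orientation p).map ((1 : Multiplicative (ZMod 4)) • ·) := by decide +kernel
  exact hh

theorem exists_orientationHom : ∃ ρ : Aut S12 →* Multiplicative (ZMod 4),
    ρ gAut = Multiplicative.ofAdd 1 ∧ ρ hAut = 1 := by
  obtain ⟨ρ, hρ⟩ := exists_monoidHom_of_induces (M := Multiplicative (ZMod 4)) (F := orientation)
    (by decide +kernel) closure_gAut_hAut (by
      rintro _ (rfl | rfl)
      exacts [⟨_, induces_orientation_gAut⟩, ⟨_, induces_orientation_hAut⟩])
  exact ⟨ρ, hρ _ _ induces_orientation_gAut, hρ _ _ induces_orientation_hAut⟩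

end Extension

section Structure

variable {π : Aut S12 →* Equiv.Perm (Fin 5)} {ρ : Aut S12 →* Multiplicative (ZMod 4)}

theorem surjective_of_colourHom (hπg : π gAut = colourG) (hπh : π hAut = finRotate 5) :
    Function.Surjective π := by
  rw [← MonoidHom.range_eq_top, eq_top_iff,
    ← Equiv.Perm.closure_prime_cycle_swap (σ := finRotate 5) (τ := Equiv.swap 0 1)
      (by rw [Fintype.card_fin]; exact Nat.prime_five) isCycle_finRotate support_finRotate
      ⟨0, 1, by decide, rfl⟩, Subgroup.closure_le]
  rintro _ (rfl | rfl)
  · exact ⟨hAut, hπh⟩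
  · exact ⟨gAut ^ 3, by rw [map_pow, hπg]; decide +kernel⟩

theorem card_ker_eq_two (hπ : Function.Surjective π) : Nat.card π.ker = 2 := by
  have hcard := Subgroup.card_mul_index π.ker
  rw [Subgroup.index_ker, MonoidHom.range_eq_top.2 hπ, Subgroup.card_top, card_aut_S12,
    Nat.card_perm, Nat.card_fin, show Nat.factorial 5 = 120 from rfl] at hcard
  omega

/-- The character of order two of the cyclic group of order four. -/
def quarterSign : Multiplicative (ZMod 4) →* ℤˣ :=
  MonoidHom.mk' (fun n => (-1) ^ n.toAdd.val) (by decide +kernel)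

theorem sign_comp_eq (hπg : π gAut = colourG) (hπh : π hAut = finRotate 5)
    (hρg : ρ gAut = Multiplicative.ofAdd 1) (hρh : ρ hAut = 1) :
    Equiv.Perm.sign.comp π = quarterSign.comp ρ := by
  refine MonoidHom.eq_of_eqOn_dense closure_gAut_hAut ?_
  rintro _ (rfl | rfl)
  · rw [MonoidHom.comp_apply, MonoidHom.comp_apply, hπg, hρg]
    decide +kernel
  · rw [MonoidHom.comp_apply, MonoidHom.comp_apply, hπh, hρh]
    decide +kernel

-- A preimage of a transposition is not an involution, since its value under `ρ` has order four.
theorem isEmpty_splitting {N : Type*} [Group N]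
    {E : GroupExtension N (Aut S12) (Equiv.Perm (Fin 5))}
    (hsign : Equiv.Perm.sign.comp E.rightHom = quarterSign.comp ρ) : IsEmpty E.Splitting := by
  refine ⟨fun s => ?_⟩
  set t : Equiv.Perm (Fin 5) := Equiv.swap 0 1
  have hρ : ρ (s t) * ρ (s t) = 1 := by
    rw [← map_mul, ← map_mul, Equiv.swap_mul_self, map_one, map_one]
  have hsq : ∀ n, n * n = 1 → quarterSign n = 1 := by decide +kernel
  have ht : Equiv.Perm.sign t = quarterSign (ρ (s t)) := by
    rw [← MonoidHom.comp_apply, ← hsign, MonoidHom.comp_apply, s.rightHom_splitting]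
  rw [hsq _ hρ, Equiv.Perm.sign_swap (by decide)] at ht
  exact absurd ht (by decide)

theorem nonempty_comap_alternatingGroup_mulEquiv (hπ : Function.Surjective π)
    (hsign : Equiv.Perm.sign.comp π = quarterSign.comp ρ) (hπu : π (gAut ^ 6) = 1)
    (hρu : ρ (gAut ^ 6) = Multiplicative.ofAdd 2) :
    Nonempty ((alternatingGroup (Fin 5)).comap π ≃*
      alternatingGroup (Fin 5) × Multiplicative (ZMod 2)) := by
  have hker : quarterSign.ker ≤ π.ker.map ρ := by
    have hmem : ∀ n, quarterSign n = 1 → n = 1 ∨ n = Multiplicative.ofAdd 2 := by decide +kernel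
    intro n hn
    obtain rfl | rfl := hmem n hn
    exacts [one_mem _, ⟨_, hπu, hρu⟩]
  have hdisj := disjoint_ker_of_card_eq_two (card_ker_eq_two hπ) hπu
    (hρu.trans_ne (by decide))
  obtain ⟨e⟩ := nonempty_comap_ker_mulEquiv_prod hsign hπ hdisj hker
  have : Fact (Nat.Prime 2) := ⟨Nat.prime_two⟩
  have hcard : Nat.card quarterSign.ker = 2 := by
    rw [Nat.card_eq_fintype_card]
    decide +kernel
  exact ⟨e.trans ((MulEquiv.refl _).prodCongr (mulEquivOfPrimeCardEq hcard (by simp)))⟩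

theorem exists_extension : ∃ E : GroupExtension (Multiplicative (ZMod 2)) (Aut S12)
    (Equiv.Perm (Fin 5)), E.inl.range ≤ Subgroup.center (Aut S12) ∧ IsEmpty E.Splitting ∧
      Nonempty (Subgroup.comap E.rightHom (alternatingGroup (Fin 5)) ≃*
        alternatingGroup (Fin 5) × Multiplicative (ZMod 2)) := by
  obtain ⟨π, hπg, hπh⟩ := exists_colourHom
  obtain ⟨ρ, hρg, hρh⟩ := exists_orientationHom
  have hsign := sign_comp_eq hπg hπh hρg hρh
  have hsurj := surjective_of_colourHom hπg hπh
  have hker := card_ker_eq_two hsurj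
  have : Fact (Nat.Prime 2) := ⟨Nat.prime_two⟩
  let ι : Multiplicative (ZMod 2) ≃* π.ker := mulEquivOfPrimeCardEq (by simp) hker
  have hrange : (π.ker.subtype.comp ι.toMonoidHom).range = π.ker := by
    rw [MonoidHom.range_comp, MonoidHom.range_eq_top.2 ι.surjective, ← MonoidHom.range_eq_map,
      Subgroup.range_subtype]
  refine ⟨⟨π.ker.subtype.comp ι.toMonoidHom, π, ?_, hrange, hsurj⟩, ?_, ?_, ?_⟩
  · exact (Subgroup.subtype_injective _).comp ι.injective
  · exact hrange.le.trans (le_center_of_card_eq_two hker)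
  · exact isEmpty_splitting hsign
  · exact nonempty_comap_alternatingGroup_mulEquiv hsurj hsign
      (by rw [map_pow, hπg]; decide +kernel) (by rw [map_pow, hρg]; decide +kernel)

end Structure

end SimplicialSurgery

theorem theorem5 :
    -- the complex comes from an antimorphic pair of icosahedra, has twelve vertices,
    -- and consists of the images of two basic facets under the group generated by `g` and `h`
    (IsAntimorphicPair ico₁ ico₂ ∧
      (vertexSet S12).ncard = 12 ∧
      S12 = generatedBy
        {s | ∃ γ ∈ groupGH, ∃ b ∈ basicFacets12,
          s = b.map γ.toEmbedding}) ∧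
    -- for every antimorphic pair the map `φ` is well defined, and up to isomorphism the complex
    -- does not depend on the pair
    (∀ (V : Type*) [DecidableEq V] (I₁ I₂ : PreAbstractSimplicialComplex V),
      IsAntimorphicPair I₁ I₂ →
        (∀ s ∈ triangles I₁, ∃! t, Corresponds I₁ I₂ s t) ∧
        ∃ e : OffDiag ≃ V, IsIso S12
          (pairComplex I₁ I₂) e) ∧
    -- it triangulates the product of two 2-spheres
    Triangulates S12
      (Sphere2 × Sphere2) ∧
    -- it arises from a 16-vertex simplicial subdivision of the product cell complex by a finite
    -- sequence of generalized bistellar moves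
    ((vertexSet S16second).ncard = 16 ∧
      IsSubdivisionOfProduct S16second ∧
      Relation.ReflTransGen (IsGBM 4) S16second
        (S12.map Subtype.val)) ∧
    -- its full automorphism group is generated by `g` and `h`, has order 240, and is a non-split
    -- central extension of `S₅` by `ℤ/2`, the one in which the preimage of `A₅` is `A₅ × ℤ/2`
    (Aut S12 = groupGH ∧
      Nat.card (Aut S12) = 240 ∧
      ∃ E : GroupExtension (Multiplicative (ZMod 2)) (Aut S12)
          (Equiv.Perm (Fin 5)),
        E.inl.range ≤ Subgroup.center (Aut S12) ∧
        IsEmpty E.Splitting ∧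
        Nonempty (Subgroup.comap E.rightHom (alternatingGroup (Fin 5)) ≃*
          alternatingGroup (Fin 5) × Multiplicative (ZMod 2))) := by
  have hcard12 : Nat.card OffDiag = 12 := by
    rw [Nat.card_eq_fintype_card]
    decide +kernel
  have hcard16 : Nat.card (Fin 4 × Fin 4) = 16 := by rw [Nat.card_prod, Nat.card_fin]
  refine ⟨⟨isAntimorphicPair_ico, ?_, S12_eq_generatedBy_orbits⟩, fun V _ I₁ I₂ hI =>
    ⟨fun s hs => hI.existsUnique_corresponds hs, isAntimorphicPair_ico.exists_isIso_pairComplex hI⟩,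
    triangulates_S12, ⟨?_, isSubdivisionOfProduct_S16second, reflTransGen_isGBM_S16second_S12⟩,
    aut_S12_eq, card_aut_S12, exists_extension⟩
  · rw [vertexSet_S12, Set.ncard_univ, hcard12]
  · rw [vertexSet_S16second, Set.ncard_univ, hcard16]
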